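/- **Spaces.** An $\omega$-Stone space is a locally compact, totally disconnected Hausdorff space $W$ whose Boolean ring $\mathrm{Co}(W)$ of compact open subsets is countable (i.e. the Stone space of a countable Boolean ring, possibly without $1$). For $A\in R=\mathrm{Co}(W)$ put $(A)=\{C\in R: C\subseteq A\}$, and let $[A]$ be the isomorphism class of the Boolean ring $(A)$. $A$ is pseudo-indecomposable (PI) if $A\neq\emptyset$ and for every $B\in R$ with $B\subseteq A$ either $(B)\cong(A)$ or $(A-B)\cong(A)$. $W$ is primitive if every element of $R$ is a disjoint union of finitely many PI elements. **PO systems.** A PO system is a set $P$ with an antisymmetric transitive relation $<$ (where $p<p$ is allowed); $p\leqslant q$ means $p<q$ or $p=q$; $P^d=\{p: p\not<p\}$; $p_\uparrow=\{q: p\leqslant q\}$; for $Q\subseteq P$, $Q_\downarrow=\{p: p\leqslant q\text{ for some }q\in Q\}$. $Q$ has a finite foundation if there is a finite $F\subseteq Q_\downarrow$ such that every $r\in Q_\downarrow$ satisfies $p\leqslant r$ for some $p\in F$. $P_\Delta$ is the set of $p\in P$ for which $\{p\}$ has a finite foundation. $P$ is simple if equality is the only equivalence relation $\sim$ on $P$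 such that $q<r$ and $q\sim s$ imply that there is $t$ with $r\sim t$ and $s<t$. For $L\subseteq P$, $L^d_{\min}=L_{\min}\cap P^d$, where $L_{\min}$ is the set of minimal elements of $L$. An extended PO system is a triple $(P,L,f)$ where $P$ is a PO system, $L$ is a lower subset of $P$ contained in $P_\Delta$, and $f\colon L^d_{\min}\to\mathbb N_+$. An isomorphism $(P,L,f)\to(Q,M,g)$ is a PO system isomorphism $\alpha\colon P\to Q$ with $\alpha(L)=M$ and $g(\alpha(p))=f(p)$ for $p\in L^d_{\min}$. $\boldsymbol{EPS}$ denotes the collection of isomorphism classes of countable extended PO systems $(P,L,f)$ with $P$ simple. **Invariants of a primitive $\omega$-Stone space $W$.** $\mathscr S(W)=\{[A]: A\in\mathrm{Co}(W)\text{ is PI}\}$, with $[A]<[B]$ iff $(A)\times(B)\cong(A)$. For $p\in\mathscr S(W)$, $X_p$ is the set of points of $W$ having a neighbourhood base of compact open sets $A$ with $[A]=p$. $L_W=\{p\in\mathscr S(W):\overline{X_p}\text{ is compact}\}$, and $f_W(p)=|X_p|$ for $p\in(L_W)^d_{\min}$. Put $\theta(W)=[(\mathscr S(W),L_W,f_W)]$.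 **Trim partitions.** Let $P$ be a PO system and $\{X_p: p\in P\}$ a family of non-empty pairwise disjoint subsets of $W$ with union $X$. It is a $P$-partition if $X_p'\cap X=\bigcup_{q<p}X_q$ for all $p$, where $X_p'$ is the set of limit points of $X_p$. A compact open $A\subseteq W$ is $p$-trim if $\{q: A\cap X_q\ne\emptyset\}=p_\uparrow$ and, when $p\in P^d$, $|A\cap X_p|=1$. A $P$-partition is trim if every point of $W$ has a neighbourhood base of sets each of which is $p$-trim for some $p$, every point with a neighbourhood base of $p$-trim sets lies in $X_p$, and every point of $X_p$ has a $p$-trim neighbourhood. It is a bounded trim $(P,L,f)$-partition if moreover $\overline{X_p}$ is compact exactly when $p\in L$, $|X_p|=f(p)$ for $p\in L^d_{\min}$, and $\overline{\bigcup_{p\in L}X_p}$ is compact. A primitive $\omega$-Stone space $W$ is finitary if $\mathscr S(W)$ is finite, and bounded if $\{X_p: p\in\mathscr S(W)\}$ is a bounded trim $(\mathscr S(W),L_W,f_W)$-partition of $W$. **Theorem.** The map $\theta\colon W\mapsto[(\mathscr S(W),L_W,f_W)]$ takes primitive $\omega$-Stone spaces to $\boldsymbol{EPS}$ and is surjective onto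 $\boldsymbol{EPS}$. It depends only on the homeomorphism class of $W$, and induces bijections: 1. between the homeomorphism classes of compact primitive $\omega$-Stone spaces and the isomorphism classes $[(P,f)]=[(P,P,f)]$, where $P$ is a countable simple PO system with a finite foundation and $f\colon P^d_{\min}\to\mathbb N_+$; 2. between the homeomorphism classes of finitary $\omega$-Stone spaces and the isomorphism classes $[(P,L,f)]$, where $P$ is a finite simple PO system, $L$ is a lower subset of $P$ and $f\colon L^d_{\min}\to\mathbb N_+$; 3. between the homeomorphism classes of bounded $\omega$-Stone spaces and the isomorphism classes $[(P,L,f)]$, where $P$ is a countable simple PO system, $L$ is a lower subset of $P$ having a finite foundation, and $f\colon L^d_{\min}\to\mathbb N_+$. -/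

import Mathlib

open Set TopologicalSpace Topology

universe u

/-! ### PO systems -/

/-- A PO system: a set with an anti-symmetric transitive relation `≺`; a point may or may
not be related to itself. -/
class POSystem (P : Type u) where
  rel : P → P → Prop
  antisymm : ∀ p q, rel p q → rel q p → p = q
  trans : ∀ p q r, rel p q → rel q r → rel p r

infix:50 " ≺ " => POSystem.rel

namespace POSystem

variable {P : Type u} [POSystem P]

/-- `p ≼ q` iff `p ≺ q` or `p = q`. -/
def le (p q : P) : Prop := p ≺ q ∨ p = q

/-- `Q↓ = {p | p ≼ q for some q ∈ Q}`. -/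
def down (Q : Set P) : Set P := {p | ∃ q ∈ Q, le p q}

/-- `p↑ = {q | p ≼ q}`. -/
def up (p : P) : Set P := {q | le p q}

/-- The elements that are not related to themselves, `P^d`. -/
def disc (P : Type u) [POSystem P] : Set P := {p | ¬ p ≺ p}

/-- `Q` is a lower subset of `P`. -/
def IsLower (Q : Set P) : Prop := ∀ q ∈ Q, ∀ r, le r q → r ∈ Q

/-- `F` is a finite foundation of `Q`. -/
def IsFiniteFoundation (F Q : Set P) : Prop :=
  F.Finite ∧ F ⊆ down Q ∧ ∀ r ∈ down Q, ∃ p ∈ F, le p r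

def HasFiniteFoundation (Q : Set P) : Prop := ∃ F : Set P, IsFiniteFoundation F Q

/-- `P_Δ`, the set of all `p` such that `{p}` has a finite foundation. -/
def Delta (P : Type u) [POSystem P] : Set P := {p | HasFiniteFoundation ({p} : Set P)}

/-- `L_min ∩ P^d`, where `L_min` is the set of minimal elements of `L`. -/
def minDisc (L : Set P) : Set P := {p | p ∈ L ∧ (∀ q ∈ L, le q p → q = p)} ∩ disc P

/-- A congruence relation on a PO system. -/
structure IsCongruence (s : P → P → Prop) : Prop where
  equiv : Equivalence s
  lift : ∀ q r t, q ≺ r → s q t → ∃ v, s r v ∧ t ≺ v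

/-- A PO system is simple if equality is its only congruence relation. -/
def IsSimple (P : Type u) [POSystem P] : Prop :=
  ∀ s : P → P → Prop, IsCongruence s → ∀ p q, s p q → p = q

end POSystem

open POSystem

/-! ### Extended PO systems and their isomorphism classes -/

/-- The data `(P, L, f)` of an extended PO system, the axioms being stated separately in
`POTriple.IsExtended`. The function `f` is allowed to take values in `ℕ∞` here. -/
structure POTriple : Type (u + 1) where
  carrier : Type u
  [sys : POSystem carrier]
  L : Set carrier
  f : minDisc L → ℕ∞

attribute [instance] POTriple.sys

namespace POTriple

/-- `f` takes values in the positive integers. -/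
def PosValued (E : POTriple.{u}) : Prop := ∀ p, ∃ n : ℕ, 0 < n ∧ E.f p = n

/-- `(P, L, f)` is an extended PO system: `L` is a lower subset of `P_Δ` and `f` maps
`L_min ∩ P^d` to the positive integers. -/
def IsExtended (E : POTriple.{u}) : Prop :=
  IsLower E.L ∧ E.L ⊆ Delta E.carrier ∧ E.PosValued

/-- `(P, L, f) ≅ (Q, M, g)`. -/
def Iso (E F : POTriple.{u}) : Prop :=
  ∃ α : E.carrier ≃ F.carrier,
    (∀ p q, p ≺ q ↔ α p ≺ α q) ∧ α '' E.L = F.L ∧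
    ∀ (p : minDisc E.L) (q : minDisc F.L), α p = q → F.f q = E.f p

theorem Iso.refl (E : POTriple.{u}) : Iso E E :=
  ⟨Equiv.refl _, fun _ _ => Iff.rfl, by simp, fun p q h => by
    have : p = q := Subtype.ext h
    rw [this]⟩

theorem Iso.symm {E F : POTriple.{u}} : Iso E F → Iso F E := by
  rintro ⟨α, h1, h2, h3⟩
  refine ⟨α.symm, fun p q => ?_, ?_, fun p q h => ?_⟩
  · rw [h1]; simp
  · rw [← h2]; simp
  · exact (h3 q p (by rw [← h]; simp)).symm

theorem map_minDisc {E F : POTriple.{u}} (α : E.carrier ≃ F.carrier)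
    (h1 : ∀ p q, p ≺ q ↔ α p ≺ α q) (h2 : α '' E.L = F.L) {p : E.carrier}
    (hp : p ∈ minDisc E.L) : α p ∈ minDisc F.L := by
  obtain ⟨⟨hL, hm⟩, hd⟩ := hp
  refine ⟨⟨h2 ▸ mem_image_of_mem _ hL, fun q hq hle => ?_⟩, fun h => hd ((h1 _ _).2 h)⟩
  rw [← h2] at hq
  obtain ⟨r, hr, rfl⟩ := hq
  rw [hm r hr]
  rcases hle with h | h
  · exact Or.inl ((h1 _ _).2 h)
  · exact Or.inr (α.injective h)

theorem Iso.trans {E F G : POTriple.{u}} : Iso E F → Iso F G → Iso E G := by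
  rintro ⟨α, h1, h2, h3⟩ ⟨β, k1, k2, k3⟩
  refine ⟨α.trans β, fun p q => (h1 p q).trans (k1 _ _), ?_, fun p r h => ?_⟩
  · rw [← k2, ← h2, image_image]; rfl
  · have hq : α p ∈ minDisc F.L := map_minDisc α h1 h2 p.2
    rw [k3 ⟨α p, hq⟩ r h, h3 p ⟨α p, hq⟩ rfl]

instance isoSetoid : Setoid POTriple.{u} where
  r := Iso
  iseqv := ⟨Iso.refl, Iso.symm, Iso.trans⟩

end POTriple

/-- Isomorphism classes of triples `(P, L, f)`. -/
abbrev POTripleClass : Type (u + 1) := Quotient POTriple.isoSetoid.{u}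

/-- The isomorphism classes of countable extended PO systems `(P, L, f)` with `P` simple. -/
def EPS : Set POTripleClass.{u} :=
  {c | ∃ E : POTriple.{u}, E.IsExtended ∧ Countable E.carrier ∧ IsSimple E.carrier ∧ ⟦E⟧ = c}

/-! ### Partitions of a space indexed by a PO system -/

section Partitions

variable {W : Type u} [TopologicalSpace W] {P : Type u} [POSystem P]

/-- `{X_p | p ∈ P}*` is a `P`-partition of `W`: the `X_p` are non-empty and pairwise disjoint
with union `X`, and `X_p' ∩ X` is the union of the `X_q` with `q ≺ p`. -/
structure IsPOPartition (X : P → Set W) : Prop where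
  nonempty : ∀ p, (X p).Nonempty
  disjoint : ∀ p q, p ≠ q → Disjoint (X p) (X q)
  derived : ∀ p, derivedSet (X p) ∩ (⋃ q, X q) = ⋃ q ∈ {q | q ≺ p}, X q

/-- The type `T(A)` of a subset of `W`. -/
def typeOf (X : P → Set W) (A : Set W) : Set P := {p | (A ∩ X p).Nonempty}

/-- `A` is a `p`-trim subset of `W`. -/
def IsTrim (X : P → Set W) (p : P) (A : Set W) : Prop :=
  IsCompact A ∧ IsOpen A ∧ typeOf X A = up p ∧ (p ∈ disc P → (A ∩ X p).encard = 1)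

/-- A trim `P`-partition of `W`: every point has a neighbourhood base of trim sets; a point
with a neighbourhood base of `p`-trim sets lies in `X_p`; every point of each `X_p` has a
`p`-trim neighbourhood. -/
structure IsTrimPartition (X : P → Set W) : Prop extends IsPOPartition X where
  base : ∀ w : W, ∀ U ∈ 𝓝 w, ∃ (p : P) (A : Set W), IsTrim X p A ∧ w ∈ A ∧ A ⊆ U
  full : ∀ (p : P) (w : W), (∀ U ∈ 𝓝 w, ∃ A : Set W, IsTrim X p A ∧ w ∈ A ∧ A ⊆ U) → w ∈ X p
  clean : ∀ (p : P), ∀ w ∈ X p, ∃ A : Set W, IsTrim X p A ∧ w ∈ A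

/-- A trim `(P, L, f)`-partition of `W`. -/
structure IsTrimTriplePartition (X : P → Set W) (L : Set P) (f : minDisc L → ℕ∞) : Prop
    extends IsTrimPartition X where
  compact_iff : ∀ p, IsCompact (closure (X p)) ↔ p ∈ L
  card_eq : ∀ p : minDisc L, (X p).encard = f p

/-- A bounded trim `(P, L, f)`-partition of `W`. -/
structure IsBoundedTrimTriplePartition (X : P → Set W) (L : Set P) (f : minDisc L → ℕ∞) : Prop
    extends IsTrimTriplePartition X L f where
  bounded : IsCompact (closure (⋃ p ∈ L, X p))

end Partitions

/-! ### ω-Stone spaces, the structure diagram and the canonical partition -/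

/-- An ω-Stone space: a locally compact, totally disconnected Hausdorff space (that is, the
Stone space of a Boolean ring, possibly without unit) whose Boolean ring of compact open
subsets is countable. -/
structure OmegaStone : Type (u + 1) where
  carrier : Type u
  [top : TopologicalSpace carrier]
  [t2 : T2Space carrier]
  [locallyCompact : LocallyCompactSpace carrier]
  [totallyDisconnected : TotallyDisconnectedSpace carrier]
  [countable : Countable (CompactOpens carrier)]

attribute [instance] OmegaStone.top OmegaStone.t2 OmegaStone.locallyCompact
  OmegaStone.totallyDisconnected OmegaStone.countable

namespace OmegaStone

/-- `W` and `X` are homeomorphic. -/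
instance homeoSetoid : Setoid OmegaStone.{u} where
  r W X := Nonempty (W.carrier ≃ₜ X.carrier)
  iseqv := ⟨fun _ => ⟨Homeomorph.refl _⟩, fun ⟨h⟩ => ⟨h.symm⟩, fun ⟨h⟩ ⟨k⟩ => ⟨h.trans k⟩⟩

variable (W : OmegaStone.{u})

/-- The Boolean ring `Co(W)` of compact open subsets of `W`, as a generalised Boolean algebra.
Its ideal `(A)` is `Set.Iic A`, and isomorphisms of Boolean rings are order isomorphisms. -/
abbrev Co : Type u := CompactOpens W.carrier

variable {W}

/-- `A` is pseudo-indecomposable: `A ≠ 0` and for every `B ⊆ A`, `(B) ≅ (A)` or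
`(A - B) ≅ (A)`. -/
def IsPI (A : W.Co) : Prop :=
  A ≠ ⊥ ∧ ∀ B ≤ A, Nonempty (Iic B ≃o Iic A) ∨ Nonempty (Iic (A \ B) ≃o Iic A)

variable (W)

/-- `W` is primitive: every compact open set is a finite disjoint union of
pseudo-indecomposable ones. -/
def IsPrimitive : Prop :=
  ∀ A : W.Co, ∃ s : Finset W.Co,
    (∀ B ∈ s, IsPI B) ∧ (s : Set W.Co).PairwiseDisjoint id ∧ s.sup id = A

/-- Isomorphism of the ideals generated by pseudo-indecomposable elements. -/
instance piSetoid : Setoid {A : W.Co // IsPI A} where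
  r A B := Nonempty (Iic A.1 ≃o Iic B.1)
  iseqv := ⟨fun _ => ⟨OrderIso.refl _⟩, fun ⟨h⟩ => ⟨h.symm⟩, fun ⟨h⟩ ⟨k⟩ => ⟨h.trans k⟩⟩

/-- The underlying set of the structure diagram `𝒮(W)`: the isomorphism classes `[A]` of the
pseudo-indecomposable elements `A`. -/
def StructureDiagram : Type u := Quotient W.piSetoid

/-- The componentwise product of two order isomorphisms. -/
def prodIso {a b c d : Type u} [LE a] [LE b] [LE c] [LE d] (e : a ≃o b) (e' : c ≃o d) :
    a × c ≃o b × d where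
  toEquiv := Equiv.prodCongr e.toEquiv e'.toEquiv
  map_rel_iff' := by
    rintro ⟨x, y⟩ ⟨z, w⟩
    simp [Prod.mk_le_mk]

/-- The relation of the structure diagram: `[A] ≺ [B]` iff `[A] × [B] ≅ [A]`. -/
def diagramRel : W.StructureDiagram → W.StructureDiagram → Prop :=
  Quotient.lift₂ (fun A B => Nonempty ((Iic A.1 × Iic B.1) ≃o Iic A.1)) (by
    rintro A B A' B' ⟨e⟩ ⟨e'⟩
    exact propext ⟨fun ⟨k⟩ => ⟨((prodIso e e').symm.trans k).trans e⟩,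
      fun ⟨k⟩ => ⟨((prodIso e e').trans k).trans e.symm⟩⟩)

instance : POSystem W.StructureDiagram where
  rel := W.diagramRel
  antisymm := by
    rintro ⟨A⟩ ⟨B⟩ ⟨h⟩ ⟨k⟩
    exact Quotient.sound ⟨h.symm.trans (OrderIso.prodComm.trans k)⟩
  trans := by
    rintro ⟨A⟩ ⟨B⟩ ⟨C⟩ ⟨h⟩ ⟨k⟩
    exact ⟨(prodIso h.symm (OrderIso.refl _)).trans
      ((OrderIso.prodAssoc _ _ _).trans ((prodIso (OrderIso.refl _) k).trans h))⟩

/-- The canonical partition: `X_p` is the set of points with a neighbourhood base of compact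
open sets of isomorphism class `p`. -/
def canonical (p : W.StructureDiagram) : Set W.carrier :=
  {w | ∀ U ∈ 𝓝 w, ∃ A : {A : W.Co // IsPI A},
    (Quotient.mk W.piSetoid A : W.StructureDiagram) = p ∧ w ∈ A.1 ∧ (A.1 : Set W.carrier) ⊆ U}

/-- `L_W`, the set of `p` for which the closure of `X_p` is compact. -/
def relCompact : Set W.StructureDiagram := {p | IsCompact (closure (W.canonical p))}

/-- `f_W(p) = |X_p|`. -/
noncomputable def size (p : minDisc W.relCompact) : ℕ∞ := (W.canonical p.1).encard

/-- The triple `(𝒮(W), L_W, f_W)`. -/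
noncomputable def triple : POTriple.{u} where
  carrier := W.StructureDiagram
  L := W.relCompact
  f := W.size

/-- `θ(W) = [(𝒮(W), L_W, f_W)]`. -/
noncomputable def theta : POTripleClass.{u} := ⟦W.triple⟧

/-- `W` is a compact primitive space. -/
def IsCompactPrimitive : Prop := W.IsPrimitive ∧ CompactSpace W.carrier

/-- `W` is finitary: primitive with finite structure diagram. -/
def IsFinitary : Prop := W.IsPrimitive ∧ Finite W.StructureDiagram

/-- `W` is a bounded primitive space: its canonical partition is a bounded trim
`(𝒮(W), L_W, f_W)`-partition. -/
def IsBounded : Prop :=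
  W.IsPrimitive ∧ IsBoundedTrimTriplePartition W.canonical W.relCompact W.size

end OmegaStone

/-- Homeomorphism classes of ω-Stone spaces. -/
abbrev OmegaStoneClass : Type (u + 1) := Quotient OmegaStone.homeoSetoid.{u}

/-- The homeomorphism classes of the ω-Stone spaces with a given property. -/
def classesOf (C : OmegaStone.{u} → Prop) : Set OmegaStoneClass.{u} := {c | ∃ W, C W ∧ ⟦W⟧ = c}

/-- The classes `[(P, f)]`, regarded as `[(P, P, f)]`, with `P` countable and simple and having
a finite foundation, and `f : P_min ∩ P^d → ℕ₊`. -/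
def compactTypes : Set POTripleClass.{u} :=
  {c | ∃ E : POTriple.{u}, Countable E.carrier ∧ IsSimple E.carrier ∧
    HasFiniteFoundation (univ : Set E.carrier) ∧ E.L = univ ∧ E.PosValued ∧ ⟦E⟧ = c}

/-- The classes `[(P, L, f)]` with `P` finite and simple, `L` a lower subset of `P` and
`f : L_min ∩ P^d → ℕ₊`. -/
def finitaryTypes : Set POTripleClass.{u} :=
  {c | ∃ E : POTriple.{u}, Finite E.carrier ∧ IsSimple E.carrier ∧
    IsLower E.L ∧ E.PosValued ∧ ⟦E⟧ = c}

/-- The classes `[(P, L, f)]` with `P` countable and simple, `L` a lower subset of `P` having a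
finite foundation and `f : L_min ∩ P^d → ℕ₊`. -/
def boundedTypes : Set POTripleClass.{u} :=
  {c | ∃ E : POTriple.{u}, Countable E.carrier ∧ IsSimple E.carrier ∧
    IsLower E.L ∧ HasFiniteFoundation E.L ∧ E.PosValued ∧ ⟦E⟧ = c}

/-! A trim partition makes every compact open set a finite disjoint union of trim pieces, so a
multiset of labels describes it. A piece of label `p` can shed or swallow a piece of label `q`
whenever `p ≺ q`. Hence the multisets describing a given set form exactly one class of `UpEquiv`:
only the upper set they generate and the multiplicities at minimal elements of `disc P` matter.
`TrimSystem` isolates these facts algebraically.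

A back-and-forth of Vaught type turns them into isomorphisms: if two sets have decompositions
matched by a relation that lifts `≺` both ways, the matching can be refined along any subset on
either side (`Matched.split`), so their ideals are isomorphic (`Matched.orderIso`). For equality
this says that trim sets of one label are isomorphic and pseudo-indecomposable; for a congruence on
the structure diagram it says that congruent classes coincide, so the diagram is simple. Conversely,
isomorphism of pieces induces a congruence on the labels (`TrimSystem.isCongruence`). Over a simple
`P` the label is therefore an isomorphism invariant, and every trim partition is the canonical one
up to relabelling (`exists_equiv_structureDiagram`).

The canonical partition of a primitive space is trim (`IsPrimitive.isTrimPartition`), and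
compactness of closures yields the axioms of an extended PO system. Every such system is realised by
the branches of a forest of ascending words with suitably many roots (`exists_omegaStone`).

In a bounded space the points with labels in `L` lie in one compact open set, whose decomposition is
determined by `(P, L, f)` up to `UpEquiv`. The other labels occur outside every compact set, so
partners for them never run out and the back-and-forth gives a homeomorphism
(`IsBoundedTrimTriplePartition.exists_homeomorph`). Compact and finitary primitive spaces are
bounded, so this one uniqueness result serves all three bijections. -/

/-! ### A back-and-forth theorem of Vaught type for generalised Boolean algebras -/

section Vaught

variable {R S : Type u} [GeneralizedBooleanAlgebra R] [GeneralizedBooleanAlgebra S]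

/-- One half of the back-and-forth conditions: `E` is the relation between the pieces already
matched, and `N` is the condition on the parts of the two algebras not yet covered. -/
structure BackForth (E N : R → S → Prop) (I : Set R) (J : Set S) : Prop where
  lower : IsLowerSet I
  mem : ∀ a b, N a b → a ∈ I
  eq_bot : ∀ a b, E a b → b = ⊥ → a = ⊥
  split : ∀ a b, E a b → ∀ a' ≤ a, ∃ b' ≤ b, E a' b' ∧ E (a \ a') (b \ b')
  extend : ∀ a b, N a b → ∀ c ∈ I, Disjoint a c →
    ∃ d ∈ J, Disjoint b d ∧ E c d ∧ N (a ⊔ c) (b ⊔ d)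

/-- A finite stage of the back-and-forth construction. -/
structure Stage (E N : R → S → Prop) where
  index : Type
  [fintype : Fintype index]
  left : index → R
  right : index → S
  disjoint_left : ∀ i j, i ≠ j → Disjoint (left i) (left j)
  disjoint_right : ∀ i j, i ≠ j → Disjoint (right i) (right j)
  rel : ∀ i, E (left i) (right i)
  rest : N (Finset.univ.sup left) (Finset.univ.sup right)

attribute [instance] Stage.fintype

namespace Stage

variable {E N : R → S → Prop}

/-- The pairs of elements matched at a given stage. -/
def Matches (s : Stage E N) (c : R) (d : S) : Prop :=
  ∃ F : Finset s.index, c = F.sup s.left ∧ d = F.sup s.right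

instance : Preorder (Stage E N) where
  le s t := ∀ c d, s.Matches c d → t.Matches c d
  le_refl _ _ _ h := h
  le_trans _ _ _ h k c d hc := k c d (h c d hc)

/-- The stage with the two sides exchanged. -/
def swap (s : Stage E N) : Stage (fun b a => E a b) (fun b a => N a b) where
  index := s.index
  left := s.right
  right := s.left
  disjoint_left := s.disjoint_right
  disjoint_right := s.disjoint_left
  rel := s.rel
  rest := s.rest

theorem swap_matches (s : Stage E N) (c : R) (d : S) : s.swap.Matches d c ↔ s.Matches c d :=
  ⟨fun ⟨F, h, k⟩ => ⟨F, k, h⟩, fun ⟨F, h, k⟩ => ⟨F, k, h⟩⟩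

theorem Matches.sup {s : Stage E N} {c c' : R} {d d' : S} (h : s.Matches c d)
    (k : s.Matches c' d') : s.Matches (c ⊔ c') (d ⊔ d') := by
  classical
  obtain ⟨F, rfl, rfl⟩ := h
  obtain ⟨G, rfl, rfl⟩ := k
  exact ⟨F ∪ G, Finset.sup_union.symm, Finset.sup_union.symm⟩

theorem matches_single (s : Stage E N) (i : s.index) : s.Matches (s.left i) (s.right i) :=
  ⟨{i}, by simp, by simp⟩

theorem matches_finset_sup {s : Stage E N} {ι : Type*} (F : Finset ι) (f : ι → R) (g : ι → S)
    (h : ∀ i ∈ F, s.Matches (f i) (g i)) : s.Matches (F.sup f) (F.sup g) := by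
  classical
  induction F using Finset.induction_on with
  | empty => exact ⟨∅, by simp, by simp⟩
  | insert i F _ ih =>
    rw [Finset.sup_insert, Finset.sup_insert]
    exact (h i (by simp)).sup (ih fun j hj => h j (by simp [hj]))

theorem le_of_matches {s t : Stage E N} (h : ∀ i, t.Matches (s.left i) (s.right i)) : s ≤ t := by
  rintro c d ⟨F, rfl, rfl⟩
  exact matches_finset_sup F _ _ fun i _ => h i

theorem Matches.mem {I : Set R} {J : Set S} (hE : BackForth E N I J) {s : Stage E N} {c : R}
    {d : S} (h : s.Matches c d) : c ∈ I := by
  obtain ⟨F, rfl, rfl⟩ := h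
  exact hE.lower (Finset.sup_mono (Finset.subset_univ F)) (hE.mem _ _ s.rest)

/-- A right-hand piece below `d'` but not used in it is disjoint from `d'`, hence empty; `eq_bot`
then empties its partner, so nothing of `c` is left outside `c'`. -/
theorem Matches.le {I : Set R} {J : Set S} (hE : BackForth E N I J) {s : Stage E N} {c c' : R}
    {d d' : S} (h : s.Matches c d) (k : s.Matches c' d') (hd : d ≤ d') : c ≤ c' := by
  classical
  obtain ⟨F, rfl, rfl⟩ := h
  obtain ⟨G, rfl, rfl⟩ := k
  refine Finset.sup_le fun i hi => ?_
  by_cases hG : i ∈ G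
  · exact Finset.le_sup hG
  · have : Disjoint (s.right i) (G.sup s.right) := by
      rw [Finset.disjoint_sup_right]
      exact fun j hj => s.disjoint_right i j (by rintro rfl; exact hG hj)
    rw [hE.eq_bot _ _ (s.rel i) (this.eq_bot_of_le ((Finset.le_sup hi).trans hd))]
    exact bot_le

/-- Each piece is cut along `c` by `split`, and the part of `c` outside all pieces is matched by
`extend`. -/
theorem exists_matches {I : Set R} {J : Set S} (hE : BackForth E N I J) (s : Stage E N) {c : R}
    (hc : c ∈ I) : ∃ t, s ≤ t ∧ ∃ d, t.Matches c d := by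
  classical
  have hsplit := fun i => hE.split _ _ (s.rel i) (s.left i ⊓ c) inf_le_left
  choose g hg h1 h2 using hsplit
  set a := Finset.univ.sup s.left with ha
  set b := Finset.univ.sup s.right with hb
  obtain ⟨d, -, hbd, hcd, hN⟩ := hE.extend a b s.rest (c \ a)
    (hE.lower sdiff_le hc) disjoint_sdiff_self_right
  -- `none` indexes the new piece; `(i, true)` and `(i, false)` are the parts of piece `i` inside
  -- and outside `c`.
  let L : Option (s.index × Bool) → R := fun o => o.elim (c \ a)
    fun x => if x.2 then s.left x.1 ⊓ c else s.left x.1 \ (s.left x.1 ⊓ c)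
  let M : Option (s.index × Bool) → S := fun o => o.elim d
    fun x => if x.2 then g x.1 else s.right x.1 \ g x.1
  have hLle : ∀ i v, L (some (i, v)) ≤ s.left i := by
    intro i v
    cases v
    · exact sdiff_le
    · exact inf_le_left
  have hMle : ∀ i v, M (some (i, v)) ≤ s.right i := by
    intro i v
    cases v
    · exact sdiff_le
    · exact hg i
  have hLs : ∀ i, s.left i = L (some (i, true)) ⊔ L (some (i, false)) := fun i =>
    (sup_sdiff_cancel_right inf_le_left).symm
  have hMs : ∀ i, s.right i = M (some (i, true)) ⊔ M (some (i, false)) := fun i =>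
    (sup_sdiff_cancel_right (hg i)).symm
  have hLu : Finset.univ.sup L = a ⊔ c \ a := by
    refine le_antisymm (Finset.sup_le ?_) (sup_le (Finset.sup_le fun i _ => ?_) ?_)
    · rintro (_ | ⟨i, v⟩) -
      · exact le_sup_right
      · exact ((hLle i v).trans (Finset.le_sup (Finset.mem_univ i))).trans le_sup_left
    · rw [hLs i]
      exact sup_le (Finset.le_sup (Finset.mem_univ _)) (Finset.le_sup (Finset.mem_univ _))
    · exact Finset.le_sup (f := L) (Finset.mem_univ none)
  have hMu : Finset.univ.sup M = b ⊔ d := by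
    refine le_antisymm (Finset.sup_le ?_) (sup_le (Finset.sup_le fun i _ => ?_) ?_)
    · rintro (_ | ⟨i, v⟩) -
      · exact le_sup_right
      · exact ((hMle i v).trans (Finset.le_sup (Finset.mem_univ i))).trans le_sup_left
    · rw [hMs i]
      exact sup_le (Finset.le_sup (Finset.mem_univ _)) (Finset.le_sup (Finset.mem_univ _))
    · exact Finset.le_sup (f := M) (Finset.mem_univ none)
  have hLd : ∀ x y, x ≠ y → Disjoint (L x) (L y) := by
    have key : ∀ x, Disjoint (L (some x)) (L none) := fun x =>
      disjoint_sdiff_self_right.mono_left ((hLle x.1 x.2).trans (Finset.le_sup (Finset.mem_univ _)))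
    rintro (_ | ⟨i, v⟩) (_ | ⟨j, w⟩) h
    · exact (h rfl).elim
    · exact (key _).symm
    · exact key _
    · by_cases hij : i = j
      · subst hij
        cases v <;> cases w
        · exact (h rfl).elim
        · exact disjoint_sdiff_self_left
        · exact disjoint_sdiff_self_right
        · exact (h rfl).elim
      · exact (s.disjoint_left i j hij).mono (hLle _ _) (hLle _ _)
  have hMd : ∀ x y, x ≠ y → Disjoint (M x) (M y) := by
    have key : ∀ x, Disjoint (M (some x)) (M none) := fun x =>
      hbd.mono_left ((hMle x.1 x.2).trans (Finset.le_sup (Finset.mem_univ _)))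
    rintro (_ | ⟨i, v⟩) (_ | ⟨j, w⟩) h
    · exact (h rfl).elim
    · exact (key _).symm
    · exact key _
    · by_cases hij : i = j
      · subst hij
        cases v <;> cases w
        · exact (h rfl).elim
        · exact disjoint_sdiff_self_left
        · exact disjoint_sdiff_self_right
        · exact (h rfl).elim
      · exact (s.disjoint_right i j hij).mono (hMle _ _) (hMle _ _)
  let t : Stage E N :=
    { index := Option (s.index × Bool)
      left := L
      right := M
      disjoint_left := hLd
      disjoint_right := hMd
      rel := by
        rintro (_ | ⟨i, v⟩)
        · exact hcd
        · cases v
          · exact h2 i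
          · exact h1 i
      rest := by rw [hLu, hMu]; exact hN }
  refine ⟨t, le_of_matches fun i => ?_, ?_⟩
  · rw [hLs, hMs]
    exact (t.matches_single (some (i, true))).sup (t.matches_single (some (i, false)))
  · have hc' : c = (Finset.univ.sup fun i => s.left i ⊓ c) ⊔ c \ a := by
      have : (Finset.univ.sup fun i => s.left i ⊓ c) = a ⊓ c := by
        rw [ha, Finset.sup_inf_distrib_right]
      rw [this, inf_comm, sup_inf_sdiff]
    refine ⟨(Finset.univ.sup g) ⊔ d, ?_⟩
    have := (matches_finset_sup (s := t) Finset.univ _ _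
      fun i _ => t.matches_single (some (i, true))).sup (t.matches_single none)
    rw [hc']
    exact this

end Stage

/-- An ideal of stages that meets one cofinal set for each element of `I` and of `J` defines the
isomorphism. Two matches are compared in a common refinement, where `Matches.le` and its mirror
image apply. -/
theorem exists_orderIso_of_backForth [Countable R] [Countable S] {E N : R → S → Prop} {I : Set R}
    {J : Set S} (h₁ : BackForth E N I J)
    (h₂ : BackForth (fun b a => E a b) (fun b a => N a b) J I) (h₀ : N ⊥ ⊥) :
    Nonempty (I ≃o J) := by
  classical
  let s₀ : Stage E N :=
    { index := Empty
      left := Empty.elim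
      right := Empty.elim
      disjoint_left := fun i => i.elim
      disjoint_right := fun i => i.elim
      rel := fun i => i.elim
      rest := by simpa using h₀ }
  have back : ∀ (s : Stage E N) {d : S}, d ∈ J → ∃ t, s ≤ t ∧ ∃ c, t.Matches c d := by
    intro s d hd
    obtain ⟨t, hst, c, hc⟩ := s.swap.exists_matches h₂ hd
    exact ⟨t.swap, fun x y hxy => (t.swap_matches y x).2 (hst y x ((s.swap_matches x y).2 hxy)),
      c, (t.swap_matches d c).2 hc⟩
  let D : I ⊕ J → Order.Cofinal (Stage E N) := Sum.elim
    (fun c => ⟨{t | ∃ d, t.Matches c.1 d}, fun s => by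
      obtain ⟨t, hst, ht⟩ := s.exists_matches h₁ c.2
      exact ⟨t, ht, hst⟩⟩)
    (fun d => ⟨{t | ∃ c, t.Matches c d.1}, fun s => by
      obtain ⟨t, hst, ht⟩ := back s d.2
      exact ⟨t, ht, hst⟩⟩)
  have : Encodable (I ⊕ J) := Encodable.ofCountable _
  let G := Order.idealOfCofinals s₀ D
  let T : R → S → Prop := fun c d => ∃ s ∈ G, s.Matches c d
  have tot : ∀ c : I, ∃ d : J, T c d := by
    intro c
    obtain ⟨s, ⟨d, hd⟩, hs⟩ := Order.cofinal_meets_idealOfCofinals s₀ D (Sum.inl c)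
    exact ⟨⟨d, ((s.swap_matches _ _).2 hd).mem h₂⟩, s, hs, hd⟩
  have surj : ∀ d : J, ∃ c : I, T c d := by
    intro d
    obtain ⟨s, ⟨c, hc⟩, hs⟩ := Order.cofinal_meets_idealOfCofinals s₀ D (Sum.inr d)
    exact ⟨⟨c, hc.mem h₁⟩, s, hs, hc⟩
  have mono : ∀ {c c' : R} {d d' : S}, T c d → T c' d' → (c ≤ c' ↔ d ≤ d') := by
    rintro c c' d d' ⟨s, hs, hc⟩ ⟨s', hs', hc'⟩
    obtain ⟨t, -, hst, hst'⟩ := G.directed _ hs _ hs'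
    have k := hst _ _ hc
    have k' := hst' _ _ hc'
    exact ⟨fun h => Stage.Matches.le h₂ ((t.swap_matches _ _).2 k) ((t.swap_matches _ _).2 k') h,
      fun h => k.le h₁ k' h⟩
  choose φ hφ using tot
  refine ⟨RelIso.ofSurjective (OrderEmbedding.ofMapLEIff φ fun c c' =>
    (mono (hφ c) (hφ c')).symm) fun d => ?_⟩
  obtain ⟨c, hc⟩ := surj d
  exact ⟨c, le_antisymm ((mono (hφ c) hc).1 le_rfl) ((mono hc (hφ c)).1 le_rfl)⟩

end Vaught

/-! ### Decompositions into labelled pieces -/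

namespace POSystem

variable {P : Type u} [POSystem P]

theorem le_refl (p : P) : le p p := Or.inr rfl

theorem le_trans {p q r : P} : le p q → le q r → le p r := by
  rintro (h | rfl) (k | rfl)
  · exact Or.inl (POSystem.trans _ _ _ h k)
  · exact Or.inl h
  · exact Or.inl k
  · exact Or.inr rfl

theorem le_antisymm {p q : P} : le p q → le q p → p = q := by
  rintro (h | rfl) (k | h')
  · exact POSystem.antisymm _ _ h k
  · exact h'.symm
  · rfl
  · rfl

theorem rel_of_le_of_rel {p q r : P} : le p q → q ≺ r → p ≺ r := by
  rintro (h | rfl) k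
  · exact POSystem.trans _ _ _ h k
  · exact k

theorem rel_of_rel_of_le {p q r : P} : p ≺ q → le q r → p ≺ r := by
  rintro h (k | rfl)
  · exact POSystem.trans _ _ _ h k
  · exact h

theorem le_of_rel {p q : P} (h : p ≺ q) : le p q := Or.inl h

end POSystem

section Decomp

variable {R P Q : Type u} [GeneralizedBooleanAlgebra R]

/-- `a` is the disjoint union of pieces whose kinds form the multiset `l`. -/
inductive Decomp (τ : R → P → Prop) : R → Multiset P → Prop
  | zero : Decomp τ ⊥ 0
  | cons {t r : R} {p : P} {l : Multiset P} :
    τ t p → Disjoint t r → Decomp τ r l → Decomp τ (t ⊔ r) (p ::ₘ l)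

namespace Decomp

variable {τ : R → P → Prop}

theorem single {a : R} {p : P} (h : τ a p) : Decomp τ a {p} := by
  have := Decomp.cons h disjoint_bot_right (Decomp.zero (τ := τ))
  rwa [sup_bot_eq] at this

theorem add {a b : R} {l m : Multiset P} (h : Decomp τ a l) (k : Decomp τ b m)
    (hd : Disjoint a b) : Decomp τ (a ⊔ b) (l + m) := by
  induction h with
  | zero => simpa using k
  | cons ht hdr _ ih =>
    rw [disjoint_sup_left] at hd
    rw [sup_assoc, Multiset.cons_add]
    exact .cons ht (disjoint_sup_right.2 ⟨hdr, hd.1⟩) (ih hd.2)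

/-- Inversion at a label of choice: the constructors fix an order of the pieces which the multiset
forgets. -/
theorem exists_cons {a : R} {m : Multiset P} (h : Decomp τ a m) :
    ∀ p l, m = p ::ₘ l → ∃ t r, τ t p ∧ Disjoint t r ∧ Decomp τ r l ∧ a = t ⊔ r := by
  induction h with
  | zero => intro p l h; exact (Multiset.cons_ne_zero h.symm).elim
  | @cons t r q l' ht hd hr ih =>
    intro p l h
    rcases Multiset.cons_eq_cons.1 h with ⟨rfl, rfl⟩ | ⟨-, cs, h1, h2⟩
    · exact ⟨t, r, ht, hd, hr, rfl⟩
    · obtain ⟨t', r', ht', hd', hr', rfl⟩ := ih p cs h1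
      rw [disjoint_sup_right] at hd
      refine ⟨t', t ⊔ r', ht', disjoint_sup_right.2 ⟨hd.1.symm, hd'⟩, ?_, sup_left_comm _ _ _⟩
      rw [h2]
      exact .cons ht hd.2 hr'

theorem eq_bot {a : R} {m : Multiset P} (h : Decomp τ a m) (hm : m = 0) : a = ⊥ := by
  cases h with
  | zero => rfl
  | cons => exact (Multiset.cons_ne_zero hm).elim

theorem of_single {a : R} {p : P} (h : Decomp τ a {p}) : τ a p := by
  obtain ⟨t, r, ht, -, hr, rfl⟩ := h.exists_cons p 0 rfl
  rwa [hr.eq_bot rfl, sup_bot_eq]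

theorem exists_add (l m : Multiset P) : ∀ a : R, Decomp τ a (l + m) →
    ∃ b c, Disjoint b c ∧ Decomp τ b l ∧ Decomp τ c m ∧ a = b ⊔ c := by
  induction l using Multiset.induction_on with
  | empty =>
    intro a h
    exact ⟨⊥, a, disjoint_bot_left, .zero, by simpa using h, by simp⟩
  | cons p l ih =>
    intro a h
    rw [Multiset.cons_add] at h
    obtain ⟨t, r, ht, hd, hr, rfl⟩ := h.exists_cons p _ rfl
    obtain ⟨b, c, hbc, hb, hc, rfl⟩ := ih r hr
    rw [disjoint_sup_right] at hd
    exact ⟨t ⊔ b, c, disjoint_sup_left.2 ⟨hd.2, hbc⟩, .cons ht hd.1 hb, hc, (sup_assoc _ _ _).symm⟩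

theorem exists_mem {a : R} {m : Multiset P} (h : Decomp τ a m) {p : P} (hp : p ∈ m) :
    ∃ t ≤ a, τ t p := by
  obtain ⟨l, rfl⟩ := Multiset.exists_cons_of_mem hp
  obtain ⟨t, r, ht, -, -, rfl⟩ := h.exists_cons p l rfl
  exact ⟨t, le_sup_left, ht⟩

end Decomp

variable {S : Type u} [GeneralizedBooleanAlgebra S]

/-- `a` and `b` have decompositions whose kinds correspond under `s`. -/
def Matched (τ : R → P → Prop) (σ : S → Q → Prop) (s : P → Q → Prop) (a : R) (b : S) : Prop :=
  ∃ m : Multiset (P × Q), (∀ x ∈ m, s x.1 x.2) ∧ Decomp τ a (m.map Prod.fst) ∧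
    Decomp σ b (m.map Prod.snd)

variable {τ : R → P → Prop} {σ : S → Q → Prop} {s : P → Q → Prop}

theorem Matched.symm {a : R} {b : S} (h : Matched τ σ s a b) :
    Matched σ τ (fun q p => s p q) b a := by
  obtain ⟨m, hm, ha, hb⟩ := h
  refine ⟨m.map Prod.swap, fun x hx => ?_, ?_, ?_⟩
  · obtain ⟨y, hy, rfl⟩ := Multiset.mem_map.1 hx
    exact hm y hy
  · simpa using hb
  · simpa using ha

theorem Matched.sup {a a' : R} {b b' : S} (h : Matched τ σ s a b) (k : Matched τ σ s a' b')
    (ha : Disjoint a a') (hb : Disjoint b b') : Matched τ σ s (a ⊔ a') (b ⊔ b') := by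
  obtain ⟨m, hm, h1, h2⟩ := h
  obtain ⟨n, hn, k1, k2⟩ := k
  refine ⟨m + n, fun x hx => (Multiset.mem_add.1 hx).elim (hm x) (hn x), ?_, ?_⟩
  · rw [Multiset.map_add]; exact h1.add k1 ha
  · rw [Multiset.map_add]; exact h2.add k2 hb

theorem Matched.of_kind {a : R} {b : S} {p : P} {q : Q} (ha : τ a p) (hb : σ b q) (h : s p q) :
    Matched τ σ s a b :=
  ⟨{(p, q)}, by simpa using h, by simpa using .single ha, by simpa using .single hb⟩

variable [POSystem P] [POSystem Q]

open scoped Classical in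
/-- Two multisets have the same upper closure and the same multiplicities at the minimal elements
that are not related to themselves. -/
def UpEquiv (l m : Multiset P) : Prop :=
  (∀ p ∈ m, ∃ q ∈ l, le q p) ∧ (∀ p ∈ l, ∃ q ∈ m, le q p) ∧
    ∀ p ∈ disc P, p ∈ l → (∀ q ∈ l, le q p → q = p) → l.count p = m.count p

/-- The elements of `m` strictly above some element of `l`. -/
def Above (l : Multiset P) (q : P) : Prop := ∃ p ∈ l, p ≺ q

-- The multiplicity condition only mentions minimal elements of `l`, but mutual domination forces
-- `l` and `m` to have the same minimal elements.
open scoped Classical in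
theorem UpEquiv.symm {l m : Multiset P} (h : UpEquiv l m) : UpEquiv m l := by
  obtain ⟨h1, h2, h3⟩ := h
  refine ⟨h2, h1, fun p hp hpm hmin => ?_⟩
  obtain ⟨q, hq, hqp⟩ := h1 p hpm
  obtain ⟨r, hr, hrq⟩ := h2 q hq
  have hrp := hmin r hr (le_trans hrq hqp)
  subst hrp
  have hqr := le_antisymm hqp hrq
  subst hqr
  refine (h3 q hp hq fun s hs hsq => ?_).symm
  obtain ⟨t, ht, hts⟩ := h2 s hs
  have := hmin t ht (le_trans hts hsq)
  subst this
  exact le_antisymm hsq hts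

-- An element of `l` with nothing of `m` strictly below it equals the element of `m` weakly below
-- it. It is then in `disc P` and minimal in `l`, where the multiplicities agree.
open scoped Classical in
theorem UpEquiv.filter_le {l m : Multiset P} (h : UpEquiv l m) :
    l.filter (fun q => ¬ Above m q) ≤ m.filter fun q => ¬ Above l q := by
  obtain ⟨h1, h2, h3⟩ := h
  rw [Multiset.le_iff_count]
  intro q
  by_cases hq : q ∈ l ∧ ¬ Above m q
  · obtain ⟨hql, hqm⟩ := hq
    obtain ⟨p, hp, hpq⟩ := h2 q hql
    have : p = q := hpq.resolve_left fun h => hqm ⟨p, hp, h⟩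
    subst this
    have hmin : ∀ r ∈ l, ¬ r ≺ p := fun r hr hrp => by
      obtain ⟨s, hs, hsr⟩ := h2 r hr
      exact hqm ⟨s, hs, rel_of_le_of_rel hsr hrp⟩
    rw [Multiset.count_filter_of_pos (p := fun q => ¬ Above m q) hqm,
      Multiset.count_filter_of_pos (p := fun q => ¬ Above l q) fun ⟨r, hr, hrp⟩ => hmin r hr hrp]
    exact (h3 p (fun h => hqm ⟨p, hp, h⟩) hql fun r hr hrp => hrp.resolve_left (hmin r hr)).le
  · rw [Multiset.count_eq_zero_of_notMem]
    · exact Nat.zero_le _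
    · rwa [Multiset.mem_filter]

-- The parts of `l` and `m` not strictly above the other multiset coincide, so the two differ by
-- redundant labels only.
open scoped Classical in
theorem UpEquiv.add_filter {l m : Multiset P} (h : UpEquiv l m) :
    l + m.filter (Above l) = m + l.filter (Above m) := by
  have key : l.filter (fun q => ¬ Above m q) = m.filter fun q => ¬ Above l q :=
    _root_.le_antisymm h.filter_le h.symm.filter_le
  have h₁ := Multiset.filter_add_not (Above m) l
  have h₂ := Multiset.filter_add_not (Above l) m
  rw [key] at h₁
  generalize m.filter (Above l) = u at *
  generalize l.filter (Above m) = v at *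
  generalize m.filter (fun q => ¬ Above l q) = w at *
  rw [← h₁, ← h₂]
  abel

/-- Pieces of kinds in a PO system, with the properties shared by the trim sets of a trim
partition. -/
structure TrimSystem (τ : R → P → Prop) : Prop where
  ne_bot : ∀ a p, τ a p → a ≠ ⊥
  absorb : ∀ a b p q, τ a p → τ b q → Disjoint a b → p ≺ q → τ (a ⊔ b) p
  emit : ∀ a p q, τ a p → p ≺ q → ∃ b c, Disjoint b c ∧ a = b ⊔ c ∧ τ b p ∧ τ c q
  exists_decomp : ∀ a, ∃ l, Decomp τ a l
  upEquiv : ∀ a l m, Decomp τ a l → Decomp τ a m → UpEquiv l m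

namespace TrimSystem

variable (hτ : TrimSystem τ)
include hτ

/-- A label `q` is split off by `emit` from a piece whose label is strictly below `q`, and that
piece keeps its label. -/
theorem decomp_add {a : R} {l : Multiset P} (h : Decomp τ a l) (m : Multiset P)
    (hm : ∀ q ∈ m, Above l q) : Decomp τ a (l + m) := by
  induction m using Multiset.induction_on with
  | empty => simpa using h
  | cons q m ih =>
    have ih := ih fun r hr => hm r (by simp [hr])
    obtain ⟨p, hp, hpq⟩ := hm q (by simp)
    obtain ⟨l', hl'⟩ := Multiset.exists_cons_of_mem (Multiset.mem_add.2 (Or.inl hp) : p ∈ l + m)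
    obtain ⟨t, r, ht, hd, hr, rfl⟩ := ih.exists_cons p l' hl'
    obtain ⟨b, c, hbc, rfl, hb, hc⟩ := hτ.emit t p q ht hpq
    rw [disjoint_sup_left] at hd
    rw [Multiset.add_cons, hl', sup_right_comm, sup_comm]
    exact .cons hc (disjoint_sup_right.2 ⟨hbc.symm, hd.2⟩) (.cons hb hd.1 hr)

theorem decomp_of_add {a : R} (l m : Multiset P) (h : Decomp τ a (l + m))
    (hm : ∀ q ∈ m, Above l q) : Decomp τ a l := by
  induction m using Multiset.induction_on generalizing a with
  | empty => simpa using h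
  | cons q m ih =>
    refine ih ?_ fun r hr => hm r (by simp [hr])
    obtain ⟨p, hp, hpq⟩ := hm q (by simp)
    obtain ⟨l', hl'⟩ := Multiset.exists_cons_of_mem (Multiset.mem_add.2 (Or.inl hp) : p ∈ l + m)
    rw [Multiset.add_cons, hl'] at h
    obtain ⟨t, r, ht, hd, hr, rfl⟩ := h.exists_cons q _ rfl
    obtain ⟨t', r', ht', hd', hr', rfl⟩ := hr.exists_cons p _ rfl
    rw [disjoint_sup_right] at hd
    rw [hl', ← sup_assoc, sup_comm t]
    exact .cons (hτ.absorb _ _ _ _ ht' ht hd.1.symm hpq)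
      (disjoint_sup_left.2 ⟨hd', hd.2⟩) hr'

-- Labels are emitted to pass from `l` to the common multiset of `UpEquiv.add_filter`, then absorbed
-- to arrive at `m`.
open scoped Classical in
theorem decomp_congr {a : R} {l m : Multiset P} (h : Decomp τ a l) (hlm : UpEquiv l m) :
    Decomp τ a m := by
  have := hτ.decomp_add h (m.filter (Above l)) fun q hq => (Multiset.mem_filter.1 hq).2
  rw [hlm.add_filter] at this
  exact hτ.decomp_of_add _ _ this fun q hq => (Multiset.mem_filter.1 hq).2

theorem eq_zero_of_bot {l : Multiset P} (h : Decomp τ ⊥ l) : l = 0 := by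
  by_contra hl
  obtain ⟨p, hp⟩ := Multiset.exists_mem_of_ne_zero hl
  obtain ⟨t, ht, htp⟩ := h.exists_mem hp
  exact hτ.ne_bot _ _ htp (le_bot_iff.1 ht)

end TrimSystem

theorem Multiset.exists_add_of_map_eq_add {α β : Type*} (f : α → β) (u v : Multiset β) :
    ∀ m : Multiset α, m.map f = u + v → ∃ n k, m = n + k ∧ n.map f = u ∧ k.map f = v := by
  induction u using Multiset.induction_on with
  | empty => exact fun m h => ⟨0, m, by simp, by simp, by simpa using h⟩
  | cons b u ih =>
    classical
    intro m h
    rw [Multiset.cons_add] at h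
    obtain ⟨a, ha, rfl, h'⟩ := (Multiset.map_eq_cons _ _ _ _).2 h
    obtain ⟨n, k, hnk, rfl, rfl⟩ := ih _ h'
    exact ⟨a ::ₘ n, k, by rw [Multiset.cons_add, ← hnk, Multiset.cons_erase ha], by simp, rfl⟩

/-- A relation between two PO systems with the lifting property in both directions. -/
structure BiLift (s : P → Q → Prop) : Prop where
  forth : ∀ p q p', s p q → p ≺ p' → ∃ q', s p' q' ∧ q ≺ q'
  back : ∀ p q q', s p q → q ≺ q' → ∃ p', s p' q' ∧ p ≺ p'

theorem BiLift.symm {s : P → Q → Prop} (h : BiLift s) : BiLift fun q p => s p q :=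
  ⟨fun _ _ _ => h.back _ _ _, fun _ _ _ => h.forth _ _ _⟩

omit [POSystem P] in
theorem Matched.eq_bot (hσ : TrimSystem σ) {a : R} {b : S}
    (h : Matched τ σ s a b) (hb : b = ⊥) : a = ⊥ := by
  obtain ⟨m, -, h1, h2⟩ := h
  subst hb
  have := hσ.eq_zero_of_bot h2
  rw [Multiset.map_eq_zero] at this
  subst this
  exact h1.eq_bot rfl

-- Decompositions of `a'` and `a \ a'` together differ from the given one of `a` by redundant labels
-- only. What is missing is emitted on both sides, and the resulting matched decomposition can be
-- divided along `a'`.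
open scoped Classical in
theorem Matched.split (hτ : TrimSystem τ) (hσ : TrimSystem σ) (hs : BiLift s) {a : R} {b : S}
    (h : Matched τ σ s a b) {a' : R} (ha' : a' ≤ a) :
    ∃ b' ≤ b, Matched τ σ s a' b' ∧ Matched τ σ s (a \ a') (b \ b') := by
  obtain ⟨m, hm, h1, h2⟩ := h
  obtain ⟨l₁, hl₁⟩ := hτ.exists_decomp a'
  obtain ⟨l₂, hl₂⟩ := hτ.exists_decomp (a \ a')
  have hl := hl₁.add hl₂ disjoint_sdiff_self_right
  rw [sup_sdiff_cancel_right ha'] at hl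
  have heq := (hτ.upEquiv a _ _ h1 hl).add_filter
  set r := (l₁ + l₂).filter (Above (m.map Prod.fst)) with hr
  set r' := (m.map Prod.fst).filter (Above (l₁ + l₂)) with hr'
  -- Every label in `r` is strictly above a label of `m`; lifting this along `s` gives a partner
  -- that may be emitted on the side of `b`.
  have lift : ∃ n : Multiset (P × Q), n.map Prod.fst = r ∧ (∀ x ∈ n, s x.1 x.2) ∧
      ∀ q ∈ n.map Prod.snd, Above (m.map Prod.snd) q := by
    have : ∀ p ∈ r, ∃ q, s p q ∧ Above (m.map Prod.snd) q := by
      intro p hp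
      obtain ⟨p₀, hp₀, hlt⟩ := (Multiset.mem_filter.1 hp).2
      obtain ⟨x, hx, rfl⟩ := Multiset.mem_map.1 hp₀
      obtain ⟨q, hq, hlt'⟩ := hs.forth _ _ _ (hm x hx) hlt
      exact ⟨q, hq, x.2, Multiset.mem_map_of_mem _ hx, hlt'⟩
    choose g hg hg' using this
    refine ⟨r.attach.map fun p => (p.1, g p.1 p.2), ?_, fun x hx => ?_, fun q hq => ?_⟩
    · rw [Multiset.map_map]
      exact Multiset.attach_map_val r
    · obtain ⟨p, -, rfl⟩ := Multiset.mem_map.1 hx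
      exact hg _ _
    · rw [Multiset.map_map] at hq
      obtain ⟨p, -, rfl⟩ := Multiset.mem_map.1 hq
      exact hg' _ _
  obtain ⟨n, hn, hns, hna⟩ := lift
  have hb := hσ.decomp_add h2 _ hna
  rw [← Multiset.map_add] at hb
  -- The labels `r'` to be added to `l₁ + l₂` go to `a'` if something in `l₁` is below them, and
  -- otherwise to `a \ a'`, where something in `l₂` is.
  set r₁ := r'.filter (Above l₁) with hr₁
  set r₂ := r'.filter (fun q => ¬ Above l₁ q) with hr₂
  have hr₁₂ : r₁ + r₂ = r' := Multiset.filter_add_not _ _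
  have hd₁ : Decomp τ a' (l₁ + r₁) :=
    hτ.decomp_add hl₁ _ fun q hq => (Multiset.mem_filter.1 hq).2
  have hd₂ : Decomp τ (a \ a') (l₂ + r₂) := by
    refine hτ.decomp_add hl₂ _ fun q hq => ?_
    obtain ⟨hq, hq'⟩ := Multiset.mem_filter.1 hq
    obtain ⟨p, hp, hpq⟩ := (Multiset.mem_filter.1 hq).2
    rcases Multiset.mem_add.1 hp with hp | hp
    · exact (hq' ⟨p, hp, hpq⟩).elim
    · exact ⟨p, hp, hpq⟩
  have hsplit : (m + n).map Prod.fst = (l₁ + r₁) + (l₂ + r₂) := by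
    rw [Multiset.map_add, hn, heq, ← hr₁₂]
    abel
  obtain ⟨n₁, n₂, hn₁₂, hn₁, hn₂⟩ := Multiset.exists_add_of_map_eq_add _ _ _ _ hsplit
  rw [hn₁₂, Multiset.map_add] at hb
  obtain ⟨b₁, b₂, hbd, hb₁, hb₂, rfl⟩ := Decomp.exists_add _ _ _ hb
  have hall : ∀ x ∈ n₁ + n₂, s x.1 x.2 := by
    rw [← hn₁₂]
    exact fun x hx => (Multiset.mem_add.1 hx).elim (hm x) (hns x)
  refine ⟨b₁, le_sup_left, ⟨n₁, fun x hx => hall x (Multiset.mem_add.2 (Or.inl hx)), ?_, hb₁⟩,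
    ⟨n₂, fun x hx => hall x (Multiset.mem_add.2 (Or.inr hx)), ?_, ?_⟩⟩
  · rwa [hn₁]
  · rwa [hn₂]
  · rwa [hbd.sup_sdiff_cancel_left]

/-- The uncovered parts are kept matched with each other, so that `extend` becomes an instance of
`split`. -/
theorem Matched.backForth (hτ : TrimSystem τ) (hσ : TrimSystem σ) (hs : BiLift s) (a : R) (b : S) :
    BackForth (Matched τ σ s) (fun x y => x ≤ a ∧ y ≤ b ∧ Matched τ σ s (a \ x) (b \ y))
      (Iic a) (Iic b) where
  lower := isLowerSet_Iic a
  mem := fun _ _ h => h.1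
  eq_bot := fun _ _ h hb => h.eq_bot hσ hb
  split := fun _ _ h _ ha' => h.split hτ hσ hs ha'
  extend := by
    rintro x y ⟨hx, hy, h⟩ c hc hxc
    have hcx : c ≤ a \ x := le_sdiff.2 ⟨hc, hxc.symm⟩
    obtain ⟨d, hd, h1, h2⟩ := h.split hτ hσ hs hcx
    obtain ⟨hd1, hd2⟩ := le_sdiff.1 hd
    refine ⟨d, hd1, hd2.symm, h1, sup_le hx hc, sup_le hy hd1, ?_⟩
    rwa [← sdiff_sdiff_left, ← sdiff_sdiff_left]

theorem Matched.orderIso [Countable R] [Countable S] (hτ : TrimSystem τ) (hσ : TrimSystem σ)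
    (hs : BiLift s) {a : R} {b : S} (h : Matched τ σ s a b) : Nonempty (Iic a ≃o Iic b) := by
  refine exists_orderIso_of_backForth (Matched.backForth hτ hσ hs a b) ?_
    ⟨bot_le, bot_le, by simpa using h⟩
  have := Matched.backForth hσ hτ hs.symm b a
  constructor
  · exact isLowerSet_Iic b
  · exact fun _ _ h => h.2.1
  · exact fun _ _ h hb => h.symm.eq_bot hτ hb
  · intro x y h x' hx'
    obtain ⟨y', hy', h1, h2⟩ := h.symm.split hσ hτ hs.symm hx'
    exact ⟨y', hy', h1.symm, h2.symm⟩
  · rintro x y ⟨h1, h2, h3⟩ c hc hxc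
    obtain ⟨d, hd, hyd, e1, e2, e3, e4⟩ := this.extend x y ⟨h2, h1, h3.symm⟩ c hc hxc
    exact ⟨d, hd, hyd, e1.symm, e3, e2, e4.symm⟩

end Decomp

/-! ### Isomorphisms of principal ideals -/

section SameType

variable {R S T : Type u} [GeneralizedBooleanAlgebra R] [GeneralizedBooleanAlgebra S]
  [GeneralizedBooleanAlgebra T]

/-- The principal ideals generated by `a` and `b` are isomorphic. -/
def SameType (a : R) (b : S) : Prop := Nonempty (Iic a ≃o Iic b)

namespace SameType

theorem refl (a : R) : SameType a a := ⟨OrderIso.refl _⟩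

theorem symm {a : R} {b : S} : SameType a b → SameType b a := fun ⟨e⟩ => ⟨e.symm⟩

theorem trans {a : R} {b : S} {c : T} : SameType a b → SameType b c → SameType a c :=
  fun ⟨e⟩ ⟨f⟩ => ⟨e.trans f⟩

end SameType

/-- The image of an element of an ideal under an isomorphism of ideals. -/
def idealMap {a : R} {b : S} (e : Iic a ≃o Iic b) (x : R) (hx : x ≤ a) : S := (e ⟨x, hx⟩).1

section idealMap

variable {a : R} {b : S} (e : Iic a ≃o Iic b)

theorem idealMap_le {x : R} (hx : x ≤ a) : idealMap e x hx ≤ b := (e ⟨x, hx⟩).2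

theorem idealMap_le_iff {x y : R} (hx : x ≤ a) (hy : y ≤ a) :
    idealMap e x hx ≤ idealMap e y hy ↔ x ≤ y :=
  e.le_iff_le (x := ⟨x, hx⟩) (y := ⟨y, hy⟩)

theorem idealMap_symm_idealMap {x : R} (hx : x ≤ a) :
    idealMap e.symm (idealMap e x hx) (idealMap_le e hx) = x := by
  simp [idealMap]

theorem idealMap_idealMap_symm {y : S} (hy : y ≤ b) :
    idealMap e (idealMap e.symm y hy) (idealMap_le e.symm hy) = y := by
  simp [idealMap]

theorem exists_idealMap {y : S} (hy : y ≤ b) : ∃ x, ∃ hx : x ≤ a, idealMap e x hx = y :=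
  ⟨_, _, idealMap_idealMap_symm e hy⟩

theorem idealMap_sup {x y : R} (hx : x ≤ a) (hy : y ≤ a) :
    idealMap e (x ⊔ y) (sup_le hx hy) = idealMap e x hx ⊔ idealMap e y hy := by
  refine le_antisymm ?_ (sup_le ((idealMap_le_iff e _ _).2 le_sup_left)
    ((idealMap_le_iff e _ _).2 le_sup_right))
  obtain ⟨z, hz, hz'⟩ := exists_idealMap e (sup_le (idealMap_le e hx) (idealMap_le e hy))
  rw [← hz', idealMap_le_iff]
  refine sup_le ((idealMap_le_iff e hx hz).1 ?_) ((idealMap_le_iff e hy hz).1 ?_)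
  · rw [hz']; exact le_sup_left
  · rw [hz']; exact le_sup_right

theorem idealMap_bot : idealMap e ⊥ bot_le = ⊥ := by
  obtain ⟨z, hz, hz'⟩ := exists_idealMap e bot_le
  rw [eq_bot_iff, ← hz', idealMap_le_iff]
  exact bot_le

theorem idealMap_top : idealMap e a le_rfl = b := by
  obtain ⟨z, hz, hz'⟩ := exists_idealMap e (le_refl b)
  refine le_antisymm (idealMap_le e _) ?_
  conv_lhs => rw [← hz']
  exact (idealMap_le_iff e _ _).2 hz

theorem idealMap_disjoint {x y : R} (hx : x ≤ a) (hy : y ≤ a) (h : Disjoint x y) :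
    Disjoint (idealMap e x hx) (idealMap e y hy) := by
  intro z hzx hzy
  obtain ⟨w, hw, rfl⟩ := exists_idealMap e (hzx.trans (idealMap_le e hx))
  rw [idealMap_le_iff] at hzx hzy
  have := le_bot_iff.1 (h hzx hzy)
  subst this
  rw [idealMap_bot]

/-- The restriction of an isomorphism of ideals to a smaller ideal. -/
def idealRestrict {x : R} (hx : x ≤ a) : Iic x ≃o Iic (idealMap e x hx) where
  toFun z := ⟨idealMap e z.1 (z.2.trans hx), (idealMap_le_iff e _ _).2 z.2⟩
  invFun z := ⟨idealMap e.symm z.1 (z.2.trans (idealMap_le e hx)), by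
    have := (idealMap_le_iff e.symm (z.2.trans (idealMap_le e hx)) (idealMap_le e hx)).2 z.2
    rwa [idealMap_symm_idealMap e hx] at this⟩
  left_inv z := Subtype.ext (idealMap_symm_idealMap e _)
  right_inv z := Subtype.ext (idealMap_idealMap_symm e _)
  map_rel_iff' := idealMap_le_iff e _ _

theorem sameType_idealMap {x : R} (hx : x ≤ a) : SameType x (idealMap e x hx) :=
  ⟨idealRestrict e hx⟩

end idealMap

theorem SameType.exists_split {a : R} {b : S} (h : SameType a b) {x y : R} (hxy : Disjoint x y)
    (ha : a = x ⊔ y) : ∃ x' y', Disjoint x' y' ∧ b = x' ⊔ y' ∧ SameType x x' ∧ SameType y y' := by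
  obtain ⟨e⟩ := h
  subst ha
  exact ⟨idealMap e x le_sup_left, idealMap e y le_sup_right, idealMap_disjoint e _ _ hxy,
    by rw [← idealMap_sup, idealMap_top], sameType_idealMap e _, sameType_idealMap e _⟩

/-- The ideal generated by a disjoint union is a product. -/
def prodIdealIso {x y : R} (h : Disjoint x y) : Iic x × Iic y ≃o Iic (x ⊔ y) where
  toFun z := ⟨z.1.1 ⊔ z.2.1, sup_le_sup z.1.2 z.2.2⟩
  invFun z := (⟨z.1 ⊓ x, inf_le_right⟩, ⟨z.1 ⊓ y, inf_le_right⟩)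
  left_inv := by
    rintro ⟨⟨u, hu⟩, ⟨v, hv⟩⟩
    refine Prod.ext (Subtype.ext ?_) (Subtype.ext ?_)
    · change (u ⊔ v) ⊓ x = u
      rw [inf_sup_right, inf_eq_left.2 hu, (h.mono_right hv).symm.eq_bot, sup_bot_eq]
    · change (u ⊔ v) ⊓ y = v
      rw [inf_sup_right, inf_eq_left.2 hv, (h.mono_left hu).eq_bot, bot_sup_eq]
  right_inv := by
    rintro ⟨z, hz⟩
    refine Subtype.ext ?_
    change z ⊓ x ⊔ z ⊓ y = z
    rw [← inf_sup_left, inf_eq_left.2 hz]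
  map_rel_iff' := by
    rintro ⟨⟨u, hu⟩, ⟨v, hv⟩⟩ ⟨⟨u', hu'⟩, ⟨v', hv'⟩⟩
    change u ⊔ v ≤ u' ⊔ v' ↔ u ≤ u' ∧ v ≤ v'
    refine ⟨fun hle => ⟨?_, ?_⟩, fun hle => sup_le_sup hle.1 hle.2⟩
    · exact Disjoint.left_le_of_le_sup_right (le_sup_left.trans hle) (h.mono hu hv')
    · exact Disjoint.left_le_of_le_sup_left (le_sup_right.trans hle) (h.symm.mono hv hu')

theorem SameType.of_prod {a b c x y : R} (hxy : Disjoint x y) (hc : c = x ⊔ y)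
    (h : SameType x a) (k : SameType y b) : Nonempty ((Iic a × Iic b) ≃o Iic c) := by
  subst hc
  obtain ⟨e⟩ := h
  obtain ⟨f⟩ := k
  exact ⟨(OmegaStone.prodIso e f).symm.trans (prodIdealIso hxy)⟩

/-- The images of `(a, ⊥)` and `(⊥, b)` are the two complementary parts of `c`. -/
theorem SameType.exists_of_prod {a b c : R} (h : Nonempty ((Iic a × Iic b) ≃o Iic c)) :
    ∃ x y, Disjoint x y ∧ c = x ⊔ y ∧ SameType a x ∧ SameType b y := by
  obtain ⟨e⟩ := h
  set X : Iic c := e (⟨a, le_rfl⟩, ⟨⊥, bot_le⟩) with hX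
  set Y : Iic c := e (⟨⊥, bot_le⟩, ⟨b, le_rfl⟩) with hY
  have hX' : ∀ u : Iic a, e (u, ⟨⊥, bot_le⟩) ≤ X := fun u =>
    e.le_iff_le.2 ⟨u.2, _root_.le_refl _⟩
  have hY' : ∀ v : Iic b, e (⟨⊥, bot_le⟩, v) ≤ Y := fun v =>
    e.le_iff_le.2 ⟨_root_.le_refl _, v.2⟩
  refine ⟨X.1, Y.1, ?_, ?_, ⟨?_⟩, ⟨?_⟩⟩
  · intro z hzx hzy
    obtain ⟨⟨u, v⟩, huv⟩ := e.surjective ⟨z, hzx.trans X.2⟩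
    have h1 : (u, v) ≤ ((⟨a, le_rfl⟩, ⟨⊥, bot_le⟩) : Iic a × Iic b) := by
      rw [← e.le_iff_le, huv]; exact hzx
    have h2 : (u, v) ≤ ((⟨⊥, bot_le⟩, ⟨b, le_rfl⟩) : Iic a × Iic b) := by
      rw [← e.le_iff_le, huv]; exact hzy
    have h3 : ∀ w : Iic c, (⟨z, hzx.trans X.2⟩ : Iic c) ≤ w := by
      intro w
      obtain ⟨⟨u', v'⟩, rfl⟩ := e.surjective w
      rw [← huv, e.le_iff_le]
      exact ⟨h2.1.trans (bot_le (a := u'.1)), h1.2.trans (bot_le (a := v'.1))⟩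
    exact h3 ⟨⊥, bot_le⟩
  · refine le_antisymm ?_ (sup_le X.2 Y.2)
    obtain ⟨⟨u, v⟩, huv⟩ := e.surjective ⟨X.1 ⊔ Y.1, sup_le X.2 Y.2⟩
    obtain ⟨⟨u', v'⟩, huv'⟩ := e.surjective ⟨c, le_rfl⟩
    have h1 : X ≤ e (u, v) := by rw [huv]; exact le_sup_left (a := X.1)
    have h2 : Y ≤ e (u, v) := by rw [huv]; exact le_sup_right (a := X.1)
    have h3 : e (u', v') ≤ e (u, v) :=
      e.le_iff_le.2 ⟨u'.2.trans (e.le_iff_le.1 h1).1, v'.2.trans (e.le_iff_le.1 h2).2⟩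
    rw [huv, huv'] at h3
    exact h3
  · refine RelIso.ofSurjective (OrderEmbedding.ofMapLEIff
      (fun u : Iic a => (⟨(e (u, ⟨⊥, bot_le⟩)).1, hX' u⟩ : Iic X.1)) fun u u' => ?_) ?_
    · exact (e.le_iff_le (x := (u, ⟨⊥, bot_le⟩)) (y := (u', ⟨⊥, bot_le⟩))).trans
        ⟨fun h => h.1, fun h => ⟨h, _root_.le_refl _⟩⟩
    · rintro ⟨z, hz⟩
      obtain ⟨⟨u, v⟩, huv⟩ := e.surjective ⟨z, le_trans hz X.2⟩
      have h1 : e (u, v) ≤ X := by rw [huv]; exact hz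
      have hv : v = ⟨⊥, bot_le⟩ := le_antisymm (e.le_iff_le.1 h1).2 (bot_le (a := v.1))
      subst hv
      exact ⟨u, Subtype.ext (by change (e _).1 = z; rw [huv])⟩
  · refine RelIso.ofSurjective (OrderEmbedding.ofMapLEIff
      (fun v : Iic b => (⟨(e (⟨⊥, bot_le⟩, v)).1, hY' v⟩ : Iic Y.1)) fun u u' => ?_) ?_
    · exact (e.le_iff_le (x := (⟨⊥, bot_le⟩, u)) (y := (⟨⊥, bot_le⟩, u'))).trans
        ⟨fun h => h.2, fun h => ⟨_root_.le_refl _, h⟩⟩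
    · rintro ⟨z, hz⟩
      obtain ⟨⟨u, v⟩, huv⟩ := e.surjective ⟨z, le_trans hz Y.2⟩
      have h1 : e (u, v) ≤ Y := by rw [huv]; exact hz
      have hu : u = ⟨⊥, bot_le⟩ := le_antisymm (e.le_iff_le.1 h1).1 (bot_le (a := u.1))
      subst hu
      exact ⟨v, Subtype.ext (by change (e _).1 = z; rw [huv])⟩

/-- Pseudo-indecomposable elements of a generalised Boolean algebra. -/
def PseudoIndecomposable (a : R) : Prop :=
  a ≠ ⊥ ∧ ∀ b ≤ a, Nonempty (Iic b ≃o Iic a) ∨ Nonempty (Iic (a \ b) ≃o Iic a)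

theorem SameType.ne_bot {a : R} {b : S} (h : SameType a b) (ha : a ≠ ⊥) : b ≠ ⊥ := by
  rintro rfl
  obtain ⟨e⟩ := h
  exact ha (by rw [← idealMap_top e.symm, idealMap_bot])

theorem PseudoIndecomposable.of_sup {a x y : R} (h : PseudoIndecomposable a) (hxy : Disjoint x y)
    (ha : a = x ⊔ y) : SameType x a ∨ SameType y a := by
  subst ha
  have := h.2 x le_sup_left
  rwa [hxy.sup_sdiff_cancel_left] at this

theorem PseudoIndecomposable.sameType {a : R} {b : S} (h : PseudoIndecomposable a)
    (hab : SameType a b) : PseudoIndecomposable b := by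
  refine ⟨hab.ne_bot h.1, fun c hc => ?_⟩
  obtain ⟨x, y, hxy, rfl, hx, hy⟩ :=
    hab.symm.exists_split disjoint_sdiff_self_right (sup_sdiff_cancel_right hc).symm
  exact (h.of_sup hxy rfl).imp (fun k => (hx.trans k).trans hab) fun k => (hy.trans k).trans hab

end SameType

/-! ### Trim systems over simple PO systems -/

namespace TrimSystem

variable {R S P : Type u} [GeneralizedBooleanAlgebra R] [GeneralizedBooleanAlgebra S] [POSystem P]
  {τ : R → P → Prop} {σ : S → P → Prop}

theorem biLift_eq : BiLift (Eq : P → P → Prop) :=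
  ⟨fun _ _ p' h hp => ⟨p', rfl, h ▸ hp⟩, fun _ _ q' h hq => ⟨q', rfl, h ▸ hq⟩⟩

theorem sameType [Countable R] [Countable S] (hτ : TrimSystem τ) (hσ : TrimSystem σ) {a : R}
    {b : S} {p : P} (ha : τ a p) (hb : σ b p) : SameType a b :=
  (Matched.of_kind (s := Eq) ha hb rfl).orderIso hτ hσ biLift_eq

variable (hτ : TrimSystem τ)
include hτ

-- A multiset with a least label, of multiplicity one if that label is in `disc P`, is equivalent to
-- a singleton.
open scoped Classical in
theorem of_decomp {b : R} {l : Multiset P} (h : Decomp τ b l) {p : P} (hp : p ∈ l)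
    (hle : ∀ q ∈ l, le p q) (hc : p ∈ disc P → l.count p ≤ 1) : τ b p := by
  refine (hτ.decomp_congr h (m := {p}) ⟨?_, ?_, ?_⟩).of_single
  · simpa using ⟨p, hp, le_refl p⟩
  · simpa using hle
  · intro r hr hrl hmin
    obtain rfl := hmin p hp (hle r hrl)
    rw [Multiset.count_singleton_self]
    exact _root_.le_antisymm (hc hr) (Multiset.one_le_count_iff_mem.2 hp)

theorem le_of_decomp {a : R} {p : P} (ha : τ a p) {l : Multiset P} (h : Decomp τ a l) {q : P}
    (hq : q ∈ l) : le p q := by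
  obtain ⟨r, hr, hrq⟩ := (hτ.upEquiv a _ _ (.single ha) h).1 q hq
  rwa [Multiset.mem_singleton.1 hr] at hrq

theorem le_of_le {a b : R} {p q : P} (ha : τ a p) (hb : τ b q) (hba : b ≤ a) : le p q := by
  obtain ⟨l, hl⟩ := hτ.exists_decomp (a \ b)
  have := Decomp.cons hb disjoint_sdiff_self_right hl
  rw [sup_sdiff_cancel_right hba] at this
  exact hτ.le_of_decomp ha this (by simp)

open scoped Classical in
theorem count_le_one {a : R} {p : P} (ha : τ a p) {l : Multiset P} (h : Decomp τ a l)
    (hp : p ∈ disc P) : l.count p ≤ 1 := by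
  rw [← (hτ.upEquiv a _ _ (.single ha) h).2.2 p hp (by simp) (by simp),
    Multiset.count_singleton_self]

/-- Otherwise `a` would have a decomposition containing `p` twice, whereas a set of label `p ∈ disc
P` admits it only once. -/
theorem rel_self {a x y : R} {p : P} (ha : τ a p) (hx : τ x p) (hy : τ y p) (hxa : x ≤ a)
    (hya : y ≤ a) (hxy : Disjoint x y) : p ≺ p := by
  classical
  by_contra hp
  obtain ⟨l, hl⟩ := hτ.exists_decomp (a \ (x ⊔ y))
  have := ((Decomp.single hx).add (.single hy) hxy).add hl disjoint_sdiff_self_right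
  rw [sup_sdiff_cancel_right (sup_le hxa hya)] at this
  have := hτ.count_le_one ha this hp
  simp at this

/-- In a decomposition of `a` refining `x ⊔ y` the label `p` is least and occurs; the side on which
it occurs has label `p`. -/
theorem of_sup {a x y : R} {p : P} (ha : τ a p) (hxy : Disjoint x y) (h : a = x ⊔ y) :
    τ x p ∨ τ y p := by
  classical
  subst h
  obtain ⟨l, hl⟩ := hτ.exists_decomp x
  obtain ⟨m, hm⟩ := hτ.exists_decomp y
  have hlm := hl.add hm hxy
  have hle := fun q hq => hτ.le_of_decomp ha hlm (q := q) hq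
  have hmem : p ∈ l + m := by
    obtain ⟨q, hq, hqp⟩ := (hτ.upEquiv _ _ _ (.single ha) hlm).2.1 p (by simp)
    rwa [le_antisymm (hle q hq) hqp]
  have hcount := fun hp => hτ.count_le_one ha hlm (hp : p ∈ disc P)
  rw [Multiset.count_add] at hcount
  rcases Multiset.mem_add.1 hmem with hp | hp
  · exact Or.inl (hτ.of_decomp hl hp (fun q hq => hle q (Multiset.mem_add.2 (Or.inl hq)))
      fun h => by have := hcount h; omega)
  · exact Or.inr (hτ.of_decomp hm hp (fun q hq => hle q (Multiset.mem_add.2 (Or.inr hq)))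
      fun h => by have := hcount h; omega)

variable [Countable R]

theorem pseudoIndecomposable {a : R} {p : P} (ha : τ a p) : PseudoIndecomposable a := by
  refine ⟨hτ.ne_bot a p ha, fun b hb => ?_⟩
  exact (hτ.of_sup ha disjoint_sdiff_self_right (sup_sdiff_cancel_right hb).symm).imp
    (fun h => hτ.sameType hτ h ha) fun h => hτ.sameType hτ h ha

/-- The pieces of `d` cut `c` correspondingly. At each cut one half of `c` keeps the label `r`,
hence the isomorphism type, so some piece of `d` is isomorphic to `c`. -/
theorem exists_le_sameType {d : R} {l : Multiset P} (hd : Decomp τ d l) :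
    ∀ {c : R} {r : P}, τ c r → SameType c d → ∃ d' ≤ d, ∃ v, τ d' v ∧ SameType c d' := by
  induction hd with
  | zero => exact fun hc h => (h.ne_bot (hτ.ne_bot _ _ hc) rfl).elim
  | @cons t s q m ht hdis _ ih =>
    intro c r hc h
    obtain ⟨x, y, hxy, rfl, hx, hy⟩ := h.symm.exists_split hdis rfl
    rcases hτ.of_sup hc hxy rfl with k | k
    · exact ⟨t, le_sup_left, q, ht, (hτ.sameType hτ hc k).trans hx.symm⟩
    · obtain ⟨d', hd', v, hv, hs⟩ := ih k hy.symm
      exact ⟨d', hd'.trans le_sup_right, v, hv, (hτ.sameType hτ hc k).trans hs⟩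

/-- A piece of label `q` splits into labels `q` and `r`. An isomorphism with a piece of label `t`
yields disjoint pieces there, isomorphic to the two parts and with labels weakly above `t`. A label
`v` with `t ≺ v` among these two is the one required; if both equal `t`, two disjoint pieces of
label `t` inside one of label `t` force `t ≺ t`. -/
theorem isCongruence (hne : ∀ p, ∃ a, τ a p) :
    IsCongruence fun p q : P => ∃ a b, τ a p ∧ τ b q ∧ SameType a b := by
  have htrans : ∀ {p q r : P}, (∃ a b, τ a p ∧ τ b q ∧ SameType a b) →
      (∃ a b, τ a q ∧ τ b r ∧ SameType a b) → ∃ a b, τ a p ∧ τ b r ∧ SameType a b := by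
    rintro p q r ⟨a, b, ha, hb, h⟩ ⟨a', b', ha', hb', h'⟩
    exact ⟨a, b', ha, hb', (h.trans (hτ.sameType hτ hb ha')).trans h'⟩
  have hsymm : ∀ {p q : P}, (∃ a b, τ a p ∧ τ b q ∧ SameType a b) →
      ∃ a b, τ a q ∧ τ b p ∧ SameType a b := by
    rintro p q ⟨a, b, ha, hb, h⟩
    exact ⟨b, a, hb, ha, h.symm⟩
  refine ⟨⟨fun p => ?_, hsymm, htrans⟩, ?_⟩
  · obtain ⟨a, ha⟩ := hne p
    exact ⟨a, a, ha, ha, .refl a⟩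
  rintro q r t hqr ⟨a, b, ha, hb, hab⟩
  obtain ⟨a', c, hac, rfl, ha', hc⟩ := hτ.emit a q r ha hqr
  obtain ⟨b', d, hbd, rfl, hb', hd⟩ := hab.exists_split hac rfl
  obtain ⟨l, hl⟩ := hτ.exists_decomp d
  obtain ⟨d', hd', v, hv, hcv⟩ := hτ.exists_le_sameType hl hc hd
  have hrv : ∃ a b, τ a r ∧ τ b v ∧ SameType a b := ⟨c, d', hc, hv, hcv⟩
  rcases hτ.le_of_le hb hv (hd'.trans le_sup_right) with htv | rfl
  · exact ⟨v, hrv, htv⟩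
  obtain ⟨m, hm⟩ := hτ.exists_decomp b'
  obtain ⟨b₁, hb₁, w, hw, haw⟩ := hτ.exists_le_sameType hm ha' hb'
  have hqw : ∃ a b, τ a q ∧ τ b w ∧ SameType a b := ⟨a', b₁, ha', hw, haw⟩
  rcases hτ.le_of_le hb hw (hb₁.trans le_sup_left) with htw | rfl
  -- Here `r`, `t`, `q` and `w` are all congruent, so `w` may take the place of `v`.
  · exact ⟨w, htrans hrv (htrans (hsymm ⟨_, _, ha, hb, hab⟩) hqw), htw⟩
  · exact ⟨t, hrv, hτ.rel_self hb hw hv (hb₁.trans le_sup_left) (hd'.trans le_sup_right)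
      (hbd.mono hb₁ hd')⟩

section Simple

variable (hP : IsSimple P) (hne : ∀ p, ∃ a, τ a p)
include hP hne

theorem kind_unique {a b : R} {p q : P} (ha : τ a p) (hb : τ b q) (h : SameType a b) : p = q :=
  hP _ (hτ.isCongruence hne) p q ⟨a, b, ha, hb, h⟩

theorem exists_le_kind {c d : R} {p : P} (hc : τ c p) (h : SameType c d) : ∃ d' ≤ d, τ d' p := by
  obtain ⟨l, hl⟩ := hτ.exists_decomp d
  obtain ⟨d', hd', v, hv, hs⟩ := hτ.exists_le_sameType hl hc h
  rw [← hτ.kind_unique hP hne hc hv hs] at hv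
  exact ⟨d', hd', hv⟩

/-- Labels occurring in `a` reappear inside `b`, so `p` is least among them. Two disjoint pieces of
label `p` in `a` would give two in `b`, which is impossible for `p ∈ disc P`. -/
theorem kind_of_sameType {a b : R} {p : P} (hb : τ b p) (h : SameType a b) : τ a p := by
  classical
  obtain ⟨a₁, ha₁, hp⟩ := hτ.exists_le_kind hP hne hb h.symm
  obtain ⟨l, hl⟩ := hτ.exists_decomp (a \ a₁)
  have hd := Decomp.cons hp disjoint_sdiff_self_right hl
  rw [sup_sdiff_cancel_right ha₁] at hd
  obtain ⟨e⟩ := h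
  refine hτ.of_decomp hd (by simp) (fun q hq => ?_) fun hdisc => ?_
  · obtain ⟨c, hc, hcq⟩ := hd.exists_mem hq
    obtain ⟨d, hd, hdq⟩ := hτ.exists_le_kind hP hne hcq (sameType_idealMap e hc)
    exact hτ.le_of_le hb hdq (hd.trans (idealMap_le e hc))
  · rw [Multiset.count_cons_self, Multiset.count_eq_zero_of_notMem]
    intro hpl
    obtain ⟨c, hc, hcp⟩ := hl.exists_mem hpl
    have hca : c ≤ a := hc.trans sdiff_le
    obtain ⟨d, hd, hdp⟩ := hτ.exists_le_kind hP hne hcp (sameType_idealMap e hca)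
    obtain ⟨d', hd', hdp'⟩ := hτ.exists_le_kind hP hne hp (sameType_idealMap e ha₁)
    refine hdisc (hτ.rel_self hb hdp hdp' (hd.trans (idealMap_le e _))
      (hd'.trans (idealMap_le e _)) ((idealMap_disjoint e hca ha₁ ?_).mono hd hd'))
    exact disjoint_sdiff_self_left.mono_left hc

/-- A pseudo-indecomposable element is isomorphic to one part of any splitting in two, hence to one
piece of its decomposition. -/
theorem exists_kind {a : R} (ha : PseudoIndecomposable a) : ∃ p, τ a p := by
  have key : ∀ {x : R} {l : Multiset P}, Decomp τ x l → SameType a x → ∃ p, τ a p := by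
    intro x l hx
    induction hx with
    | zero => exact fun h => (h.ne_bot ha.1 rfl).elim
    | @cons t r p m ht hd _ ih =>
      intro h
      obtain ⟨y, z, hyz, hsup, hy, hz⟩ := h.symm.exists_split hd rfl
      rcases ha.of_sup hyz hsup with k | k
      · exact ⟨p, hτ.kind_of_sameType hP hne ht (k.symm.trans hy.symm)⟩
      · exact ih (k.symm.trans hz.symm)
  obtain ⟨l, hl⟩ := hτ.exists_decomp a
  exact key hl (.refl a)

theorem rel_iff {a b : R} {p q : P} (ha : τ a p) (hb : τ b q) :
    p ≺ q ↔ Nonempty ((Iic a × Iic b) ≃o Iic a) := by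
  constructor
  · intro h
    obtain ⟨x, y, hxy, hsup, hx, hy⟩ := hτ.emit a p q ha h
    exact SameType.of_prod hxy hsup (hτ.sameType hτ hx ha) (hτ.sameType hτ hy hb)
  · intro h
    obtain ⟨x, y, hxy, hsup, hx, hy⟩ := SameType.exists_of_prod h
    have hx := hτ.kind_of_sameType hP hne ha hx.symm
    have hy := hτ.kind_of_sameType hP hne hb hy.symm
    have hxa : x ≤ a := hsup ▸ le_sup_left
    have hya : y ≤ a := hsup ▸ le_sup_right
    rcases hτ.le_of_le ha hy hya with h | rfl
    · exact h
    · exact hτ.rel_self ha hx hy hxa hya hxy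

end Simple

end TrimSystem

/-! ### The trim sets of a trim partition -/

section Basis

variable {W : Type u} [TopologicalSpace W] [T2Space W] [LocallyCompactSpace W]
  [TotallyDisconnectedSpace W]

theorem exists_compactOpens_subset {w : W} {U : Set W} (hU : U ∈ 𝓝 w) :
    ∃ C : CompactOpens W, w ∈ C ∧ (C : Set W) ⊆ U := by
  obtain ⟨K, hK, hKU, hKc⟩ := local_compact_nhds hU
  obtain ⟨C, hC, hwC, hCK⟩ := (loc_compact_Haus_tot_disc_of_zero_dim (H := W)).mem_nhds_iff.1 hK
  exact ⟨⟨⟨C, hKc.of_isClosed_subset hC.1 hCK⟩, hC.2⟩, hwC, hCK.trans hKU⟩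

end Basis

section Trim

variable {W P : Type u} [TopologicalSpace W] [POSystem P] {X : P → Set W}

/-- The relation of being trim, for compact open sets. -/
def TrimKind (X : P → Set W) (a : CompactOpens W) (p : P) : Prop := IsTrim X p (a : Set W)

theorem IsTrim.le_of_mem {p q : P} {A : Set W} (h : IsTrim X p A) {w : W} (hw : w ∈ A) (hq : w ∈ X q) :
    le p q := by
  have : q ∈ typeOf X A := ⟨w, hw, hq⟩
  rwa [h.2.2.1] at this

theorem IsTrim.exists_mem {p q : P} {A : Set W} (h : IsTrim X p A) (hq : le p q) :
    ∃ w ∈ A, w ∈ X q := by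
  have : q ∈ typeOf X A := by rw [h.2.2.1]; exact hq
  exact this

theorem IsTrim.eq_of_mem {p : P} {A : Set W} (h : IsTrim X p A) (hp : p ∈ disc P) {w z : W}
    (hw : w ∈ A) (hwp : w ∈ X p) (hz : z ∈ A) (hzp : z ∈ X p) : w = z := by
  obtain ⟨y, hy⟩ := Set.encard_eq_one.1 (h.2.2.2 hp)
  have h1 : w ∈ ({y} : Set W) := hy ▸ ⟨hw, hwp⟩
  have h2 : z ∈ ({y} : Set W) := hy ▸ ⟨hz, hzp⟩
  exact h1.trans h2.symm

theorem IsPOPartition.eq_of_mem (hX : IsPOPartition X) {p q : P} {w : W} (hp : w ∈ X p)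
    (hq : w ∈ X q) : p = q := by
  by_contra h
  exact Set.disjoint_left.1 (hX.disjoint p q h) hp hq

theorem IsPOPartition.exists_ne (hX : IsPOPartition X) {p q : P} (h : p ≺ q) {w : W}
    (hw : w ∈ X p) {U : Set W} (hU : U ∈ 𝓝 w) : ∃ z ∈ U, z ∈ X q ∧ z ≠ w := by
  have : w ∈ derivedSet (X q) ∩ ⋃ r, X r := by
    rw [hX.derived]
    exact mem_biUnion (show p ∈ {r | r ≺ q} from h) hw
  obtain ⟨z, ⟨hz, hzq⟩, hne⟩ := accPt_iff_nhds.1 this.1 U hU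
  exact ⟨z, hz, hzq, hne⟩

theorem IsPOPartition.rel_of_accPt (hX : IsPOPartition X) {p q : P} {w : W}
    (hw : w ∈ X p) (h : ∀ U ∈ 𝓝 w, ∃ z ∈ U, z ∈ X q ∧ z ≠ w) : p ≺ q := by
  have : w ∈ derivedSet (X q) ∩ ⋃ r, X r := by
    refine ⟨accPt_iff_nhds.2 fun U hU => ?_, mem_iUnion.2 ⟨p, hw⟩⟩
    obtain ⟨z, hz, hzq, hne⟩ := h U hU
    exact ⟨z, ⟨hz, hzq⟩, hne⟩
  rw [hX.derived] at this
  obtain ⟨r, hr, hwr⟩ := mem_iUnion₂.1 this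
  rw [hX.eq_of_mem hw hwr]
  exact hr

theorem IsPOPartition.of_limit (hne : ∀ p, (X p).Nonempty)
    (hd : ∀ p q w, w ∈ X p → w ∈ X q → p = q)
    (hlim : ∀ p q w, w ∈ X p → p ≺ q → ∀ U ∈ 𝓝 w, ∃ z ∈ U, z ∈ X q ∧ z ≠ w)
    (hrel : ∀ p q w, w ∈ X p → (∀ U ∈ 𝓝 w, ∃ z ∈ U, z ∈ X q ∧ z ≠ w) → p ≺ q) :
    IsPOPartition X where
  nonempty := hne
  disjoint p q hpq := Set.disjoint_left.2 fun w hp hq => hpq (hd p q w hp hq)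
  derived p := by
    ext w
    constructor
    · rintro ⟨hw, hwX⟩
      obtain ⟨q, hq⟩ := mem_iUnion.1 hwX
      refine mem_biUnion (x := q) (hrel q p w hq fun U hU => ?_) hq
      obtain ⟨z, ⟨hz, hzq⟩, hne⟩ := accPt_iff_nhds.1 hw U hU
      exact ⟨z, hz, hzq, hne⟩
    · intro hw
      obtain ⟨q, hqp, hq⟩ := mem_iUnion₂.1 hw
      refine ⟨accPt_iff_nhds.2 fun U hU => ?_, mem_iUnion.2 ⟨q, hq⟩⟩
      obtain ⟨z, hz, hzq, hne⟩ := hlim q p w hq hqp U hU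
      exact ⟨z, ⟨hz, hzq⟩, hne⟩

theorem IsPOPartition.subset_closure (hX : IsPOPartition X) {p q : P} (h : le p q) :
    X p ⊆ closure (X q) := by
  rcases h with h | rfl
  · intro w hw
    rw [mem_closure_iff_nhds]
    intro U hU
    obtain ⟨z, hz, hzq, -⟩ := hX.exists_ne h hw hU
    exact ⟨z, hz, hzq⟩
  · exact _root_.subset_closure

/-- The criterion for an open compact set to be trim, given that its type is bounded below. -/
theorem IsPOPartition.isTrim (hX : IsPOPartition X) {p : P} {A : Set W} (hA : IsCompact A)
    (hA' : IsOpen A) {w : W} (hw : w ∈ A) (hp : w ∈ X p) (hle : ∀ q, ∀ z ∈ A, z ∈ X q → le p q)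
    (huniq : p ∈ disc P → ∀ z ∈ A, z ∈ X p → z = w) : IsTrim X p A := by
  refine ⟨hA, hA', Set.Subset.antisymm ?_ ?_, fun h => ?_⟩
  · rintro q ⟨z, hz, hzq⟩
    exact hle q z hz hzq
  · rintro q (h | rfl)
    · obtain ⟨z, hz, hzq, -⟩ := hX.exists_ne h hp (hA'.mem_nhds hw)
      exact ⟨z, hz, hzq⟩
    · exact ⟨w, hw, hp⟩
  · rw [Set.encard_eq_one]
    refine ⟨w, Set.Subset.antisymm ?_ ?_⟩
    · rintro z ⟨hz, hzp⟩
      exact huniq h z hz hzp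
    · rintro z rfl
      exact ⟨hw, hp⟩

theorem IsPOPartition.isTrim_of_subset (hX : IsPOPartition X) {p : P} {A B : Set W}
    (hB : IsTrim X p B) (hA : IsCompact A) (hA' : IsOpen A) (hAB : A ⊆ B) {w : W} (hw : w ∈ A)
    (hp : w ∈ X p) : IsTrim X p A :=
  hX.isTrim hA hA' hw hp (fun _ _ hz hzq => hB.le_of_mem (hAB hz) hzq)
    fun hd _ hz hzp => hB.eq_of_mem hd (hAB hz) hzp (hAB hw) hp

/-- The compact open set underlying a trim set. -/
def IsTrim.toCompactOpens {p : P} {A : Set W} (h : IsTrim X p A) : CompactOpens W :=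
  ⟨⟨A, h.1⟩, h.2.1⟩

theorem IsTrimPartition.exists_isTrim (hX : IsTrimPartition X) {p : P} {w : W} (hw : w ∈ X p)
    {U : Set W} (hU : U ∈ 𝓝 w) : ∃ A, IsTrim X p A ∧ w ∈ A ∧ A ⊆ U := by
  obtain ⟨A, hA, hwA⟩ := hX.clean p w hw
  obtain ⟨q, B, hB, hwB, hBA⟩ := hX.base w _ (Filter.inter_mem hU (hA.2.1.mem_nhds hwA))
  exact ⟨B, hX.isTrim_of_subset hA hB.1 hB.2.1 (fun z hz => (hBA hz).2) hwB hw, hwB,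
    fun z hz => (hBA hz).1⟩

theorem IsTrimPartition.exists_kind (hX : IsTrimPartition X) (p : P) :
    ∃ a : CompactOpens W, IsTrim X p a := by
  obtain ⟨w, hw⟩ := hX.nonempty p
  obtain ⟨A, hA, -⟩ := hX.clean p w hw
  exact ⟨hA.toCompactOpens, hA⟩

variable [T2Space W]

/-- If `s \ t` still meets `X q`, it is `q`-trim and disjoint from `t`. If not, every point of `X q`
in `s` lies in `t`, so `p ≼ q` and `t ⊔ s` is `p`-trim. -/
theorem IsTrimPartition.exists_decomp_sup (hX : IsTrimPartition X) {r : CompactOpens W}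
    {l : Multiset P} (h : Decomp (TrimKind X) r l) :
    ∀ {t : CompactOpens W} {p : P}, IsTrim X p (t : Set W) →
      ∃ m, Decomp (TrimKind X) (t ⊔ r) m := by
  induction h with
  | zero => intro t p ht; exact ⟨{p}, by rw [sup_bot_eq]; exact .single ht⟩
  | @cons s r q l hs hd _ ih =>
    intro t p ht
    by_cases hq : ∃ w ∈ (s \ t : CompactOpens W), w ∈ X q
    · obtain ⟨w, hw, hwq⟩ := hq
      obtain ⟨m, hm⟩ := ih ht
      have hst : IsTrim X q ((s \ t : CompactOpens W) : Set W) :=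
        hX.isTrim_of_subset hs (s \ t).isCompact (s \ t).isOpen sdiff_subset hw hwq
      refine ⟨q ::ₘ m, ?_⟩
      have := Decomp.cons (τ := TrimKind X) hst
        (disjoint_sup_right.2 ⟨disjoint_sdiff_self_left, hd.mono_left sdiff_le⟩) hm
      rwa [← sup_assoc, sdiff_sup_self, sup_comm s, sup_assoc] at this
    · have hq' : ∀ w ∈ s, w ∈ X q → w ∈ t := fun w hw hwq => by
        by_contra hwt
        exact hq ⟨w, ⟨hw, hwt⟩, hwq⟩
      have hs : IsTrim X q (s : Set W) := hs
      obtain ⟨w, hw, hwq⟩ := hs.exists_mem (le_refl q)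
      have hpq : le p q := ht.le_of_mem (hq' w hw hwq) hwq
      obtain ⟨z, hz, hzp⟩ := ht.exists_mem (le_refl p)
      have hts : IsTrim X p ((t ⊔ s : CompactOpens W) : Set W) := by
        refine hX.isTrim (t ⊔ s).isCompact (t ⊔ s).isOpen (Or.inl hz) hzp ?_ ?_
        · rintro r y (hy | hy) hyr
          · exact ht.le_of_mem hy hyr
          · exact le_trans hpq (hs.le_of_mem hy hyr)
        · rintro hdisc y (hy | hy) hyp
          · exact ht.eq_of_mem hdisc hy hyp hz hzp
          · have := le_antisymm hpq (hs.le_of_mem hy hyp)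
            subst this
            exact ht.eq_of_mem hdisc (hq' y hy hyp) hyp hz hzp
      obtain ⟨m, hm⟩ := ih hts
      exact ⟨m, by rwa [← sup_assoc]⟩

theorem IsTrimPartition.exists_decomp (hX : IsTrimPartition X) (a : CompactOpens W) :
    ∃ l, Decomp (TrimKind X) a l := by
  have hsup : ∀ {r : CompactOpens W} {l : Multiset P},
      Decomp (TrimKind X) r l → ∀ {r' : CompactOpens W} {l' : Multiset P},
      Decomp (TrimKind X) r' l' →
        ∃ m, Decomp (TrimKind X) (r ⊔ r') m := by
    intro r l h
    induction h with
    | zero => exact fun {r' l'} h' => ⟨l', by rwa [bot_sup_eq]⟩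
    | cons hs _ _ ih =>
      intro r' l' h'
      obtain ⟨m, hm⟩ := ih h'
      rw [sup_assoc]
      exact hX.exists_decomp_sup hm hs
  have := a.isCompact.induction_on (p := fun s => ∃ c : CompactOpens W, c ≤ a ∧ s ⊆ c ∧
    ∃ l, Decomp (TrimKind X) c l) ?_ ?_ ?_ ?_
  · obtain ⟨c, hca, hac, l, hl⟩ := this
    obtain rfl : c = a := _root_.le_antisymm hca hac
    exact ⟨l, hl⟩
  · exact ⟨⊥, bot_le, empty_subset _, 0, .zero⟩
  · rintro s t hst ⟨c, hc, htc, hl⟩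
    exact ⟨c, hc, hst.trans htc, hl⟩
  · rintro s t ⟨c, hc, hsc, l, hl⟩ ⟨d, hd, htd, m, hm⟩
    exact ⟨c ⊔ d, sup_le hc hd, union_subset_union hsc htd, hsup hl hm⟩
  · intro w hw
    obtain ⟨p, A, hA, hwA, hAa⟩ := hX.base w _ (a.isOpen.mem_nhds hw)
    exact ⟨A, mem_nhdsWithin_of_mem_nhds (hA.2.1.mem_nhds hwA), hA.toCompactOpens, hAa,
      Subset.rfl, {p}, .single hA⟩

theorem IsTrimPartition.exists_le_of_decomp {a : CompactOpens W} {l : Multiset P}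
    (h : Decomp (TrimKind X) a l) {q : P} {w : W} :
    w ∈ a → w ∈ X q → ∃ p ∈ l, le p q := by
  induction h with
  | zero => exact fun h => h.elim
  | @cons t r p l ht _ _ ih =>
    rintro (hw | hw) hq
    · exact ⟨p, by simp, IsTrim.le_of_mem ht hw hq⟩
    · obtain ⟨s, hs, hsq⟩ := ih hw hq
      exact ⟨s, by simp [hs], hsq⟩

-- By minimality a piece of another label misses `X p`, while a piece of label `p` meets it in one
-- point. Counting points thus makes the multiplicity independent of the decomposition.
open scoped Classical in
theorem IsTrimPartition.encard_of_decomp {a : CompactOpens W} {l : Multiset P}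
    (h : Decomp (TrimKind X) a l) {p : P} (hp : p ∈ disc P)
    (hmin : ∀ q ∈ l, le q p → q = p) : ((a : Set W) ∩ X p).encard = l.count p := by
  induction h with
  | zero => simp
  | @cons t r q l ht hd _ ih =>
    have hd' : Disjoint ((t : Set W) ∩ X p) (r ∩ X p) := by
      rw [Set.disjoint_left]
      rintro w ⟨hw, -⟩ ⟨hw', -⟩
      have hwb : w ∈ t ⊓ r := ⟨hw, hw'⟩
      rwa [hd.eq_bot] at hwb
    rw [CompactOpens.coe_sup, union_inter_distrib_right, Set.encard_union_eq hd',
      ih fun r hr => hmin r (by simp [hr])]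
    by_cases hq : q = p
    · subst hq
      rw [ht.2.2.2 hp, Multiset.count_cons_self, Nat.cast_add, Nat.cast_one, add_comm]
    · have : (t : Set W) ∩ X p = ∅ := by
        rw [Set.eq_empty_iff_forall_notMem]
        rintro w ⟨hw, hwp⟩
        exact hq (hmin q (by simp) (IsTrim.le_of_mem ht hw hwp))
      rw [this, Multiset.count_cons_of_ne (Ne.symm hq), Set.encard_empty, zero_add]

open scoped Classical in
theorem IsTrimPartition.trimSystem (hX : IsTrimPartition X) :
    TrimSystem (TrimKind X) where
  ne_bot := by
    rintro a p (ha : IsTrim X p (a : Set W)) rfl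
    obtain ⟨w, hw, -⟩ := ha.exists_mem (le_refl p)
    exact hw
  absorb := by
    intro a b p q (ha : IsTrim X p (a : Set W)) (hb : IsTrim X q (b : Set W)) hd hpq
    obtain ⟨w, hw, hwp⟩ := ha.exists_mem (le_refl p)
    refine hX.isTrim (a ⊔ b).isCompact (a ⊔ b).isOpen (Or.inl hw) hwp ?_ ?_
    · rintro r y (hy | hy) hyr
      · exact ha.le_of_mem hy hyr
      · exact le_trans (le_of_rel hpq) (hb.le_of_mem hy hyr)
    · rintro hdisc y (hy | hy) hyp
      · exact ha.eq_of_mem hdisc hy hyp hw hwp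
      · exact (hdisc (rel_of_rel_of_le hpq (hb.le_of_mem hy hyp))).elim
  emit := by
    intro a p q (ha : IsTrim X p (a : Set W)) hpq
    obtain ⟨w, hw, hwp⟩ := ha.exists_mem (le_refl p)
    obtain ⟨z, hz, hzq, hne⟩ := hX.exists_ne hpq hwp (a.isOpen.mem_nhds hw)
    obtain ⟨B, hB, hzB, hBa⟩ := hX.exists_isTrim hzq
      (Filter.inter_mem (a.isOpen.mem_nhds hz) (isOpen_ne.mem_nhds hne))
    let b : CompactOpens W := hB.toCompactOpens
    have hba : b ≤ a := fun y hy => (hBa hy).1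
    refine ⟨a \ b, b, disjoint_sdiff_self_left, (sdiff_sup_cancel hba).symm, ?_, hB⟩
    exact hX.isTrim_of_subset ha (a \ b).isCompact (a \ b).isOpen sdiff_subset
      (w := w) ⟨hw, fun h => (hBa h).2 rfl⟩ hwp
  exists_decomp := hX.exists_decomp
  upEquiv := by
    intro a l m hl hm
    have key : ∀ {l m : Multiset P}, Decomp (TrimKind X) a l →
        Decomp (TrimKind X) a m → ∀ p ∈ m, ∃ q ∈ l, le q p := by
      intro l m hl hm p hp
      obtain ⟨t, hta, ht⟩ := hm.exists_mem hp
      obtain ⟨w, hw, hwp⟩ := IsTrim.exists_mem ht (le_refl p)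
      exact IsTrimPartition.exists_le_of_decomp hl (hta hw) hwp
    refine ⟨key hl hm, key hm hl, fun p hp _ hmin => ?_⟩
    have h1 := IsTrimPartition.encard_of_decomp hl hp hmin
    have h2 := IsTrimPartition.encard_of_decomp hm hp fun q hq hqp => by
      obtain ⟨r, hr, hrq⟩ := key hl hm q hq
      have := hmin r hr (le_trans hrq hqp)
      subst this
      exact le_antisymm hqp hrq
    exact_mod_cast h1.symm.trans h2

end Trim

theorem POSystem.eq_of_rel_eq {P : Type u} {I J : POSystem P} (h : I.rel = J.rel) : I = J := by
  cases I
  cases J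
  cases h
  rfl

/-! ### Extended PO systems from trim partitions -/

section TrimTriple

variable {W P : Type u} [TopologicalSpace W] [POSystem P] {X : P → Set W}

/-- For `r ∈ down Q` the set `X r` lies in the compact closure, so the labels of a finite cover by
trim sets around points of the closure form a foundation. -/
theorem IsTrimPartition.hasFiniteFoundation (hX : IsTrimPartition X) {Q : Set P}
    (hQ : IsCompact (closure (⋃ p ∈ Q, X p))) : HasFiniteFoundation Q := by
  choose p A hA hwA _ using fun w : W => hX.base w univ Filter.univ_mem
  obtain ⟨t, ht, hcov⟩ := hQ.elim_nhds_subcover A fun w _ => (hA w).2.1.mem_nhds (hwA w)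
  refine ⟨p '' (t : Set W), t.finite_toSet.image p, ?_, ?_⟩
  · rintro _ ⟨w, hw, rfl⟩
    obtain ⟨z, hz, hzQ⟩ := mem_closure_iff_nhds.1 (ht w hw) _ ((hA w).2.1.mem_nhds (hwA w))
    obtain ⟨q, hq, hzq⟩ := mem_iUnion₂.1 hzQ
    exact ⟨q, hq, (hA w).le_of_mem hz hzq⟩
  · rintro r ⟨q, hq, hrq⟩
    obtain ⟨z, hz⟩ := hX.nonempty r
    have hz' : z ∈ closure (⋃ p ∈ Q, X p) :=
      closure_mono (subset_biUnion_of_mem (u := X) hq) (hX.subset_closure hrq hz)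
    obtain ⟨w, hw, hzw⟩ := mem_iUnion₂.1 (hcov hz')
    exact ⟨p w, mem_image_of_mem p hw, (hA w).le_of_mem hzw hz⟩

theorem IsTrimTriplePartition.isLower {L : Set P} {f : minDisc L → ℕ∞}
    (hX : IsTrimTriplePartition X L f) : IsLower L := by
  intro q hq r hrq
  rw [← hX.compact_iff] at hq ⊢
  exact hq.of_isClosed_subset isClosed_closure
    (closure_minimal (hX.subset_closure hrq) isClosed_closure)

theorem IsTrimTriplePartition.subset_delta {L : Set P} {f : minDisc L → ℕ∞}
    (hX : IsTrimTriplePartition X L f) : L ⊆ Delta P := by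
  intro p hp
  refine hX.hasFiniteFoundation ?_
  rw [biUnion_singleton]
  exact (hX.compact_iff p).2 hp

/-- As `p` is minimal in the lower set `L`, every trim set around a point of `closure (X p)` has
label `p` and holds a single point of `X p`. -/
theorem IsTrimTriplePartition.pos_finite {L : Set P} {f : minDisc L → ℕ∞}
    (hX : IsTrimTriplePartition X L f) (p : minDisc L) : ∃ n : ℕ, 0 < n ∧ f p = n := by
  obtain ⟨⟨hpL, hmin⟩, hdisc⟩ := p.2
  choose q A hA hwA _ using fun w : W => hX.base w univ Filter.univ_mem
  have hcomp := (hX.compact_iff p).2 hpL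
  obtain ⟨t, ht, hcov⟩ := hcomp.elim_nhds_subcover A fun w _ => (hA w).2.1.mem_nhds (hwA w)
  have hfin : (X p).Finite := by
    refine (Set.Finite.biUnion t.finite_toSet (t := fun w => A w ∩ X p) fun w hw => ?_).subset
      fun z hz => ?_
    · obtain ⟨z, hz, hzp⟩ := mem_closure_iff_nhds.1 (ht w hw) _ ((hA w).2.1.mem_nhds (hwA w))
      have hle := (hA w).le_of_mem hz hzp
      have hq := hmin _ (hX.isLower _ hpL _ hle) hle
      have h1 := (hA w).2.2.2 (hq ▸ hdisc)
      rw [hq] at h1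
      exact Set.finite_of_encard_eq_coe (k := 1) h1
    · obtain ⟨w, hw, hzw⟩ := mem_iUnion₂.1 (hcov (_root_.subset_closure hz))
      exact mem_iUnion₂.2 ⟨w, hw, hzw, hz⟩
  refine ⟨(X p).ncard, (Set.ncard_pos hfin).2 (hX.nonempty p), ?_⟩
  rw [← hX.card_eq, hfin.cast_ncard_eq]

end TrimTriple

/-! ### Structure diagrams read off from trim partitions. -/

theorem Decomp.exists_finset {R P : Type u} [GeneralizedBooleanAlgebra R] {τ : R → P → Prop}
    {a : R} {l : Multiset P} (h : Decomp τ a l) :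
    ∃ s : Finset R, (∀ b ∈ s, ∃ p, τ b p) ∧ (s : Set R).PairwiseDisjoint id ∧ s.sup id = a := by
  classical
  induction h with
  | zero => exact ⟨∅, by simp, by simp, by simp⟩
  | @cons t r p l ht hd _ ih =>
    obtain ⟨s, hs, hsd, rfl⟩ := ih
    refine ⟨insert t s, fun b hb => ?_, ?_, by simp⟩
    · rcases Finset.mem_insert.1 hb with rfl | hb
      · exact ⟨p, ht⟩
      · exact hs b hb
    · rw [Finset.coe_insert]
      exact hsd.insert fun b hb _ => hd.mono_right (Finset.le_sup (f := id) hb)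

namespace OmegaStone

variable {W : OmegaStone.{u}} {P : Type u} [POSystem P] {X : P → Set W.carrier}

theorem isPrimitive_of_isTrimPartition (hX : IsTrimPartition X) : W.IsPrimitive := by
  intro A
  obtain ⟨l, hl⟩ := hX.exists_decomp A
  obtain ⟨s, hs, hd, hA⟩ := hl.exists_finset
  refine ⟨s, fun B hB => ?_, hd, hA⟩
  obtain ⟨p, hp⟩ := hs B hB
  exact hX.trimSystem.pseudoIndecomposable hp

/-- Over a simple `P` a pseudo-indecomposable set has the class of `A p` exactly when it is
`p`-trim. The canonical neighbourhood bases are then bases of trim sets, and `full` and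
`exists_isTrim` give the two inclusions. -/
theorem exists_equiv_structureDiagram (hX : IsTrimPartition X) (hP : IsSimple P) :
    ∃ α : P ≃ W.StructureDiagram, (∀ p q, p ≺ q ↔ α p ≺ α q) ∧ ∀ p, W.canonical (α p) = X p := by
  have hτ := hX.trimSystem
  have hne := hX.exists_kind
  choose A hA using hne
  have hpi : ∀ p, IsPI (W := W) (A p) := fun p => hτ.pseudoIndecomposable (hA p)
  let φ : P → W.StructureDiagram := fun p => Quotient.mk _ ⟨A p, hpi p⟩
  have hφ : ∀ (B : {A : W.Co // IsPI A}) p,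
      (Quotient.mk W.piSetoid B : W.StructureDiagram) = φ p ↔ IsTrim X p (B.1 : Set W.carrier) := by
    intro B p
    constructor
    · intro h
      exact hτ.kind_of_sameType hP hX.exists_kind (hA p) (Quotient.exact h)
    · exact fun h => Quotient.sound (hτ.sameType hτ h (hA p))
  have hbij : Function.Bijective φ := by
    constructor
    · intro p q h
      exact hτ.kind_unique hP hX.exists_kind (hA p) (hA q) (Quotient.exact h)
    · rintro ⟨B⟩
      obtain ⟨p, hp⟩ := hτ.exists_kind hP hX.exists_kind B.2
      exact ⟨p, ((hφ B p).2 hp).symm⟩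
  refine ⟨Equiv.ofBijective φ hbij, fun p q => hτ.rel_iff hP hX.exists_kind (hA p) (hA q),
    fun p => ?_⟩
  ext w
  constructor
  · intro hw
    refine hX.full p w fun U hU => ?_
    obtain ⟨B, hB, hwB, hBU⟩ := hw U hU
    exact ⟨B.1, (hφ B p).1 hB, hwB, hBU⟩
  · intro hw U hU
    obtain ⟨B, hB, hwB, hBU⟩ := hX.exists_isTrim hw hU
    exact ⟨⟨hB.toCompactOpens, hτ.pseudoIndecomposable (p := p) hB⟩, (hφ _ p).2 hB, hwB, hBU⟩

theorem theta_eq_of_isTrimTriplePartition {L : Set P} {f : minDisc L → ℕ∞}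
    (hX : IsTrimTriplePartition X L f) (hP : IsSimple P) :
    W.theta = ⟦{ carrier := P, L := L, f := f }⟧ := by
  obtain ⟨α, h1, h2⟩ := exists_equiv_structureDiagram hX.toIsTrimPartition hP
  have hiso : POTriple.Iso { carrier := P, L := L, f := f } W.triple := by
    refine ⟨α, h1, ?_, ?_⟩
    · ext q
      obtain ⟨p, rfl⟩ := α.surjective q
      change α p ∈ α '' L ↔ IsCompact (closure (W.canonical (α p)))
      rw [h2, hX.compact_iff, α.injective.mem_set_image]
    · intro p q hpq
      change (W.canonical q.1).encard = f p
      have hpq : α p = q.1 := hpq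
      rw [← hpq, h2, hX.card_eq]
  exact (Quotient.sound hiso).symm

/-! ### The canonical partition of a primitive space -/

/-- `A` is pseudo-indecomposable of isomorphism class `p`. -/
def HasKind (A : W.Co) (p : W.StructureDiagram) : Prop :=
  ∃ h : IsPI A, (Quotient.mk W.piSetoid ⟨A, h⟩ : W.StructureDiagram) = p

theorem HasKind.sameType {A B : W.Co} {p : W.StructureDiagram} (hA : HasKind A p)
    (hB : HasKind B p) : SameType A B := by
  obtain ⟨h, rfl⟩ := hA
  obtain ⟨k, hk⟩ := hB
  exact SameType.symm (Quotient.exact hk)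

theorem HasKind.of_sameType {A B : W.Co} {p : W.StructureDiagram} (hA : HasKind A p)
    (h : SameType A B) : HasKind B p := by
  obtain ⟨k, rfl⟩ := hA
  exact ⟨PseudoIndecomposable.sameType k h, Quotient.sound h.symm⟩

theorem HasKind.rel_iff {A B : W.Co} {p q : W.StructureDiagram} (hA : HasKind A p)
    (hB : HasKind B q) : p ≺ q ↔ Nonempty ((Iic A × Iic B) ≃o Iic A) := by
  obtain ⟨h, rfl⟩ := hA
  obtain ⟨k, rfl⟩ := hB
  exact Iff.rfl

theorem exists_hasKind (p : W.StructureDiagram) : ∃ A, HasKind A p := by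
  obtain ⟨A, rfl⟩ := Quotient.exists_rep p
  exact ⟨A.1, A.2, rfl⟩

theorem IsPI.hasKind {A : W.Co} (h : IsPI A) : ∃ p, HasKind A p := ⟨_, h, rfl⟩

theorem HasKind.le {A B : W.Co} {p q : W.StructureDiagram} (hA : HasKind A p) (hB : HasKind B q)
    (hBA : B ≤ A) : le p q := by
  rcases hA.1.2 B hBA with h | h
  · right
    obtain ⟨_, rfl⟩ := hA.of_sameType (SameType.symm h)
    obtain ⟨_, rfl⟩ := hB
    rfl
  · left
    rw [hA.rel_iff hB]
    exact SameType.of_prod disjoint_sdiff_self_left (sdiff_sup_cancel hBA).symm h (.refl B)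

theorem HasKind.exists_split {A : W.Co} {p q : W.StructureDiagram} (hA : HasKind A p)
    (hpq : p ≺ q) : ∃ B C : W.Co, Disjoint B C ∧ A = B ⊔ C ∧ HasKind B p ∧ HasKind C q := by
  obtain ⟨D, hD⟩ := exists_hasKind q
  rw [hA.rel_iff hD] at hpq
  obtain ⟨B, C, hBC, h, hB, hC⟩ := SameType.exists_of_prod hpq
  exact ⟨B, C, hBC, h, hA.of_sameType hB, hD.of_sameType hC⟩

/-- The compact open sets are enumerated and decided in turn: the current set of class `p` has a
part of class `p` inside or disjoint from the next one. By compactness the chosen sets share a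
point, and they form a neighbourhood base there. -/
theorem HasKind.exists_mem_canonical {A : W.Co} {p : W.StructureDiagram} (hA : HasKind A p) :
    ∃ w ∈ A, w ∈ W.canonical p := by
  obtain ⟨g, hg⟩ := exists_surjective_nat W.Co
  have step : ∀ (n : ℕ) (B : {B : W.Co // HasKind B p}), ∃ C : {C : W.Co // HasKind C p},
      C.1 ≤ B.1 ∧ (C.1 ≤ g n ∨ Disjoint C.1 (g n)) := by
    rintro n ⟨B, hB⟩
    rcases hB.1.2 (B ⊓ g n) inf_le_left with h | h
    · exact ⟨⟨B ⊓ g n, hB.of_sameType (SameType.symm h)⟩, inf_le_left, Or.inl inf_le_right⟩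
    · have hd : Disjoint (B \ (B ⊓ g n)) (g n) := by
        rw [sdiff_inf_self_left]
        exact disjoint_sdiff_self_left
      exact ⟨⟨B \ (B ⊓ g n), hB.of_sameType (SameType.symm h)⟩, sdiff_le, Or.inr hd⟩
  choose next hnext hnext' using step
  let C : ℕ → {B : W.Co // HasKind B p} := fun n => Nat.rec ⟨A, hA⟩ next n
  have hC : ∀ n, (C (n + 1)).1 ≤ (C n).1 := fun n => hnext n (C n)
  have hne : (⋂ n, ((C n).1 : Set W.carrier)).Nonempty := by
    refine IsCompact.nonempty_iInter_of_sequence_nonempty_isCompact_isClosed _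
      (fun n => hC n) (fun n => ?_) (C 0).1.isCompact fun n => (C n).1.isCompact.isClosed
    by_contra h
    rw [Set.not_nonempty_iff_eq_empty] at h
    exact (C n).2.1.1 (CompactOpens.ext h)
  obtain ⟨w, hw⟩ := hne
  rw [mem_iInter] at hw
  refine ⟨w, hw 0, fun U hU => ?_⟩
  obtain ⟨D, hwD, hDU⟩ := exists_compactOpens_subset hU
  obtain ⟨n, rfl⟩ := hg D
  rcases hnext' n (C n) with h | h
  · exact ⟨⟨_, (C (n + 1)).2.1⟩, (C (n + 1)).2.2, hw (n + 1), Subset.trans h hDU⟩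
  · have : w ∈ (next n (C n)).1 ⊓ g n := ⟨hw (n + 1), hwD⟩
    rw [h.eq_bot] at this
    exact this.elim

theorem exists_hasKind_of_mem_canonical {p : W.StructureDiagram} {w : W.carrier}
    (hw : w ∈ W.canonical p) {U : Set W.carrier} (hU : U ∈ 𝓝 w) :
    ∃ A : W.Co, HasKind A p ∧ w ∈ A ∧ (A : Set W.carrier) ⊆ U := by
  obtain ⟨A, hA, hwA, hAU⟩ := hw U hU
  exact ⟨A.1, ⟨A.2, hA⟩, hwA, hAU⟩

theorem HasKind.le_of_mem {A : W.Co} {p q : W.StructureDiagram} (hA : HasKind A p) {w : W.carrier}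
    (hw : w ∈ A) (hq : w ∈ W.canonical q) : POSystem.le p q := by
  obtain ⟨B, hB, -, hBA⟩ := exists_hasKind_of_mem_canonical hq (A.isOpen.mem_nhds hw)
  exact hA.le hB hBA

theorem HasKind.exists_mem_of_le {A : W.Co} {p q : W.StructureDiagram} (hA : HasKind A p)
    (h : POSystem.le p q) : ∃ w ∈ A, w ∈ W.canonical q := by
  rcases h with h | rfl
  · obtain ⟨B, C, -, rfl, -, hC⟩ := hA.exists_split h
    obtain ⟨w, hw, hwq⟩ := hC.exists_mem_canonical
    exact ⟨w, Or.inr hw, hwq⟩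
  · exact hA.exists_mem_canonical

theorem eq_of_mem_canonical {p q : W.StructureDiagram} {w : W.carrier} (hp : w ∈ W.canonical p)
    (hq : w ∈ W.canonical q) : p = q := by
  obtain ⟨A, hA, hwA, -⟩ := exists_hasKind_of_mem_canonical hp Filter.univ_mem
  obtain ⟨B, hB, hwB, -⟩ := exists_hasKind_of_mem_canonical hq Filter.univ_mem
  exact le_antisymm (hA.le_of_mem hwA hq) (hB.le_of_mem hwB hp)

variable (W) in
/-- Elements of class `p` contain two disjoint elements of class `p`. -/
def Doubles (p : W.StructureDiagram) : Prop :=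
  ∃ A B C : W.Co, HasKind A p ∧ HasKind B p ∧ HasKind C p ∧ B ≤ A ∧ C ≤ A ∧ Disjoint B C

theorem Doubles.exists_of_hasKind {p : W.StructureDiagram} (h : W.Doubles p) {A : W.Co}
    (hA : HasKind A p) :
    ∃ B C : W.Co, HasKind B p ∧ HasKind C p ∧ B ≤ A ∧ C ≤ A ∧ Disjoint B C := by
  obtain ⟨A', B, C, hA', hB, hC, hBA, hCA, hBC⟩ := h
  obtain ⟨e⟩ := hA'.sameType hA
  exact ⟨_, _, hB.of_sameType (sameType_idealMap e hBA), hC.of_sameType (sameType_idealMap e hCA),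
    idealMap_le e _, idealMap_le e _, idealMap_disjoint e _ _ hBC⟩

theorem doubles_of_rel {p : W.StructureDiagram} (h : p ≺ p) : W.Doubles p := by
  obtain ⟨A, hA⟩ := exists_hasKind p
  obtain ⟨B, C, hBC, rfl, hB, hC⟩ := hA.exists_split h
  exact ⟨_, B, C, hA, hB, hC, le_sup_left, le_sup_right, hBC⟩

variable (W) in
/-- The order of the structure diagram, with the diagonal replaced by `Doubles`. -/
@[reducible] def doublingOrder : POSystem W.StructureDiagram where
  rel p q := p ≺ q ∨ p = q ∧ W.Doubles p
  antisymm := by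
    rintro p q (h | ⟨h, -⟩) (k | ⟨k, -⟩)
    · exact POSystem.antisymm _ _ h k
    · exact k.symm
    · exact h
    · exact h
  trans := by
    rintro p q r (h | ⟨rfl, h⟩) (k | ⟨rfl, k⟩)
    · exact Or.inl (POSystem.trans _ _ _ h k)
    · exact Or.inl h
    · exact Or.inl k
    · exact Or.inr ⟨rfl, h⟩

theorem doublingOrder_le_iff {p q : W.StructureDiagram} :
    @POSystem.le _ W.doublingOrder p q ↔ POSystem.le p q := by
  constructor
  · rintro ((h | ⟨rfl, -⟩) | rfl)
    · exact Or.inl h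
    · exact le_refl _
    · exact le_refl _
  · rintro (h | rfl)
    · exact Or.inl (Or.inl h)
    · exact Or.inr rfl

theorem HasKind.isTrim_doublingOrder {A : W.Co} {p : W.StructureDiagram} (hA : HasKind A p) :
    @IsTrim _ _ _ W.doublingOrder W.canonical p (A : Set W.carrier) := by
  refine ⟨A.isCompact, A.isOpen, ?_, fun hp => ?_⟩
  · ext q
    refine Iff.trans ⟨?_, ?_⟩ doublingOrder_le_iff.symm
    · rintro ⟨w, hw, hwq⟩
      exact hA.le_of_mem hw hwq
    · exact hA.exists_mem_of_le
  · obtain ⟨w, hw, hwp⟩ := hA.exists_mem_canonical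
    rw [Set.encard_eq_one]
    refine ⟨w, Set.Subset.antisymm ?_ ?_⟩
    · rintro z ⟨hz, hzp⟩
      by_contra hne
      obtain ⟨B, hB, hzB, hBA⟩ := exists_hasKind_of_mem_canonical hzp
        (Filter.inter_mem (A.isOpen.mem_nhds hz) (isOpen_ne.mem_nhds hne))
      have hwB : w ∉ B := fun h => (hBA h).2 rfl
      obtain ⟨C, hC, -, hCA⟩ := exists_hasKind_of_mem_canonical hwp
        (Filter.inter_mem (A.isOpen.mem_nhds hw) (B.isCompact.isClosed.isOpen_compl.mem_nhds hwB))
      refine hp (Or.inr ⟨rfl, A, B, C, hA, hB, hC, fun x hx => (hBA hx).1, fun x hx => (hCA hx).1,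
        ?_⟩)
      intro D hDB hDC x hx
      exact (hCA (hDC hx)).2 (hDB hx)
    · rintro z rfl
      exact ⟨hw, hwp⟩

theorem IsPrimitive.exists_hasKind_nhds (hW : W.IsPrimitive) {w : W.carrier} {U : Set W.carrier}
    (hU : U ∈ 𝓝 w) : ∃ (p : W.StructureDiagram) (A : W.Co), HasKind A p ∧ w ∈ A ∧
      (A : Set W.carrier) ⊆ U := by
  obtain ⟨C, hwC, hCU⟩ := exists_compactOpens_subset hU
  obtain ⟨s, hs, -, rfl⟩ := hW C
  have : w ∈ ((s.sup id : W.Co) : Set W.carrier) := hwC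
  rw [CompactOpens.coe_finsetSup] at this
  obtain ⟨A, hA, hwA⟩ := mem_iUnion₂.1 this
  obtain ⟨p, hp⟩ := (hs A hA).hasKind
  exact ⟨p, A, hp, hwA, Subset.trans (show A ≤ s.sup id from Finset.le_sup (f := id) hA) hCU⟩

/-- A point of `X p` is a limit of `X p` as soon as sets of class `p` contain two disjoint copies,
whereas `p ≺ p` asks that two copies together make one. Trimness is therefore proved for the order
with the weaker diagonal, which `rel_of_doubles` then identifies with the original. -/
theorem IsPrimitive.isTrimPartition_doublingOrder (hW : W.IsPrimitive) :
    @IsTrimPartition _ _ _ W.doublingOrder W.canonical := by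
  let := W.doublingOrder
  refine @IsTrimPartition.mk _ _ _ W.doublingOrder _
    (@IsPOPartition.of_limit _ _ _ W.doublingOrder _ ?_ ?_ ?_ ?_) ?_ ?_ ?_
  · intro p
    obtain ⟨A, hA⟩ := exists_hasKind p
    obtain ⟨w, -, hw⟩ := hA.exists_mem_canonical
    exact ⟨w, hw⟩
  · exact fun p q w => eq_of_mem_canonical
  · intro q p w hq hqp U hU
    obtain ⟨A, hA, hwA, hAU⟩ := exists_hasKind_of_mem_canonical hq hU
    by_cases hne : q = p
    · subst hne
      have hd : W.Doubles q := hqp.elim doubles_of_rel And.right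
      obtain ⟨B, C, hB, hC, hBA, hCA, hBC⟩ := hd.exists_of_hasKind hA
      obtain ⟨x, hx, hxq⟩ := hB.exists_mem_canonical
      obtain ⟨y, hy, hyq⟩ := hC.exists_mem_canonical
      by_cases hxw : x = w
      · refine ⟨y, hAU (hCA hy), hyq, ?_⟩
        rintro rfl
        subst hxw
        have : x ∈ B ⊓ C := ⟨hx, hy⟩
        rwa [hBC.eq_bot] at this
      · exact ⟨x, hAU (hBA hx), hxq, hxw⟩
    · obtain ⟨z, hz, hzp⟩ := hA.exists_mem_of_le (Or.inl (hqp.resolve_right fun h => hne h.1))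
      exact ⟨z, hAU hz, hzp, fun h => hne (eq_of_mem_canonical hq (h ▸ hzp))⟩
  · intro q p w hq hw
    obtain ⟨A, hA, hwA, -⟩ := exists_hasKind_of_mem_canonical hq Filter.univ_mem
    obtain ⟨z, hzA, hzp, hne⟩ := hw _ (A.isOpen.mem_nhds hwA)
    rcases hA.le_of_mem hzA hzp with h | rfl
    · exact Or.inl h
    · by_contra hd
      exact hne (hA.isTrim_doublingOrder.eq_of_mem hd hzA hzp hwA hq)
  · intro w U hU
    obtain ⟨p, A, hA, hwA, hAU⟩ := hW.exists_hasKind_nhds hU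
    exact ⟨p, A, hA.isTrim_doublingOrder, hwA, hAU⟩
  · intro p w hw U hU
    obtain ⟨A, hA, hwA, hAU⟩ := hw U hU
    -- A trim set is not yet known to have class `p`, so a neighbourhood `B` with a class is
    -- squeezed between two `p`-trim ones.
    obtain ⟨q, B, hB, hwB, hBA⟩ := hW.exists_hasKind_nhds (hA.2.1.mem_nhds hwA)
    obtain ⟨C, hC, hwC, hCB⟩ := hw _ (B.isOpen.mem_nhds hwB)
    obtain ⟨x, hx, hxp⟩ := hC.exists_mem (le_refl p)
    obtain ⟨y, hy, hyq⟩ := hB.exists_mem_canonical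
    have h1 : POSystem.le p q := hA.le_of_mem (hBA hy) hyq
    have h2 : POSystem.le q p := doublingOrder_le_iff.2 (hB.le_of_mem (hCB hx) hxp)
    obtain rfl := le_antisymm h1 h2
    exact ⟨⟨B, hB.1⟩, hB.2, hwB, hBA.trans hAU⟩
  · intro p w hw
    obtain ⟨A, hA, hwA, -⟩ := exists_hasKind_of_mem_canonical hw Filter.univ_mem
    exact ⟨A, hA.isTrim_doublingOrder, hwA⟩

/-- For the doubling order `B ⊔ C` is trim of label `p` by `absorb`, and trim sets of one label are
isomorphic; hence `(A) × (A) ≅ (B ⊔ C) ≅ (A)`. -/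
theorem IsPrimitive.rel_of_doubles (hW : W.IsPrimitive) {p : W.StructureDiagram}
    (h : W.Doubles p) : p ≺ p := by
  have hd := h
  obtain ⟨A, B, C, hA, hB, hC, -, -, hBC⟩ := h
  have hτ := @IsTrimPartition.trimSystem _ _ _ W.doublingOrder _ _
    hW.isTrimPartition_doublingOrder
  have hsup := @TrimSystem.absorb _ _ _ W.doublingOrder _ hτ B C p p hB.isTrim_doublingOrder
    hC.isTrim_doublingOrder hBC (Or.inr ⟨rfl, hd⟩)
  obtain ⟨e⟩ := @TrimSystem.sameType _ _ _ _ _ W.doublingOrder _ _ _ _ hτ hτ _ _ _ hsup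
    hA.isTrim_doublingOrder
  obtain ⟨f⟩ := SameType.of_prod hBC rfl (hB.sameType hA) (hC.sameType hA)
  exact (hA.rel_iff hA).2 ⟨f.trans e⟩

theorem IsPrimitive.doublingOrder_eq (hW : W.IsPrimitive) :
    W.doublingOrder = (inferInstance : POSystem W.StructureDiagram) := by
  have : W.doublingOrder.rel = (inferInstance : POSystem W.StructureDiagram).rel := by
    funext p q
    refine propext ⟨?_, Or.inl⟩
    rintro (h | ⟨rfl, h⟩)
    · exact h
    · exact hW.rel_of_doubles h
  exact POSystem.eq_of_rel_eq this

theorem IsPrimitive.isTrimPartition (hW : W.IsPrimitive) : IsTrimPartition W.canonical := by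
  have := hW.isTrimPartition_doublingOrder
  rwa [hW.doublingOrder_eq] at this

theorem IsPrimitive.isTrimTriplePartition (hW : W.IsPrimitive) :
    IsTrimTriplePartition W.canonical W.relCompact W.size where
  toIsTrimPartition := hW.isTrimPartition
  compact_iff _ := Iff.rfl
  card_eq _ := rfl

theorem IsPrimitive.isTrim_of_hasKind (hW : W.IsPrimitive) {A : W.Co} {p : W.StructureDiagram}
    (hA : HasKind A p) : IsTrim W.canonical p (A : Set W.carrier) := by
  have := hA.isTrim_doublingOrder
  rwa [hW.doublingOrder_eq] at this

/-- Being symmetric, a congruence lifts `≺` in both directions, so representatives of congruent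
classes are matched and the back-and-forth makes them isomorphic. -/
theorem IsPrimitive.isSimple (hW : W.IsPrimitive) : IsSimple W.StructureDiagram := by
  intro s hs p q hpq
  have hτ := hW.isTrimPartition.trimSystem
  have hbl : BiLift s := ⟨fun p q p' h h' => hs.lift p p' q h' h, fun p q q' h h' => by
    obtain ⟨v, hv, hpv⟩ := hs.lift q q' p h' (hs.equiv.symm h)
    exact ⟨v, hs.equiv.symm hv, hpv⟩⟩
  obtain ⟨A, hA⟩ := exists_hasKind p
  obtain ⟨B, hB⟩ := exists_hasKind q
  have := (Matched.of_kind (τ := TrimKind W.canonical) (σ := TrimKind W.canonical)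
    (hW.isTrim_of_hasKind hA) (hW.isTrim_of_hasKind hB) hpq).orderIso hτ hτ hbl
  obtain ⟨_, rfl⟩ := hA.of_sameType this
  obtain ⟨_, rfl⟩ := hB
  rfl

instance : Countable W.StructureDiagram := by
  unfold StructureDiagram
  infer_instance

theorem IsPrimitive.isExtended (hW : W.IsPrimitive) : W.triple.IsExtended :=
  ⟨hW.isTrimTriplePartition.isLower, hW.isTrimTriplePartition.subset_delta,
    hW.isTrimTriplePartition.pos_finite⟩

theorem IsPrimitive.theta_mem_EPS (hW : W.IsPrimitive) : W.theta ∈ EPS :=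
  ⟨W.triple, hW.isExtended, inferInstanceAs (Countable W.StructureDiagram), hW.isSimple, rfl⟩

end OmegaStone

/-! ### Uniqueness of bounded spaces -/

/-! ### Recovering a space from its compact open sets. -/

section StoneDuality

variable {W V : Type u} [TopologicalSpace W] [T2Space W] [LocallyCompactSpace W]
  [TotallyDisconnectedSpace W] [TopologicalSpace V] [T2Space V] [LocallyCompactSpace V]
  [TotallyDisconnectedSpace V]

-- The images of the compact open neighbourhoods of `w` are non-empty, compact and directed, so they
-- have a common point. If `C` misses `w`, then `C₀ \ C` is such a neighbourhood and keeps that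
-- point out of `e C`.
omit [LocallyCompactSpace V] [TotallyDisconnectedSpace V] in
theorem exists_point_of_orderIso (e : CompactOpens W ≃o CompactOpens V) (w : W) :
    ∃ v : V, ∀ C : CompactOpens W, v ∈ e C ↔ w ∈ C := by
  obtain ⟨C₀, hC₀, -⟩ := exists_compactOpens_subset (Filter.univ_mem (f := 𝓝 w))
  have hdisj : ∀ {C D : CompactOpens W}, Disjoint C D → Disjoint (e C) (e D) := fun h =>
    (disjoint_map_orderIso_iff e).2 h
  have hne : (⋂ C : {C : CompactOpens W // w ∈ C}, ((e C.1 : CompactOpens V) : Set V)).Nonempty := by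
    have : Nonempty {C : CompactOpens W // w ∈ C} := ⟨⟨C₀, hC₀⟩⟩
    refine IsCompact.nonempty_iInter_of_directed_nonempty_isCompact_isClosed _ ?_ ?_
      (fun C => (e C.1).isCompact) fun C => (e C.1).isCompact.isClosed
    · intro C D
      exact ⟨⟨C.1 ⊓ D.1, C.2, D.2⟩, e.monotone inf_le_left, e.monotone inf_le_right⟩
    · intro C
      by_contra h
      rw [Set.not_nonempty_iff_eq_empty] at h
      have h' : e C.1 = ⊥ := CompactOpens.ext h
      rw [map_eq_bot_iff] at h'
      have := C.2
      rw [h'] at this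
      exact this
  obtain ⟨v, hv⟩ := hne
  rw [mem_iInter] at hv
  refine ⟨v, fun C => ⟨fun hvC => ?_, fun hwC => hv ⟨C, hwC⟩⟩⟩
  by_contra hwC
  have h1 : v ∈ e (C₀ \ C) := hv ⟨C₀ \ C, hC₀, hwC⟩
  have h2 : v ∈ e (C₀ \ C) ⊓ e C := ⟨h1, hvC⟩
  rwa [(hdisj disjoint_sdiff_self_left).eq_bot] at h2

theorem eq_of_forall_mem_compactOpens {w z : W} (h : ∀ C : CompactOpens W, z ∈ C → w ∈ C) :
    w = z := by
  by_contra hne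
  obtain ⟨C, hzC, hC⟩ := exists_compactOpens_subset (isOpen_ne.mem_nhds (Ne.symm hne))
  exact hC (h C hzC) rfl

theorem exists_homeomorph_of_orderIso (e : CompactOpens W ≃o CompactOpens V) :
    Nonempty (W ≃ₜ V) := by
  choose φ hφ using exists_point_of_orderIso e
  choose ψ hψ using exists_point_of_orderIso e.symm
  have hcont : ∀ w, ContinuousAt φ w := by
    intro w U hU
    change φ ⁻¹' U ∈ 𝓝 w
    obtain ⟨C, hwC, hCU⟩ := exists_compactOpens_subset hU
    obtain ⟨D, rfl⟩ := e.surjective C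
    exact Filter.mem_of_superset (D.isOpen.mem_nhds ((hφ w D).1 hwC)) fun z hz =>
      hCU ((hφ z D).2 hz)
  have hcont' : ∀ v, ContinuousAt ψ v := by
    intro v U hU
    change ψ ⁻¹' U ∈ 𝓝 v
    obtain ⟨C, hwC, hCU⟩ := exists_compactOpens_subset hU
    obtain ⟨D, rfl⟩ := e.symm.surjective C
    exact Filter.mem_of_superset (D.isOpen.mem_nhds ((hψ v D).1 hwC)) fun z hz =>
      hCU ((hψ z D).2 hz)
  refine ⟨⟨⟨φ, ψ, fun w => ?_, fun v => ?_⟩, continuous_iff_continuousAt.2 hcont,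
    continuous_iff_continuousAt.2 hcont'⟩⟩
  · refine eq_of_forall_mem_compactOpens fun C hC => ?_
    rw [← e.symm_apply_apply C, hψ, hφ]
    exact hC
  · refine eq_of_forall_mem_compactOpens fun C hC => ?_
    rw [← e.apply_symm_apply C, hφ, hψ]
    exact hC

theorem exists_compactOpens_superset {K : Set W} (hK : IsCompact K) :
    ∃ C : CompactOpens W, K ⊆ C := by
  refine hK.induction_on (p := fun s => ∃ C : CompactOpens W, s ⊆ C) ⟨⊥, empty_subset _⟩ ?_ ?_ ?_
  · rintro s t hst ⟨C, hC⟩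
    exact ⟨C, hst.trans hC⟩
  · rintro s t ⟨C, hC⟩ ⟨D, hD⟩
    exact ⟨C ⊔ D, union_subset_union hC hD⟩
  · intro w _
    obtain ⟨C, hC, -⟩ := exists_compactOpens_subset (Filter.univ_mem (f := 𝓝 w))
    exact ⟨C, mem_nhdsWithin_of_mem_nhds (C.isOpen.mem_nhds hC), C, Subset.rfl⟩

end StoneDuality

/-! ### Back-and-forth between bounded trim partitions. -/

section Bounded

variable {W V P Q : Type u} [TopologicalSpace W] [T2Space W] [TopologicalSpace V] [T2Space V]
  [POSystem P] [POSystem Q] {X : P → Set W} {Y : Q → Set V} {L : Set P} {M : Set Q}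
  {f : minDisc L → ℕ∞} {g : minDisc M → ℕ∞}

/-- Pieces of kinds outside `M` can be found outside any compact open set. -/
theorem IsTrimTriplePartition.exists_decomp_disjoint (hY : IsTrimTriplePartition Y M g)
    (l : Multiset Q) (hl : ∀ q ∈ l, q ∉ M) :
    ∀ e : CompactOpens V, ∃ d, Disjoint e d ∧ Decomp (TrimKind Y) d l := by
  induction l using Multiset.induction_on with
  | empty => exact fun e => ⟨⊥, disjoint_bot_right, .zero⟩
  | cons q l ih =>
    intro e
    have hq : ¬ Y q ⊆ e := fun h => hl q (by simp) <| (hY.compact_iff q).1 <|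
      e.isCompact.of_isClosed_subset isClosed_closure (closure_minimal h e.isCompact.isClosed)
    obtain ⟨w, hw, hwe⟩ := Set.not_subset.1 hq
    obtain ⟨A, hA, -, hAe⟩ := hY.exists_isTrim hw (e.isCompact.isClosed.isOpen_compl.mem_nhds hwe)
    let t : CompactOpens V := hA.toCompactOpens
    have het : Disjoint e t := by
      intro x hxe hxt y hy
      exact hAe (hxt hy) (hxe hy)
    obtain ⟨d, hd, hdl⟩ := ih (fun r hr => hl r (by simp [hr])) (e ⊔ t)
    rw [disjoint_sup_left] at hd
    exact ⟨t ⊔ d, disjoint_sup_right.2 ⟨het, hd.1⟩, .cons (t := t) hA hd.2 hdl⟩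

/-- The parts outside `a` and `b` contain matching compact open sets which cover what is left of
the points with labels in `L` and `M`. -/
def Remaining (X : P → Set W) (Y : Q → Set V) (s : P → Q → Prop) (L : Set P) (M : Set Q)
    (a : CompactOpens W) (b : CompactOpens V) : Prop :=
  ∃ a' b', Disjoint a a' ∧ Disjoint b b' ∧ Matched (TrimKind X) (TrimKind Y) s a' b' ∧
    (∀ p ∈ L, X p ⊆ ((a ⊔ a' : CompactOpens W) : Set W)) ∧
    ∀ q ∈ M, Y q ⊆ ((b ⊔ b' : CompactOpens V) : Set V)

theorem Remaining.symm {s : P → Q → Prop} {a : CompactOpens W} {b : CompactOpens V}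
    (h : Remaining X Y s L M a b) : Remaining Y X (fun q p => s p q) M L b a := by
  obtain ⟨a', b', h1, h2, h3, h4, h5⟩ := h
  exact ⟨b', a', h2, h1, h3.symm, h5, h4⟩

/-- The part of `c` inside the reserve `a'` is treated by splitting the reserve. The rest of `c`
contains no point with label in `L`, so only labels outside `L` occur there, and partners for these
exist outside any compact open set. -/
theorem Remaining.backForth (hX : IsTrimTriplePartition X L f) (hY : IsTrimTriplePartition Y M g)
    {s : P → Q → Prop} (hs : BiLift s) (htot : ∀ p, ∃ q, s p q)
    (hLM : ∀ p q, s p q → (p ∈ L ↔ q ∈ M)) :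
    BackForth (Matched (TrimKind X) (TrimKind Y) s) (Remaining X Y s L M) univ univ where
  lower := isLowerSet_univ
  mem _ _ _ := trivial
  eq_bot _ _ h hb := h.eq_bot hY.trimSystem hb
  split _ _ h _ ha' := h.split hX.trimSystem hY.trimSystem hs ha'
  extend := by
    rintro a b ⟨a', b', ha, hb, hab, hcX, hcY⟩ c - hac
    obtain ⟨b₁, hb₁, h1, h2⟩ := hab.split hX.trimSystem hY.trimSystem hs
      (inf_le_right : c ⊓ a' ≤ a')
    obtain ⟨l, hl⟩ := hX.exists_decomp (c \ a')
    have hlL : ∀ p ∈ l, p ∉ L := by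
      intro p hp hpL
      obtain ⟨t, ht, htp⟩ := hl.exists_mem hp
      obtain ⟨w, hw, hwp⟩ := IsTrim.exists_mem htp (le_refl p)
      obtain ⟨hwc, hwa'⟩ := ht hw
      rcases hcX p hpL hwp with h | h
      · have : w ∈ a ⊓ c := ⟨h, hwc⟩
        rwa [hac.eq_bot] at this
      · exact hwa' h
    choose φ hφ using htot
    obtain ⟨d, hd, hdl⟩ := hY.exists_decomp_disjoint (l.map φ) (by
      intro q hq hqM
      obtain ⟨p, hp, rfl⟩ := Multiset.mem_map.1 hq
      exact hlL p hp ((hLM _ _ (hφ p)).2 hqM)) (b ⊔ b')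
    rw [disjoint_sup_left] at hd
    have hcd : Matched (TrimKind X) (TrimKind Y) s (c \ a') d := by
      refine ⟨l.map fun p => (p, φ p), fun x hx => ?_, by simpa using hl, by simpa using hdl⟩
      obtain ⟨p, -, rfl⟩ := Multiset.mem_map.1 hx
      exact hφ p
    have hb₁d : Disjoint b₁ d := hd.2.mono_left hb₁
    have hbb₁ : Disjoint b b₁ := hb.mono_right hb₁
    have hcc : Disjoint (c ⊓ a') (c \ a') := disjoint_inf_sdiff
    refine ⟨b₁ ⊔ d, trivial, disjoint_sup_right.2 ⟨hbb₁, hd.1⟩, ?_, a' \ (c ⊓ a'), b' \ b₁, ?_, ?_,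
      h2, ?_, ?_⟩
    · have := h1.sup hcd hcc hb₁d
      rwa [sup_inf_sdiff] at this
    · refine disjoint_sup_left.2 ⟨ha.mono_right sdiff_le, ?_⟩
      rw [sdiff_inf_self_right]
      exact disjoint_sdiff_self_right
    · refine disjoint_sup_left.2 ⟨hb.mono_right sdiff_le, disjoint_sup_left.2 ⟨?_, ?_⟩⟩
      · exact disjoint_sdiff_self_right
      · exact (hd.2.mono_left sdiff_le).symm
    · intro p hp w hw
      rcases hcX p hp hw with h | h
      · exact Or.inl (Or.inl h)
      · by_cases hwc : w ∈ c
        · exact Or.inl (Or.inr hwc)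
        · exact Or.inr ⟨h, fun h' => hwc h'.1⟩
    · intro q hq w hw
      rcases hcY q hq hw with h | h
      · exact Or.inl (Or.inl h)
      · by_cases hwb : w ∈ b₁
        · exact Or.inl (Or.inr (Or.inl hwb))
        · exact Or.inr ⟨h, hwb⟩

variable [LocallyCompactSpace W] [TotallyDisconnectedSpace W] [LocallyCompactSpace V]
  [TotallyDisconnectedSpace V]

-- A compact open set containing all `X p` with `p ∈ L` is decomposed. As `L` is lower, pieces with
-- labels outside `L` contain no such point and may be dropped.
open scoped Classical in
theorem IsBoundedTrimTriplePartition.exists_decomp_superset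
    (hX : IsBoundedTrimTriplePartition X L f) :
    ∃ a l, Decomp (TrimKind X) a l ∧ (∀ p ∈ l, p ∈ L) ∧ ∀ p ∈ L, X p ⊆ (a : Set W) := by
  obtain ⟨C, hC⟩ := exists_compactOpens_superset hX.bounded
  obtain ⟨l, hl⟩ := hX.exists_decomp C
  rw [← Multiset.filter_add_not (· ∈ L) l] at hl
  obtain ⟨a, b, -, ha, hb, rfl⟩ := Decomp.exists_add _ _ _ hl
  refine ⟨a, _, ha, fun p hp => (Multiset.mem_filter.1 hp).2, fun p hp w hw => ?_⟩
  rcases hC (_root_.subset_closure (mem_biUnion hp hw)) with h | h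
  · exact h
  · obtain ⟨q, hq, hqp⟩ := IsTrimPartition.exists_le_of_decomp hb h hw
    exact ((Multiset.mem_filter.1 hq).2 (hX.isLower p hp q hqp)).elim

omit [LocallyCompactSpace W] [TotallyDisconnectedSpace W] in
open scoped Classical in
theorem IsBoundedTrimTriplePartition.count_eq (hX : IsBoundedTrimTriplePartition X L f)
    {a : CompactOpens W} {l : Multiset P} (hl : Decomp (TrimKind X) a l)
    (ha : ∀ p ∈ L, X p ⊆ (a : Set W)) (p : minDisc L) (hmin : ∀ q ∈ l, le q p → q = p) :
    (l.count p.1 : ℕ∞) = f p := by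
  rw [← hX.card_eq, ← IsTrimPartition.encard_of_decomp hl p.2.2 hmin,
    inter_eq_right.2 (ha p p.2.1.1)]

-- The sets `a` and `b` holding all points with labels in `L` and `M` have equivalent multisets,
-- since `f` and `g` fix the relevant multiplicities. Redecomposing `b` to match `a` gives the
-- initial reserve of the back-and-forth.
open scoped Classical in
theorem IsBoundedTrimTriplePartition.exists_homeomorph [Countable (CompactOpens W)]
    [Countable (CompactOpens V)] (hX : IsBoundedTrimTriplePartition X L f)
    (hY : IsBoundedTrimTriplePartition Y M g) (α : P ≃ Q) (hα : ∀ p q, p ≺ q ↔ α p ≺ α q)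
    (hLM : α '' L = M) (hfg : ∀ (p : minDisc L) (q : minDisc M), α p = q → g q = f p) :
    Nonempty (W ≃ₜ V) := by
  have hle : ∀ p q, le p q ↔ le (α p) (α q) := fun p q =>
    or_congr (hα p q) α.injective.eq_iff.symm
  have hLM' : ∀ p, p ∈ L ↔ α p ∈ M := fun p => by rw [← hLM, α.injective.mem_set_image]
  obtain ⟨a, l, hal, hlL, haL⟩ := hX.exists_decomp_superset
  obtain ⟨b, m, hbm, hmM, hbM⟩ := hY.exists_decomp_superset
  have hlow : ∀ p ∈ L, ∃ q ∈ l, le q p := fun p hp => by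
    obtain ⟨w, hw⟩ := hX.nonempty p
    exact IsTrimPartition.exists_le_of_decomp hal (haL p hp hw) hw
  have hlow' : ∀ q ∈ M, ∃ r ∈ m, le r q := fun q hq => by
    obtain ⟨w, hw⟩ := hY.nonempty q
    exact IsTrimPartition.exists_le_of_decomp hbm (hbM q hq hw) hw
  have hequiv : UpEquiv m (l.map α) := by
    refine UpEquiv.symm ⟨fun q hq => ?_, fun q hq => ?_, fun q hqd hq hmin => ?_⟩
    · obtain ⟨p, rfl⟩ := α.surjective q
      obtain ⟨r, hr, hrp⟩ := hlow p ((hLM' p).2 (hmM _ hq))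
      exact ⟨α r, Multiset.mem_map_of_mem _ hr, (hle _ _).1 hrp⟩
    · obtain ⟨p, hp, rfl⟩ := Multiset.mem_map.1 hq
      exact hlow' _ ((hLM' p).1 (hlL p hp))
    · obtain ⟨p, hp, rfl⟩ := Multiset.mem_map.1 hq
      -- As `l` has an element below each element of `L`, minimality in `l.map α` makes `p` minimal
      -- in all of `L`, which is where `f` is defined.
      have hminL : ∀ r ∈ L, le r p → r = p := by
        intro r hr hrp
        obtain ⟨t, ht, htr⟩ := hlow r hr
        have := α.injective (hmin (α t) (Multiset.mem_map_of_mem _ ht)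
          ((hle _ _).1 (le_trans htr hrp)))
        subst this
        exact le_antisymm hrp htr
      have hpL : p ∈ minDisc L := ⟨⟨hlL p hp, hminL⟩, fun h => hqd ((hα _ _).1 h)⟩
      have hminM : ∀ r ∈ M, le r (α p) → r = α p := by
        intro r hr hrp
        obtain ⟨t, rfl⟩ := α.surjective r
        rw [hminL t ((hLM' t).2 hr) ((hle _ _).2 hrp)]
      have hpM : α p ∈ minDisc M := ⟨⟨(hLM' p).1 (hlL p hp), hminM⟩, hqd⟩
      have h1 := hX.count_eq hal haL ⟨p, hpL⟩ fun r hr => hminL r (hlL r hr)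
      have h2 := hY.count_eq hbm hbM ⟨α p, hpM⟩ fun r hr => hminM r (hmM r hr)
      rw [hfg ⟨p, hpL⟩ ⟨α p, hpM⟩ rfl, ← h1] at h2
      rw [Multiset.count_map_eq_count' _ _ α.injective]
      exact_mod_cast h2.symm
  have hb' := hY.trimSystem.decomp_congr hbm hequiv
  have hs : BiLift fun p q => α p = q := by
    constructor
    · rintro p _ p' rfl h
      exact ⟨α p', rfl, (hα _ _).1 h⟩
    · rintro p _ q' rfl h
      obtain ⟨p', rfl⟩ := α.surjective q'
      exact ⟨p', rfl, (hα _ _).2 h⟩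
  have hR : Remaining X Y (fun p q => α p = q) L M ⊥ ⊥ := by
    refine ⟨a, b, disjoint_bot_left, disjoint_bot_left, ⟨l.map fun p => (p, α p), ?_, ?_, ?_⟩, ?_,
      ?_⟩
    · intro x hx
      obtain ⟨p, -, rfl⟩ := Multiset.mem_map.1 hx
      rfl
    · simpa using hal
    · simpa using hb'
    · simpa using haL
    · simpa using hbM
  have h1 := Remaining.backForth hX.toIsTrimTriplePartition hY.toIsTrimTriplePartition hs
    (fun p => ⟨α p, rfl⟩) (by rintro p _ rfl; exact hLM' p)
  have h2 := Remaining.backForth hY.toIsTrimTriplePartition hX.toIsTrimTriplePartition hs.symm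
    (fun q => ⟨α.symm q, α.apply_symm_apply q⟩) (by rintro _ p rfl; exact (hLM' p).symm)
  obtain ⟨e⟩ := exists_orderIso_of_backForth h1 (by
    refine ⟨h2.lower, fun _ _ h => trivial, fun _ _ h hb => h2.eq_bot _ _ h.symm hb, ?_, ?_⟩
    · intro x y h x' hx'
      obtain ⟨y', hy', k1, k2⟩ := h2.split _ _ h.symm x' hx'
      exact ⟨y', hy', k1.symm, k2.symm⟩
    · intro x y h c hc hxc
      obtain ⟨d, hd, hyd, k1, k2⟩ := h2.extend _ _ h.symm c hc hxc
      exact ⟨d, hd, hyd, k1.symm, k2.symm⟩) hR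
  exact exists_homeomorph_of_orderIso ((OrderIso.Set.univ.symm.trans e).trans OrderIso.Set.univ)

end Bounded

theorem OmegaStone.IsBounded.exists_homeomorph {W V : OmegaStone.{u}} (hW : W.IsBounded)
    (hV : V.IsBounded) (h : W.theta = V.theta) : Nonempty (W.carrier ≃ₜ V.carrier) := by
  obtain ⟨α, h1, h2, h3⟩ := Quotient.exact h
  exact hW.2.exists_homeomorph hV.2 α h1 h2 h3

/-! ### Transport along homeomorphisms -/

section Transport

variable {W V P : Type u} [TopologicalSpace W] [TopologicalSpace V] [POSystem P] {X : P → Set W}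

theorem IsTrim.preimage {p : P} {A : Set W} (hA : IsTrim X p A) (h : V ≃ₜ W) :
    IsTrim (fun p => h ⁻¹' X p) p (h ⁻¹' A) := by
  refine ⟨h.isCompact_preimage.2 hA.1, hA.2.1.preimage h.continuous, ?_, fun hp => ?_⟩
  · rw [← hA.2.2.1]
    ext q
    change (h ⁻¹' (A ∩ X q)).Nonempty ↔ (A ∩ X q).Nonempty
    rw [h.surjective.nonempty_preimage]
  · rw [← hA.2.2.2 hp, ← preimage_inter]
    exact Set.encard_preimage_of_bijective h.bijective _

theorem IsTrim.of_preimage (h : V ≃ₜ W) {p : P} {A : Set V}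
    (hA : IsTrim (fun p => h ⁻¹' X p) p A) : IsTrim X p (h.symm ⁻¹' A) := by
  have := hA.preimage h.symm
  simpa only [← preimage_comp, h.self_comp_symm, preimage_id_eq, id] using this

theorem IsTrimPartition.preimage (hX : IsTrimPartition X) (h : V ≃ₜ W) :
    IsTrimPartition fun p => h ⁻¹' X p where
  toIsPOPartition := by
    refine .of_limit (fun p => (hX.nonempty p).preimage h.surjective)
      (fun p q w => hX.eq_of_mem) ?_ ?_
    · intro p q w hw hpq U hU
      obtain ⟨z, hz, hzq, hne⟩ := hX.exists_ne hpq hw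
        (U := h.symm ⁻¹' U) (h.symm.continuous.continuousAt (by simpa using hU))
      exact ⟨h.symm z, hz, by simpa using hzq, fun h' => hne (by rw [← h']; simp)⟩
    · intro p q w hw hlim
      refine hX.rel_of_accPt hw fun U hU => ?_
      obtain ⟨z, hz, hzq, hne⟩ := hlim _ (h.continuous.continuousAt hU)
      exact ⟨h z, hz, hzq, h.injective.ne hne⟩
  base w U hU := by
    obtain ⟨p, A, hA, hwA, hAU⟩ := hX.base (h w) (h.symm ⁻¹' U)
      (h.symm.continuous.continuousAt (by simpa using hU))
    exact ⟨p, _, hA.preimage h, hwA, fun z hz => by simpa using hAU hz⟩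
  full p w hw := by
    refine hX.full p (h w) fun U hU => ?_
    obtain ⟨A, hA, hwA, hAU⟩ := hw _ (h.continuous.continuousAt hU)
    exact ⟨_, hA.of_preimage h, by simpa using hwA, fun z hz => by simpa using hAU hz⟩
  clean p w hw := by
    obtain ⟨A, hA, hwA⟩ := hX.clean p _ hw
    exact ⟨_, hA.preimage h, hwA⟩

theorem IsTrimTriplePartition.preimage {L : Set P} {f : minDisc L → ℕ∞}
    (hX : IsTrimTriplePartition X L f) (h : V ≃ₜ W) :
    IsTrimTriplePartition (fun p => h ⁻¹' X p) L f where
  toIsTrimPartition := hX.toIsTrimPartition.preimage h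
  compact_iff p := by rw [← h.preimage_closure, h.isCompact_preimage, hX.compact_iff]
  card_eq p := by
    rw [← hX.card_eq]
    exact Set.encard_preimage_of_bijective h.bijective _

end Transport

/-- The pulled-back canonical partition of `W` is a trim partition of `V` over a simple PO system,
hence computes `V.theta`. -/
theorem OmegaStone.IsPrimitive.theta_eq_of_homeomorph {W V : OmegaStone.{u}} (hW : W.IsPrimitive)
    (h : V.carrier ≃ₜ W.carrier) : V.theta = W.theta :=
  theta_eq_of_isTrimTriplePartition (hW.isTrimTriplePartition.preimage h) hW.isSimple

/-! ### The space of branches of a labelled forest -/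

/-- The branches of a forest: its non-empty lower chains. -/
def Branch (T : Type u) [PartialOrder T] : Type u :=
  {b : T → Bool // (∃ u, b u = true) ∧ (∀ u v, v ≤ u → b u = true → b v = true) ∧
    ∀ u v, b u = true → b v = true → u ≤ v ∨ v ≤ u}

namespace Branch

variable {T : Type u} [PartialOrder T]

instance : TopologicalSpace (Branch T) := instTopologicalSpaceSubtype

instance : T2Space (Branch T) := inferInstanceAs (T2Space (Subtype _))

instance : TotallyDisconnectedSpace (Branch T) :=
  inferInstanceAs (TotallyDisconnectedSpace (Subtype _))

instance [Countable T] : SecondCountableTopology (Branch T) :=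
  TopologicalSpace.Subtype.secondCountableTopology _

/-- The set of branches passing through a node. -/
def cone (u : T) : Set (Branch T) := {b | b.1 u = true}

theorem mem_of_le {b : Branch T} {u v : T} (hb : b ∈ cone u) (h : v ≤ u) : b ∈ cone v :=
  b.2.2.1 u v h hb

theorem le_or_le {b : Branch T} {u v : T} (hu : b ∈ cone u) (hv : b ∈ cone v) : u ≤ v ∨ v ≤ u :=
  b.2.2.2 u v hu hv

theorem exists_mem_cone (b : Branch T) : ∃ u, b ∈ cone u := b.2.1

theorem ext_cone {b c : Branch T} (h : ∀ u, b ∈ cone u ↔ c ∈ cone u) : b = c :=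
  Subtype.ext (funext fun u => Bool.eq_iff_iff.2 (h u))

theorem isClopen_cone (u : T) : IsClopen (cone u) :=
  (isClopen_discrete {true}).preimage ((continuous_apply u).comp continuous_subtype_val)

/-- The conditions on a branch each involve at most two coordinates and are closed in `T → Bool`,
except non-emptiness, which `b u = true` makes automatic. -/
theorem isCompact_cone (u : T) : IsCompact (cone u) := by
  have hclosed : ∀ (s : Set (Bool × Bool)) (v w : T), IsClosed {b : T → Bool | (b v, b w) ∈ s} :=
    fun s v w => (isClosed_discrete s).preimage
      ((continuous_apply v).prodMk (continuous_apply w))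
  have : IsClosed {b : T → Bool | b u = true ∧ (∀ v w, w ≤ v → b v = true → b w = true) ∧
      ∀ v w, b v = true → b w = true → v ≤ w ∨ w ≤ v} := by
    simp only [ofPred_and, ofPred_forall]
    refine (hclosed {x | x.1 = true} u u).inter (IsClosed.inter ?_ ?_)
    · refine isClosed_iInter fun v => isClosed_iInter fun w => isClosed_iInter fun _ => ?_
      exact hclosed {x | x.1 = true → x.2 = true} v w
    · refine isClosed_iInter fun v => isClosed_iInter fun w => ?_
      exact hclosed {x | x.1 = true → x.2 = true → v ≤ w ∨ w ≤ v} v w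
  refine Topology.IsInducing.subtypeVal.isCompact_iff.2 ?_
  convert this.isCompact using 1
  ext b
  constructor
  · rintro ⟨c, hc, rfl⟩
    exact ⟨hc, c.2.2⟩
  · rintro ⟨hu, hb⟩
    exact ⟨⟨b, ⟨u, hu⟩, hb⟩, hu, rfl⟩

instance : WeaklyLocallyCompactSpace (Branch T) where
  exists_compact_mem_nhds b := by
    obtain ⟨u, hu⟩ := b.exists_mem_cone
    exact ⟨cone u, isCompact_cone u, (isClopen_cone u).isOpen.mem_nhds hu⟩

/-- A finite set of nodes of a branch is bounded above in it by a node above a given one. -/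
theorem exists_upper_bound (b : Branch T) {v : T} (hv : b ∈ cone v) (F : Finset T)
    (hF : ∀ w ∈ F, b ∈ cone w) : ∃ u, b ∈ cone u ∧ v ≤ u ∧ ∀ w ∈ F, w ≤ u := by
  classical
  induction F using Finset.induction_on with
  | empty => exact ⟨v, hv, le_rfl, by simp⟩
  | insert x F _ ih =>
    obtain ⟨u, hu, hvu, hFu⟩ := ih fun w hw => hF w (by simp [hw])
    rcases le_or_le hu (hF x (by simp)) with h | h
    · refine ⟨x, hF x (by simp), hvu.trans h, fun w hw => ?_⟩
      rcases Finset.mem_insert.1 hw with rfl | hw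
      · exact le_rfl
      · exact (hFu w hw).trans h
    · refine ⟨u, hu, hvu, fun w hw => ?_⟩
      rcases Finset.mem_insert.1 hw with rfl | hw
      · exact h
      · exact hFu w hw

/-- Along a chain finitely many conditions `b ∈ cone w` follow from a single one higher up; the
negative conditions remain as removed cones. -/
theorem exists_nhds {b : Branch T} {U : Set (Branch T)} (hU : U ∈ 𝓝 b) {v : T}
    (hv : b ∈ cone v) : ∃ (u : T) (F : Finset T), v ≤ u ∧ b ∈ cone u ∧ (∀ w ∈ F, b ∉ cone w) ∧
      cone u \ ⋃ w ∈ F, cone w ⊆ U := by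
  classical
  obtain ⟨V, hV, hVU⟩ := (mem_nhds_subtype _ b U).1 hU
  rw [nhds_pi, Filter.mem_pi] at hV
  obtain ⟨I, hI, t, ht, htV⟩ := hV
  obtain ⟨u, hu, hvu, hIu⟩ := b.exists_upper_bound hv (hI.toFinset.filter fun w => b ∈ cone w)
    fun w hw => (Finset.mem_filter.1 hw).2
  refine ⟨u, hI.toFinset.filter fun w => b ∉ cone w, hvu, hu,
    fun w hw => (Finset.mem_filter.1 hw).2, fun c hc => hVU (htV fun w hw => ?_)⟩
  have hcw : c.1 w = b.1 w := by
    rw [Bool.eq_iff_iff]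
    constructor
    · intro h
      by_contra hb
      exact hc.2 (mem_biUnion (x := w) (by simpa using ⟨hw, hb⟩) h)
    · intro h
      exact mem_of_le hc.1 (hIu w (by simpa using ⟨hw, h⟩))
  rw [hcw]
  exact mem_of_mem_nhds (ht w)

end Branch

theorem countable_compactOpens (W : Type u) [TopologicalSpace W] [SecondCountableTopology W] :
    Countable (CompactOpens W) := by
  have hb : IsTopologicalBasis (range (Subtype.val : countableBasis W → Set W)) := by
    rw [Subtype.range_coe]
    exact isBasis_countableBasis W
  choose s hs hCs using fun C : CompactOpens W =>
    eq_finite_iUnion_of_isTopologicalBasis_of_isCompact_open _ hb C C.isCompact C.isOpen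
  have : Countable (countableBasis W) := (countable_countableBasis W).to_subtype
  refine Function.Injective.countable (f := fun C => (hs C).toFinset) fun C D h => ?_
  exact CompactOpens.ext (by rw [hCs C, hCs D, Set.Finite.toFinset_inj.1 h])

/-- A forest with labels in a PO system, growing strictly along the branches, in which every node
has infinitely many pairwise incomparable successors of every possible label. -/
structure IsLabelledForest {T P : Type u} [PartialOrder T] [POSystem P] (lab : T → P) : Prop where
  chain : ∀ u v w : T, u ≤ w → v ≤ w → u ≤ v ∨ v ≤ u
  rel : ∀ u v : T, u < v → lab u ≺ lab v
  child : ∀ (u : T) (q : P), lab u ≺ q → ∀ F : Finset T, (∀ v ∈ F, u < v) →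
    ∃ w, u < w ∧ lab w = q ∧ ∀ v ∈ F, ¬ v ≤ w ∧ ¬ w ≤ v
  root : ∀ u : T, ∃ r ≤ u, IsMin r
  cover : ∀ p : P, ∃ r : T, IsMin r ∧ le (lab r) p

/-- The branches on which the labels are eventually equal to `p`. -/
def branchesOf {T P : Type u} [PartialOrder T] (lab : T → P) (p : P) : Set (Branch T) :=
  {b | ∃ u, b ∈ Branch.cone u ∧ ∀ v, b ∈ Branch.cone v → u ≤ v → lab v = p}

namespace IsLabelledForest

open Branch

variable {T P : Type u} [PartialOrder T] {lab : T → P}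

theorem eq_of_mem {b : Branch T} {p q : P} (hp : b ∈ branchesOf lab p)
    (hq : b ∈ branchesOf lab q) : p = q := by
  obtain ⟨u, hu, hup⟩ := hp
  obtain ⟨v, hv, hvq⟩ := hq
  rcases le_or_le hu hv with h | h
  · rw [← hup v hv h, hvq v hv le_rfl]
  · rw [← hvq u hu h, hup u hu le_rfl]

variable [POSystem P] (hT : IsLabelledForest lab)
include hT

open scoped Classical in
/-- The branch of all the nodes below a given one. -/
noncomputable def principal (u : T) : Branch T :=
  ⟨fun v => decide (v ≤ u), ⟨u, by simp⟩, fun v w h hv => by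
    simp only [decide_eq_true_eq] at hv ⊢; exact h.trans hv, fun v w hv hw => by
    simp only [decide_eq_true_eq] at hv hw; exact hT.chain v w u hv hw⟩

open scoped Classical in
theorem principal_mem_cone {u v : T} : hT.principal u ∈ cone v ↔ v ≤ u := by
  change decide (v ≤ u) = true ↔ v ≤ u
  exact decide_eq_true_iff

theorem lab_le {u v : T} (h : u ≤ v) : le (lab u) (lab v) := by
  rcases h.eq_or_lt with rfl | h
  · exact le_refl _
  · exact le_of_rel (hT.rel u v h)

theorem principal_mem (u : T) : hT.principal u ∈ branchesOf lab (lab u) :=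
  ⟨u, hT.principal_mem_cone.2 le_rfl, fun v hv huv => by
    rw [_root_.le_antisymm (hT.principal_mem_cone.1 hv) huv]⟩

theorem le_of_mem_cone {b : Branch T} {q : P} (hq : b ∈ branchesOf lab q) {u : T}
    (hu : b ∈ cone u) : le (lab u) q := by
  obtain ⟨v, hv, hvq⟩ := hq
  rcases le_or_le hu hv with h | h
  · rw [← hvq v hv le_rfl]
    exact hT.lab_le h
  · rw [hvq u hu h]
    exact le_refl q

/-- A branch continuing beyond `u` would have a node `v` with `lab u ≺ lab v ≼ lab u`. -/
theorem eq_principal {b : Branch T} {u : T} (hu : b ∈ cone u) (hb : b ∈ branchesOf lab (lab u))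
    (hd : lab u ∈ disc P) : b = hT.principal u := by
  refine ext_cone fun v => ?_
  rw [hT.principal_mem_cone]
  refine ⟨fun hv => ?_, mem_of_le hu⟩
  by_contra hvu
  have huv : u < v := ((le_or_le hu hv).resolve_right hvu).lt_of_not_ge hvu
  exact hd (rel_of_rel_of_le (hT.rel u v huv) (hT.le_of_mem_cone hb hv))

/-- The point is the principal branch of a successor of `u` with label `q`, chosen clear of the
removed cones. Should it be `b` itself, a second successor incomparable with the first is taken. -/
theorem exists_mem_ne {b : Branch T} {q : P} {u : T} (hu : b ∈ cone u) (hq : lab u ≺ q)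
    (F : Finset T) (hF : ∀ w ∈ F, b ∉ cone w) :
    ∃ z ∈ cone u \ ⋃ w ∈ F, cone w, z ∈ branchesOf lab q ∧ z ≠ b := by
  classical
  have key : ∀ w, u < w → (∀ v ∈ F, u < v → ¬ v ≤ w) →
      hT.principal w ∈ cone u \ ⋃ w ∈ F, cone w := by
    intro w huw hw
    refine ⟨hT.principal_mem_cone.2 huw.le, fun h => ?_⟩
    obtain ⟨v, hv, hvw⟩ := mem_iUnion₂.1 h
    rw [hT.principal_mem_cone] at hvw
    rcases hT.chain u v w huw.le hvw with h | h
    · rcases h.eq_or_lt with rfl | h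
      · exact hF u hv hu
      · exact hw v hv h hvw
    · exact hF v hv (mem_of_le hu h)
  obtain ⟨w, huw, rfl, hw⟩ := hT.child u q hq (F.filter (u < ·)) (by simp)
  have hwF : ∀ v ∈ F, u < v → ¬ v ≤ w := fun v hv huv => (hw v (by simp [hv, huv])).1
  by_cases hb : hT.principal w = b
  · obtain ⟨w', huw', hlab, hw'⟩ := hT.child u _ hq (insert w (F.filter (u < ·))) (by
      simpa using huw)
    refine ⟨_, key w' huw' fun v hv huv => (hw' v (by simp [hv, huv])).1,
      hlab ▸ hT.principal_mem w', ?_⟩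
    rw [← hb]
    intro h
    exact (hw' w (by simp)).1 (hT.principal_mem_cone.1
      (h ▸ hT.principal_mem_cone.2 le_rfl : hT.principal w' ∈ cone w))
  · exact ⟨_, key w huw hwF, hT.principal_mem w, hb⟩

theorem isPOPartition : IsPOPartition (branchesOf lab) := by
  refine .of_limit ?_ (fun p q w => IsLabelledForest.eq_of_mem) ?_ ?_
  · intro p
    obtain ⟨r, -, hr | rfl⟩ := hT.cover p
    · obtain ⟨w, -, rfl, -⟩ := hT.child r p hr ∅ (by simp)
      exact ⟨_, hT.principal_mem w⟩
    · exact ⟨_, hT.principal_mem r⟩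
  · rintro p q b ⟨v, hv, hvp⟩ hpq U hU
    obtain ⟨u, F, hvu, hu, hF, hFU⟩ := exists_nhds hU hv
    rw [← hvp u hu hvu] at hpq
    obtain ⟨z, hz, hzq, hne⟩ := hT.exists_mem_ne hu hpq F hF
    exact ⟨z, hFU hz, hzq, hne⟩
  · intro p q b hb hlim
    have hb' := hb
    obtain ⟨u, hu, hup⟩ := hb'
    obtain rfl := hup u hu le_rfl
    obtain ⟨z, hz, hzq, hne⟩ := hlim _ ((isClopen_cone u).isOpen.mem_nhds hu)
    rcases hT.le_of_mem_cone hzq hz with h | rfl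
    · exact h
    · by_contra hd
      exact hne ((hT.eq_principal hz hzq hd).trans (hT.eq_principal hu hb hd).symm)

theorem isTrim {u : T} {A : Set (Branch T)} (hA : IsCompact A) (hA' : IsOpen A) (hAu : A ⊆ cone u)
    (hu : hT.principal u ∈ A) : IsTrim (branchesOf lab) (lab u) A :=
  hT.isPOPartition.isTrim hA hA' hu (hT.principal_mem u)
    (fun _ _ hz hzq => hT.le_of_mem_cone hzq (hAu hz))
    fun hd _ hz hzp => hT.eq_principal (hAu hz) hzp hd

theorem isTrim_cone (u : T) : IsTrim (branchesOf lab) (lab u) (cone u) :=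
  hT.isTrim (isCompact_cone u) (isClopen_cone u).isOpen Subset.rfl
    (hT.principal_mem_cone.2 le_rfl)

theorem exists_isTrim {b : Branch T} {U : Set (Branch T)} (hU : U ∈ 𝓝 b) {v : T}
    (hv : b ∈ cone v) : ∃ u A, v ≤ u ∧ b ∈ cone u ∧ IsTrim (branchesOf lab) (lab u) A ∧ b ∈ A ∧
      A ⊆ U ∧ hT.principal u ∈ A := by
  obtain ⟨u, F, hvu, hu, hF, hFU⟩ := exists_nhds hU hv
  have hclopen : IsClopen (⋃ w ∈ F, cone w) := F.finite_toSet.isClopen_biUnion fun w _ =>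
    isClopen_cone w
  have hp : hT.principal u ∈ cone u \ ⋃ w ∈ F, cone w := by
    refine ⟨hT.principal_mem_cone.2 le_rfl, fun h => ?_⟩
    obtain ⟨w, hw, hwu⟩ := mem_iUnion₂.1 h
    exact hF w hw (mem_of_le hu (hT.principal_mem_cone.1 hwu))
  refine ⟨u, _, hvu, hu, hT.isTrim ((isCompact_cone u).diff hclopen.isOpen)
    ((isClopen_cone u).isOpen.sdiff hclopen.isClosed) sdiff_subset hp, ⟨hu, fun h => ?_⟩, hFU, hp⟩
  obtain ⟨w, hw, hwb⟩ := mem_iUnion₂.1 h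
  exact hF w hw hwb

theorem isTrimPartition : IsTrimPartition (branchesOf lab) where
  toIsPOPartition := hT.isPOPartition
  base b U hU := by
    obtain ⟨v, hv⟩ := b.exists_mem_cone
    obtain ⟨u, A, -, -, hA, hbA, hAU, -⟩ := hT.exists_isTrim hU hv
    exact ⟨_, A, hA, hbA, hAU⟩
  full p b hb := by
    obtain ⟨A, hA, hbA, -⟩ := hb univ Filter.univ_mem
    obtain ⟨v, hv⟩ := b.exists_mem_cone
    obtain ⟨u, B, -, hu, -, -, hBA, huB⟩ := hT.exists_isTrim (hA.2.1.mem_nhds hbA) hv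
    -- From `u` on, labels along `b` are at least `p` because `principal u` lies in the `p`-trim set
    -- `A`, and at most `p` because every cone around `b` contains a `p`-trim set.
    have hpu := hA.le_of_mem (hBA huB) (hT.principal_mem u)
    refine ⟨u, hu, fun w hw huw => ?_⟩
    obtain ⟨B, hB, -, hBw⟩ := hb _ ((isClopen_cone w).isOpen.mem_nhds hw)
    obtain ⟨z, hz, hzp⟩ := hB.exists_mem (le_refl p)
    exact le_antisymm (hT.le_of_mem_cone hzp (hBw hz)) (le_trans hpu (hT.lab_le huw))
  clean p b hb := by
    obtain ⟨v, hv, hvp⟩ := hb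
    obtain ⟨u, A, hvu, hu, hA, hbA, -, -⟩ := hT.exists_isTrim Filter.univ_mem hv
    rw [hvp u hu hvu] at hA
    exact ⟨A, hA, hbA⟩

theorem isCompact_closure_of_finite {Q : Set P} (hQ : {r : T | IsMin r ∧ lab r ∈ down Q}.Finite) :
    IsCompact (closure (⋃ p ∈ Q, branchesOf lab p)) := by
  refine (hQ.isCompact_biUnion fun r _ => isCompact_cone r).of_isClosed_subset isClosed_closure
    (closure_minimal ?_ (hQ.isClosed_biUnion fun r _ => (isClopen_cone r).isClosed))
  refine iUnion₂_subset fun p hp b hb => ?_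
  obtain ⟨u, hu⟩ := b.exists_mem_cone
  obtain ⟨r, hru, hr⟩ := hT.root u
  have hbr := mem_of_le hu hru
  exact mem_biUnion (x := r) ⟨hr, p, hp, hT.le_of_mem_cone hb hbr⟩ hbr

/-- Cones of distinct roots are disjoint, and the cone of a root with label below `p` meets
`branchesOf lab p`; so a finite cover of the closure by root cones uses all these roots. -/
theorem finite_of_isCompact_closure {p : P} (hp : IsCompact (closure (branchesOf lab p))) :
    {r : T | IsMin r ∧ le (lab r) p}.Finite := by
  have hroot : ∀ b : Branch T, ∃ r, IsMin r ∧ b ∈ cone r := fun b => by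
    obtain ⟨u, hu⟩ := b.exists_mem_cone
    obtain ⟨r, hru, hr⟩ := hT.root u
    exact ⟨r, hr, mem_of_le hu hru⟩
  choose r hr hbr using hroot
  obtain ⟨t, -, hcov⟩ := hp.elim_nhds_subcover (fun b => cone (r b)) fun b _ =>
    (isClopen_cone _).isOpen.mem_nhds (hbr b)
  refine (t.finite_toSet.image r).subset ?_
  rintro s ⟨hs, hsp⟩
  obtain ⟨z, hz, hzp⟩ := (hT.isTrim_cone s).exists_mem hsp
  obtain ⟨b, hb, hzb⟩ := mem_iUnion₂.1 (hcov (subset_closure hzp))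
  refine ⟨b, hb, ?_⟩
  rcases le_or_le hzb hz with h | h
  · exact hs.eq_of_le h
  · exact (hr b).eq_of_ge h

/-- Such a branch starts at a root of label `p` and, as `p ∈ disc P`, cannot continue. -/
theorem encard_eq {p : P} (hp : p ∈ disc P) (hroot : ∀ r, IsMin r → le (lab r) p → lab r = p) :
    (branchesOf lab p).encard = {r : T | IsMin r ∧ lab r = p}.encard := by
  have : branchesOf lab p = hT.principal '' {r : T | IsMin r ∧ lab r = p} := by
    ext b
    constructor
    · intro hb
      obtain ⟨u, hu⟩ := b.exists_mem_cone
      obtain ⟨r, hru, hr⟩ := hT.root u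
      have hbr := mem_of_le hu hru
      obtain rfl := hroot r hr (hT.le_of_mem_cone hb hbr)
      exact ⟨r, ⟨hr, rfl⟩, (hT.eq_principal hbr hb hp).symm⟩
    · rintro ⟨r, ⟨-, rfl⟩, rfl⟩
      exact hT.principal_mem r
  rw [this]
  refine Function.Injective.encard_image (fun r s h => ?_) _
  refine _root_.le_antisymm (hT.principal_mem_cone.1 ?_) (hT.principal_mem_cone.1 ?_)
  · rw [← h]; exact hT.principal_mem_cone.2 le_rfl
  · rw [h]; exact hT.principal_mem_cone.2 le_rfl

end IsLabelledForest

/-! ### The forest of ascending words -/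

section Words

variable {P : Type u} [POSystem P]

/-- Words, read from right to left, whose labels ascend strictly; the rightmost letter has to be
an admissible root. -/
def IsAscending (R : P → Set ℕ) : List (P × ℕ) → Prop
  | [] => False
  | [x] => x.2 ∈ R x.1
  | x :: y :: t => y.1 ≺ x.1 ∧ IsAscending R (y :: t)

/-- The nodes of the forest of ascending words. -/
def Word (R : P → Set ℕ) : Type u := {u : List (P × ℕ) // IsAscending R u}

variable {R : P → Set ℕ}

instance : PartialOrder (Word R) where
  le u v := u.1 <:+ v.1
  le_refl u := List.suffix_refl u.1
  le_trans _ _ _ := List.IsSuffix.trans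
  le_antisymm _ _ h k := Subtype.ext (h.eq_of_length_le k.length_le)

instance [Countable P] : Countable (Word R) := inferInstanceAs (Countable (Subtype _))

namespace Word

/-- The label of a word is that of its last letter. -/
def label : Word R → P
  | ⟨[], h⟩ => h.elim
  | ⟨x :: _, _⟩ => x.1

theorem exists_eq_cons (u : Word R) : ∃ x t, u.1 = x :: t ∧ u.label = x.1 := by
  obtain ⟨_ | ⟨x, t⟩, h⟩ := u
  · exact h.elim
  · exact ⟨x, t, rfl, rfl⟩

theorem rel_of_suffix : ∀ (v : List (P × ℕ)) (x y : P × ℕ) (s : List (P × ℕ)),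
    IsAscending R (y :: v) → x :: s <:+ v → x.1 ≺ y.1
  | [], _, _, _, _, h => by simp at h
  | z :: v, x, y, s, hv, h => by
    rcases List.suffix_cons_iff.1 h with h | h
    · obtain ⟨rfl, rfl⟩ := List.cons.inj h
      exact hv.1
    · exact POSystem.trans _ _ _ (rel_of_suffix v x z s hv.2 h) hv.1

theorem rel_of_lt {u v : Word R} (h : u < v) : u.label ≺ v.label := by
  obtain ⟨x, s, hu, hx⟩ := u.exists_eq_cons
  obtain ⟨y, t, hv, hy⟩ := v.exists_eq_cons
  have hle : u.1 <:+ v.1 := h.le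
  have hne : u.1 ≠ v.1 := fun h' => h.ne (Subtype.ext h')
  have hv' := v.2
  rw [hu, hv] at hle
  rw [hu, hv] at hne
  rw [hv] at hv'
  rw [hx, hy]
  exact rel_of_suffix t x y s hv' ((List.suffix_cons_iff.1 hle).resolve_left hne)

/-- The word with a single letter. -/
def single (p : P) (n : ℕ) (h : n ∈ R p) : Word R := ⟨[(p, n)], h⟩

theorem isMin_single (p : P) (n : ℕ) (h : n ∈ R p) : IsMin (single p n h) := by
  intro u hu
  obtain ⟨x, s, hx, -⟩ := u.exists_eq_cons
  change [(p, n)] <:+ u.1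
  have hu : u.1 <:+ [(p, n)] := hu
  rw [hx] at hu ⊢
  rw [hu.eq_of_length_le (by simp)]

theorem exists_single_le (u : Word R) : ∃ p n h, single p n h ≤ u := by
  obtain ⟨u, hu⟩ := u
  induction u with
  | nil => exact hu.elim
  | cons x t ih =>
    cases t with
    | nil => exact ⟨x.1, x.2, hu, List.suffix_refl _⟩
    | cons y t =>
      obtain ⟨p, n, h, hle⟩ := ih hu.2
      exact ⟨p, n, h, List.IsSuffix.trans hle (List.suffix_cons _ _)⟩

theorem exists_eq_single {u : Word R} (hu : IsMin u) : ∃ p n h, u = single p n h := by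
  obtain ⟨p, n, h, hle⟩ := u.exists_single_le
  exact ⟨p, n, h, (hu.eq_of_ge hle)⟩

/-- Extending `u` by a letter whose number occurs in no word of `F` makes the result incomparable
with all of `F`. -/
theorem exists_child (u : Word R) (q : P) (h : u.label ≺ q) (F : Finset (Word R))
    (hF : ∀ v ∈ F, u < v) : ∃ w, u < w ∧ w.label = q ∧ ∀ v ∈ F, ¬ v ≤ w ∧ ¬ w ≤ v := by
  classical
  obtain ⟨n, hn⟩ := Infinite.exists_notMem_finset
    (F.biUnion fun v => (v.1.map Prod.snd).toFinset)
  have hn' : ∀ v ∈ F, (q, n) ∉ v.1 := fun v hv h => hn <| Finset.mem_biUnion.2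
    ⟨v, hv, List.mem_toFinset.2 (List.mem_map_of_mem h)⟩
  obtain ⟨x, t, hu, hx⟩ := u.exists_eq_cons
  let w : Word R := ⟨(q, n) :: u.1, by
    have := u.2
    rw [hu] at this ⊢
    exact ⟨hx ▸ h, this⟩⟩
  have huw : u.1 <:+ w.1 := List.suffix_cons _ _
  refine ⟨w, lt_of_le_not_ge huw fun hwu => ?_, rfl, fun v hv => ⟨fun hvw => ?_, fun hwv => ?_⟩⟩
  · have : w.1.length ≤ u.1.length := List.IsSuffix.length_le hwu
    simp [w] at this
  · have hvw : v.1 <:+ (q, n) :: u.1 := hvw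
    rcases List.suffix_cons_iff.1 hvw with h | h
    · exact hn' v hv (by rw [h]; simp)
    · exact (hF v hv).not_ge h
  · have hwv : (q, n) :: u.1 <:+ v.1 := hwv
    exact hn' v hv (hwv.subset (by simp))

theorem isLabelledForest (hR : ∀ p, ∃ q, le q p ∧ (R q).Nonempty) :
    IsLabelledForest (label : Word R → P) where
  chain _ _ _ h k := List.suffix_or_suffix_of_suffix h k
  rel _ _ h := rel_of_lt h
  child := exists_child
  root u := by
    obtain ⟨p, n, h, hle⟩ := u.exists_single_le
    exact ⟨_, hle, isMin_single p n h⟩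
  cover p := by
    obtain ⟨q, hqp, n, hn⟩ := hR p
    exact ⟨_, isMin_single q n hn, hqp⟩

theorem encard_roots (p : P) : {r : Word R | IsMin r ∧ r.label = p}.encard = (R p).encard := by
  have : {r : Word R | IsMin r ∧ r.label = p} =
      (fun n : R p => single p n.1 n.2) '' univ := by
    ext r
    constructor
    · rintro ⟨hr, rfl⟩
      obtain ⟨p, n, h, rfl⟩ := exists_eq_single hr
      exact ⟨⟨n, h⟩, trivial, rfl⟩
    · rintro ⟨n, -, rfl⟩
      exact ⟨isMin_single _ _ _, rfl⟩
  rw [this, Function.Injective.encard_image, Set.encard_univ, ENat.card_coe_set_eq]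
  intro m n h
  have h : [(p, m.1)] = [(p, n.1)] := congrArg Subtype.val h
  simpa [Subtype.ext_iff] using h

theorem finite_roots {Q : Set P} (hQ : (Q ∩ {p | (R p).Nonempty}).Finite)
    (hR : ∀ p ∈ Q, (R p).Finite) : {r : Word R | IsMin r ∧ r.label ∈ Q}.Finite := by
  refine (hQ.biUnion (t := fun p => {r : Word R | IsMin r ∧ r.label = p}) fun p hp => ?_).subset ?_
  · rw [← Set.encard_lt_top_iff, encard_roots, Set.encard_lt_top_iff]
    exact hR p hp.1
  · rintro r ⟨hr, hrQ⟩
    obtain ⟨p, n, h, rfl⟩ := exists_eq_single hr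
    exact mem_biUnion (x := p) ⟨hrQ, n, h⟩ ⟨hr, rfl⟩

end Word

end Words

/-! ### Existence of spaces with a given extended PO system -/

section Existence

variable {P : Type u} [POSystem P] {L : Set P} {f : minDisc L → ℕ∞}

/-- The minimal elements of a subset of a PO system. -/
def minimals (L : Set P) : Set P := {p | p ∈ L ∧ ∀ q ∈ L, le q p → q = p}

theorem minimals_subset_of_isFiniteFoundation (hL : IsLower L) {F Q : Set P}
    (hF : IsFiniteFoundation F Q) (hQ : Q ⊆ L) : minimals L ∩ down Q ⊆ F := by
  rintro p ⟨⟨-, hmin⟩, hp⟩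
  obtain ⟨q, hq, hqp⟩ := hF.2.2 p hp
  obtain ⟨r, hr, hqr⟩ := hF.2.1 hq
  rwa [← hmin q (hL r (hQ hr) q hqr) hqp]

/-- A minimal element of a finite foundation of `{p}` is minimal in `L`. -/
theorem exists_minimal_le (hL : IsLower L) (hΔ : L ⊆ Delta P) {p : P} (hp : p ∈ L) :
    ∃ q ∈ minimals L, le q p := by
  obtain ⟨F, hF⟩ := hΔ hp
  let : PartialOrder P :=
    { le := POSystem.le
      le_refl := POSystem.le_refl
      le_trans := fun _ _ _ => POSystem.le_trans
      le_antisymm := fun _ _ => POSystem.le_antisymm }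
  have hdown : ∀ {q}, q ∈ down ({p} : Set P) ↔ POSystem.le q p := by
    intro q
    simp [down]
  obtain ⟨q, hq, -⟩ := hF.2.2 p (hdown.2 (POSystem.le_refl p))
  obtain ⟨m, hm⟩ := hF.1.exists_minimal ⟨q, hq⟩
  have hmp := hdown.1 (hF.2.1 hm.1)
  refine ⟨m, ⟨hL p hp m hmp, fun r _ hrm => ?_⟩, hmp⟩
  obtain ⟨t, ht, htr⟩ := hF.2.2 r (hdown.2 (POSystem.le_trans hrm hmp))
  exact POSystem.le_antisymm hrm (POSystem.le_trans (hm.2 ht (POSystem.le_trans htr hrm)) htr)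

open scoped Classical in
/-- The admissible roots: infinitely many of each label outside `L`, and for the minimal elements
of `L` as many as prescribed. -/
def rootSet (L : Set P) (f : minDisc L → ℕ∞) (p : P) : Set ℕ :=
  if h : p ∈ minDisc L then {n | (n : ℕ∞) < f ⟨p, h⟩}
  -- A minimal element related to itself gets one root. The other elements of `L` get none, being
  -- reached from minimal ones below them.
  else if p ∈ L then {n | n = 0 ∧ p ∈ minimals L} else univ

theorem encard_rootSet (hf : ∀ p, ∃ n : ℕ, 0 < n ∧ f p = n) (p : minDisc L) :
    (rootSet L f p).encard = f p := by
  obtain ⟨n, -, hn⟩ := hf p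
  have : rootSet L f p = Set.Iio n := by
    ext m
    simp [rootSet, hn]
  rw [this, hn, ← Finset.coe_Iio, Set.encard_coe_eq_coe_finsetCard, Nat.card_Iio]

theorem rootSet_of_notMem {p : P} (hp : p ∉ L) : rootSet L f p = univ := by
  rw [rootSet, dif_neg fun h => hp h.1.1, if_neg hp]

theorem finite_rootSet (hf : ∀ p, ∃ n : ℕ, 0 < n ∧ f p = n) {p : P} (hp : p ∈ L) :
    (rootSet L f p).Finite := by
  by_cases h : p ∈ minDisc L
  · obtain ⟨n, -, hn⟩ := hf ⟨p, h⟩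
    exact Set.finite_of_encard_eq_coe ((encard_rootSet hf ⟨p, h⟩).trans hn)
  · rw [rootSet, dif_neg h, if_pos hp]
    exact (Set.finite_singleton 0).subset fun n hn => hn.1

theorem nonempty_rootSet_iff (hf : ∀ p, ∃ n : ℕ, 0 < n ∧ f p = n) {p : P} (hp : p ∈ L) :
    (rootSet L f p).Nonempty ↔ p ∈ minimals L := by
  by_cases h : p ∈ minDisc L
  · obtain ⟨n, hpos, hn⟩ := hf ⟨p, h⟩
    refine ⟨fun _ => h.1, fun _ => ⟨0, ?_⟩⟩
    rw [rootSet, dif_pos h, hn]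
    exact_mod_cast hpos
  · rw [rootSet, dif_neg h, if_pos hp]
    exact ⟨fun ⟨_, hn⟩ => hn.2, fun h => ⟨0, rfl, h⟩⟩

theorem exists_rootSet_nonempty (hL : IsLower L) (hΔ : L ⊆ Delta P)
    (hf : ∀ p, ∃ n : ℕ, 0 < n ∧ f p = n) (p : P) : ∃ q, le q p ∧ (rootSet L f q).Nonempty := by
  by_cases hp : p ∈ L
  · obtain ⟨q, hq, hqp⟩ := exists_minimal_le hL hΔ hp
    exact ⟨q, hqp, (nonempty_rootSet_iff hf hq.1).2 hq⟩
  · exact ⟨p, le_refl p, by rw [rootSet_of_notMem hp]; exact univ_nonempty⟩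

theorem finite_roots_of_hasFiniteFoundation (hL : IsLower L)
    (hf : ∀ p, ∃ n : ℕ, 0 < n ∧ f p = n) {Q : Set P} (hQ : Q ⊆ L) (hF : HasFiniteFoundation Q) :
    {r : Word (rootSet L f) | IsMin r ∧ r.label ∈ down Q}.Finite := by
  obtain ⟨F, hF⟩ := hF
  have hdown : down Q ⊆ L := by
    rintro p ⟨q, hq, hpq⟩
    exact hL q (hQ hq) p hpq
  refine Word.finite_roots (hF.1.subset ?_) fun p hp => finite_rootSet hf (hdown hp)
  rintro p ⟨hp, hne⟩
  exact minimals_subset_of_isFiniteFoundation hL hF hQ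
    ⟨(nonempty_rootSet_iff hf (hdown hp)).1 hne, hp⟩

/-- A label outside `L` has infinitely many roots, so its closure is not compact. For `p ∈ L` the
roots below `p` have minimal labels, which lie in any foundation of `{p}`, so they are finite in
number. -/
theorem isTrimTriplePartition_branchesOf (hL : IsLower L) (hΔ : L ⊆ Delta P)
    (hf : ∀ p, ∃ n : ℕ, 0 < n ∧ f p = n) :
    IsTrimTriplePartition (branchesOf (Word.label : Word (rootSet L f) → P)) L f := by
  have hT := Word.isLabelledForest (exists_rootSet_nonempty hL hΔ hf)
  refine ⟨hT.isTrimPartition, fun p => ⟨fun h => ?_, fun h => ?_⟩, fun p => ?_⟩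
  · by_contra hp
    have hfin := (hT.finite_of_isCompact_closure h).subset
      (show {r : Word (rootSet L f) | IsMin r ∧ r.label = p} ⊆ _ from
        fun r hr => ⟨hr.1, hr.2 ▸ le_refl _⟩)
    rw [← Set.encard_lt_top_iff, Word.encard_roots, rootSet_of_notMem hp] at hfin
    simp at hfin
  · have := hT.isCompact_closure_of_finite
      (finite_roots_of_hasFiniteFoundation hL hf (singleton_subset_iff.2 h) (hΔ h))
    rwa [biUnion_singleton] at this
  · rw [hT.encard_eq p.2.2, Word.encard_roots, encard_rootSet hf]
    intro r hr hle
    exact p.2.1.2 _ (hL p p.2.1.1 _ hle) hle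

theorem exists_omegaStone [Countable P] (hL : IsLower L) (hΔ : L ⊆ Delta P)
    (hf : ∀ p, ∃ n : ℕ, 0 < n ∧ f p = n) :
    ∃ (W : OmegaStone.{u}) (X : P → Set W.carrier), IsTrimTriplePartition X L f ∧
      (HasFiniteFoundation L → IsCompact (closure (⋃ p ∈ L, X p))) := by
  have hT := Word.isLabelledForest (exists_rootSet_nonempty hL hΔ hf)
  have := countable_compactOpens (Branch (Word (rootSet L f)))
  exact ⟨{ carrier := Branch (Word (rootSet L f)) }, branchesOf Word.label,
    isTrimTriplePartition_branchesOf hL hΔ hf, fun h => hT.isCompact_closure_of_finite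
      (finite_roots_of_hasFiniteFoundation hL hf Subset.rfl h)⟩

end Existence

/-! ### The classification -/

theorem subset_delta_of_hasFiniteFoundation {P : Type u} [POSystem P] {L : Set P}
    (h : HasFiniteFoundation L) : L ⊆ Delta P := by
  obtain ⟨F, hF, -, hF'⟩ := h
  intro p hp
  refine ⟨{r | r ∈ F ∧ le r p}, hF.subset fun r hr => hr.1, fun r hr => ⟨p, rfl, hr.2⟩, ?_⟩
  rintro r ⟨q, rfl, hrq⟩
  obtain ⟨t, ht, htr⟩ := hF' r ⟨q, hp, hrq⟩
  exact ⟨t, ⟨ht, le_trans htr hrq⟩, htr⟩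

theorem hasFiniteFoundation_of_finite {P : Type u} [POSystem P] [Finite P] (Q : Set P) :
    HasFiniteFoundation Q :=
  ⟨down Q, Set.toFinite _, Subset.rfl, fun r hr => ⟨r, hr, le_refl r⟩⟩

namespace OmegaStone

theorem exists_theta_eq {E : POTriple.{u}} (hE : E.IsExtended) (hc : Countable E.carrier)
    (hs : IsSimple E.carrier) : ∃ W : OmegaStone.{u}, W.IsPrimitive ∧ W.theta = ⟦E⟧ ∧
      (HasFiniteFoundation E.L → W.IsBounded) := by
  obtain ⟨W, X, hX, hb⟩ := exists_omegaStone hE.1 hE.2.1 hE.2.2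
  have hW : W.IsPrimitive := isPrimitive_of_isTrimPartition hX.toIsTrimPartition
  refine ⟨W, hW, theta_eq_of_isTrimTriplePartition hX hs, fun hF => ⟨hW, ?_⟩⟩
  obtain ⟨α, -, hα⟩ := exists_equiv_structureDiagram hX.toIsTrimPartition hs
  refine ⟨hW.isTrimTriplePartition, ?_⟩
  have : (⋃ q ∈ W.relCompact, W.canonical q) = ⋃ p ∈ E.L, X p := by
    refine Set.Subset.antisymm (iUnion₂_subset fun q hq => ?_) (iUnion₂_subset fun p hp => ?_)
    · obtain ⟨p, rfl⟩ := α.surjective q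
      have hp : IsCompact (closure (W.canonical (α p))) := hq
      rw [hα, hX.compact_iff] at hp
      rw [hα]
      exact subset_biUnion_of_mem (u := X) hp
    · rw [← hα]
      refine subset_biUnion_of_mem (u := W.canonical) ?_
      change IsCompact (closure (W.canonical (α p)))
      rwa [hα, hX.compact_iff]
  rw [this]
  exact hb hF

variable {W : OmegaStone.{u}}

theorem IsPrimitive.isBounded_of_compactSpace (hW : W.IsPrimitive) [CompactSpace W.carrier] :
    W.IsBounded :=
  ⟨hW, hW.isTrimTriplePartition, isClosed_closure.isCompact⟩

theorem IsPrimitive.isBounded_of_finite (hW : W.IsPrimitive) [Finite W.StructureDiagram] :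
    W.IsBounded := by
  refine ⟨hW, hW.isTrimTriplePartition, ?_⟩
  have hfin := W.relCompact.toFinite
  rw [hfin.closure_biUnion]
  exact hfin.isCompact_biUnion fun p hp => hp

theorem IsBounded.theta_mem (hW : W.IsBounded) : W.theta ∈ boundedTypes :=
  ⟨W.triple, inferInstanceAs (Countable W.StructureDiagram), hW.1.isSimple, hW.1.isExtended.1,
    hW.2.hasFiniteFoundation hW.2.bounded, hW.1.isExtended.2.2, rfl⟩

theorem IsCompactPrimitive.theta_mem (hW : W.IsCompactPrimitive) : W.theta ∈ compactTypes := by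
  obtain ⟨hW, hc⟩ := hW
  exact ⟨W.triple, inferInstanceAs (Countable W.StructureDiagram), hW.isSimple,
    hW.isTrimPartition.hasFiniteFoundation isClosed_closure.isCompact,
    eq_univ_of_forall fun p => isClosed_closure.isCompact, hW.isExtended.2.2, rfl⟩

theorem IsFinitary.theta_mem (hW : W.IsFinitary) : W.theta ∈ finitaryTypes :=
  ⟨W.triple, hW.2, hW.1.isSimple, hW.1.isExtended.1, hW.1.isExtended.2.2, rfl⟩

theorem exists_isBounded_of_mem {c : POTripleClass.{u}} (hc : c ∈ boundedTypes) :
    ∃ W : OmegaStone.{u}, W.IsBounded ∧ W.theta = c := by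
  obtain ⟨E, hcount, hs, hL, hF, hf, rfl⟩ := hc
  obtain ⟨W, -, hθ, hb⟩ :=
    exists_theta_eq ⟨hL, subset_delta_of_hasFiniteFoundation hF, hf⟩ hcount hs
  exact ⟨W, hb hF, hθ⟩

theorem exists_isFinitary_of_mem {c : POTripleClass.{u}} (hc : c ∈ finitaryTypes) :
    ∃ W : OmegaStone.{u}, W.IsFinitary ∧ W.theta = c := by
  obtain ⟨E, hfin, hs, hL, hf, rfl⟩ := hc
  obtain ⟨W, hb, hθ⟩ := exists_isBounded_of_mem
    ⟨E, inferInstance, hs, hL, hasFiniteFoundation_of_finite _, hf, rfl⟩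
  obtain ⟨α, -⟩ := Quotient.exact hθ
  exact ⟨W, ⟨hb.1, Finite.of_equiv _ α.symm⟩, hθ⟩

theorem IsPrimitive.dense (hW : W.IsPrimitive) : closure (⋃ p, W.canonical p) = univ := by
  refine eq_univ_of_forall fun w => mem_closure_iff_nhds.2 fun U hU => ?_
  obtain ⟨p, A, hA, -, hAU⟩ := hW.isTrimPartition.base w U hU
  obtain ⟨z, hz, hzp⟩ := hA.exists_mem (le_refl p)
  exact ⟨z, hAU hz, mem_iUnion.2 ⟨p, hzp⟩⟩

/-- When `L` is everything, boundedness says that the closure of the union of all `X p` is compact,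
and this closure is the whole space. -/
theorem exists_isCompactPrimitive_of_mem {c : POTripleClass.{u}} (hc : c ∈ compactTypes) :
    ∃ W : OmegaStone.{u}, W.IsCompactPrimitive ∧ W.theta = c := by
  obtain ⟨E, hcount, hs, hF, hL, hf, rfl⟩ := hc
  obtain ⟨W, hb, hθ⟩ := exists_isBounded_of_mem
    ⟨E, hcount, hs, by rw [hL]; exact fun _ _ _ _ => trivial, by rwa [hL], hf, rfl⟩
  obtain ⟨α, -, hα, -⟩ := Quotient.exact hθ
  have huniv : W.relCompact = univ := by
    refine eq_univ_of_forall fun p => ?_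
    have : α p ∈ α '' W.relCompact := by
      change α p ∈ α '' W.triple.L
      rw [hα, hL]
      trivial
    exact (α.injective.mem_set_image).1 this
  have := hb.2.bounded
  rw [huniv, biUnion_univ, hb.1.dense] at this
  exact ⟨W, ⟨hb.1, isCompact_univ_iff.1 this⟩, hθ⟩

theorem bijOn_classesOf {Θ : OmegaStoneClass.{u} → POTripleClass.{u}}
    (hΘ : ∀ W : OmegaStone.{u}, W.IsPrimitive → Θ ⟦W⟧ = W.theta) {C : OmegaStone.{u} → Prop}
    {t : Set POTripleClass.{u}} (hC : ∀ W, C W → W.IsBounded) (hmaps : ∀ W, C W → W.theta ∈ t)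
    (hsurj : ∀ c ∈ t, ∃ W, C W ∧ W.theta = c) : BijOn Θ (classesOf C) t := by
  refine ⟨?_, ?_, ?_⟩
  · rintro _ ⟨W, hW, rfl⟩
    rw [hΘ W (hC W hW).1]
    exact hmaps W hW
  · rintro _ ⟨W, hW, rfl⟩ _ ⟨V, hV, rfl⟩ h
    rw [hΘ W (hC W hW).1, hΘ V (hC V hV).1] at h
    exact Quotient.sound ((hC W hW).exists_homeomorph (hC V hV) h)
  · intro c hc
    obtain ⟨W, hW, rfl⟩ := hsurj c hc
    exact ⟨⟦W⟧, ⟨W, hW, rfl⟩, hΘ W (hC W hW).1⟩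

end OmegaStone

theorem mainTheorem5 :
    (∀ W : OmegaStone.{u}, W.IsPrimitive → W.theta ∈ EPS) ∧
    (∀ c ∈ EPS.{u}, ∃ W : OmegaStone.{u}, W.IsPrimitive ∧ W.theta = c) ∧
    ∃ Θ : OmegaStoneClass.{u} → POTripleClass.{u},
      (∀ W : OmegaStone.{u}, W.IsPrimitive → Θ ⟦W⟧ = W.theta) ∧
      Set.BijOn Θ (classesOf OmegaStone.IsCompactPrimitive) compactTypes ∧
      Set.BijOn Θ (classesOf OmegaStone.IsFinitary) finitaryTypes ∧
      Set.BijOn Θ (classesOf OmegaStone.IsBounded) boundedTypes := by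
  -- `Θ` applies `theta` to a chosen representative; on classes of primitive spaces the choice does
  -- not matter.
  have hΘ : ∀ W : OmegaStone.{u}, W.IsPrimitive →
      (Quotient.out (⟦W⟧ : OmegaStoneClass.{u})).theta = W.theta := by
    intro W hW
    obtain ⟨h⟩ : Nonempty (_ ≃ₜ W.carrier) := Quotient.mk_out W
    exact hW.theta_eq_of_homeomorph h
  refine ⟨fun W hW => hW.theta_mem_EPS, ?_, fun c => c.out.theta, hΘ, ?_, ?_, ?_⟩
  · rintro _ ⟨E, hE, hc, hs, rfl⟩
    obtain ⟨W, hW, hθ, -⟩ := OmegaStone.exists_theta_eq hE hc hs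
    exact ⟨W, hW, hθ⟩
  · exact OmegaStone.bijOn_classesOf hΘ (fun W hW => by
      have := hW.2
      exact hW.1.isBounded_of_compactSpace) (fun W hW => hW.theta_mem)
      fun c hc => OmegaStone.exists_isCompactPrimitive_of_mem hc
  · exact OmegaStone.bijOn_classesOf hΘ (fun W hW => by
      have := hW.2
      exact hW.1.isBounded_of_finite) (fun W hW => hW.theta_mem)
      fun c hc => OmegaStone.exists_isFinitary_of_mem hc
  · exact OmegaStone.bijOn_classesOf hΘ (fun W hW => hW) (fun W hW => hW.theta_mem)
      fun c hc => OmegaStone.exists_isBounded_of_mem hc
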